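/- Let $U_s:[0,1]\to\mathbb R$ be smooth and strictly concave, in the sense that $U_s''<0$ on $[0,1]$. For $\omega\in L^2((0,1))$ (complex valued) let $\Phi[\omega]\in H^2((0,1))$ denote the solution of the Dirichlet problem $\partial_y^2\Phi[\omega]=\omega$ on $(0,1)$, $\Phi[\omega]|_{y=0}=\Phi[\omega]|_{y=1}=0$, and set $\mathcal U[\omega]=(\partial_y\Phi[\omega](0),\partial_y\Phi[\omega](1))$ and $H=\{\omega\in L^2((0,1)):\ \mathcal U[\omega]=0\}$, equipped with the $L^2$ norm. Then there exist positive constants $K_*,k_0,M$, depending only on $U_s$, such that for all $k\in\mathbb R$ with $|k|\ge k_0$, all $\lambda\in\mathbb C$ with $\operatorname{Re}\lambda\ge K_*|k|^{2/3}$ and all $\hat\omega_{init}\in H$, the resolvent equation $$\lambda\hat\omega+ikU_s\hat\omega-ikU_s''\,\Phi[\hat\omega]-\partial_y^2\hat\omega=\hat\omega_{init}\quad\text{in }(0,1),\qquad \mathcal U[\hat\omega]=0,$$ has a unique solution $\hat\omega\in H^2((0,1))$, and it satisfies $$\|\hat\omega\|_{L^2}\le M\,|\lambda|^{1/4}\,|k|^{-2/3}\,\|\hat\omega_{init}\|_{L^2}.$$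 -/

import Mathlib

open MeasureTheory Set

noncomputable section

namespace HydrostaticNS

/-- The complex Hilbert space `L²((0,1))`. -/
abbrev L2 : Type := Lp ℂ 2 (volume.restrict (Ioo (0 : ℝ) 1))

/-- `Φ` solves the Dirichlet problem `Φ'' = ω` on `(0,1)`, `Φ(0) = Φ(1) = 0`: it is differentiable
on `[0,1]` and its derivative `u` is a primitive of `ω` there (so `Φ ∈ H²` if `ω ∈ L²`). -/
def IsDirichletSolution (ω Φ : ℝ → ℂ) : Prop :=
  Φ 0 = 0 ∧ Φ 1 = 0 ∧
    ∃ u : ℝ → ℂ, (∀ y ∈ Icc (0 : ℝ) 1, HasDerivWithinAt Φ (u y) (Icc 0 1) y) ∧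
      ∀ y ∈ Icc (0 : ℝ) 1, u y = u 0 + ∫ s in (0 : ℝ)..y, ω s

/-- The velocity `u = Φ[ω]'`: the primitive of `ω` with zero mean over `(0,1)`. -/
def velocity (ω : ℝ → ℂ) (y : ℝ) : ℂ :=
  (∫ s in (0 : ℝ)..y, ω s) - ∫ t in (0 : ℝ)..1, ∫ s in (0 : ℝ)..t, ω s

/-- The stream function `Φ[ω]`; by `isDirichletSolution_streamFunction` and
`IsDirichletSolution.eqOn` it is the one and only solution of the Dirichlet problem
`Φ'' = ω`, `Φ(0) = Φ(1) = 0`. -/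
def streamFunction (ω : ℝ → ℂ) (y : ℝ) : ℂ :=
  ∫ t in (0 : ℝ)..y, velocity ω t

theorem intervalIntegrable_coe (ω : L2) : IntervalIntegrable ω volume 0 1 := by
  have h : Integrable ω (volume.restrict (Ioo (0 : ℝ) 1)) :=
    (Lp.memLp ω).integrable (by norm_num)
  rw [intervalIntegrable_iff_integrableOn_Ioo_of_le zero_le_one]
  exact h

theorem continuousOn_velocity {ω : ℝ → ℂ} (hω : IntervalIntegrable ω volume 0 1) :
    ContinuousOn (velocity ω) (Icc 0 1) := by
  have h := intervalIntegral.continuousOn_primitive_interval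
    (f := ω) (μ := volume) (a := 0) (b := 1) (by
      rw [uIcc_of_le zero_le_one, integrableOn_Icc_iff_integrableOn_Ioc]
      exact (intervalIntegrable_iff_integrableOn_Ioc_of_le zero_le_one).1 hω)
  rw [uIcc_of_le zero_le_one] at h
  exact h.sub continuousOn_const

theorem hasDerivWithinAt_streamFunction {ω : ℝ → ℂ} (hω : IntervalIntegrable ω volume 0 1)
    {y : ℝ} (hy : y ∈ Icc (0 : ℝ) 1) :
    HasDerivWithinAt (streamFunction ω) (velocity ω y) (Icc 0 1) y := by
  have hc := continuousOn_velocity hω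
  have : Fact (y ∈ Icc (0 : ℝ) 1) := ⟨hy⟩
  refine intervalIntegral.integral_hasDerivWithinAt_right (s := Icc 0 1) (t := Icc 0 1) ?_ ?_
    (hc y hy)
  · refine ContinuousOn.intervalIntegrable (hc.mono ?_)
    rw [uIcc_of_le hy.1]
    exact Icc_subset_Icc_right hy.2
  · exact hc.stronglyMeasurableAtFilter_nhdsWithin measurableSet_Icc y

theorem isDirichletSolution_streamFunction {ω : ℝ → ℂ} (hω : IntervalIntegrable ω volume 0 1) :
    IsDirichletSolution ω (streamFunction ω) := by
  refine ⟨by simp [streamFunction], ?_, velocity ω,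
    fun y hy => hasDerivWithinAt_streamFunction hω hy, fun y _ => ?_⟩
  · have h : IntervalIntegrable (fun t => ∫ s in (0 : ℝ)..t, ω s) volume 0 1 := by
      have h1 := (continuousOn_velocity hω).add
        (continuousOn_const (c := ∫ t in (0 : ℝ)..1, ∫ s in (0 : ℝ)..t, ω s))
      refine ContinuousOn.intervalIntegrable ?_
      rw [uIcc_of_le zero_le_one]
      refine h1.congr fun t _ => ?_
      simp [velocity]
    simp only [streamFunction, velocity]
    rw [intervalIntegral.integral_sub h intervalIntegrable_const]
    simp
  · simp only [velocity, intervalIntegral.integral_same]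
    ring

theorem IsDirichletSolution.eqOn {ω Φ Ψ : ℝ → ℂ} (hΦ : IsDirichletSolution ω Φ)
    (hΨ : IsDirichletSolution ω Ψ) : EqOn Φ Ψ (Icc 0 1) := by
  obtain ⟨h0, h1, u, hu, hu'⟩ := hΦ
  obtain ⟨g0, g1, v, hv, hv'⟩ := hΨ
  have key : ∀ y ∈ Icc (0 : ℝ) 1, Φ y - Ψ y - y * (u 0 - v 0) = 0 := by
    have hd : ∀ y ∈ Icc (0 : ℝ) 1,
        HasDerivWithinAt (fun y : ℝ => Φ y - Ψ y - y * (u 0 - v 0)) 0 (Icc 0 1) y := by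
      intro y hy
      have h2 := ((hu y hy).sub (hv y hy)).sub
        (((hasDerivAt_id y).ofReal_comp.hasDerivWithinAt (s := Icc 0 1)).mul_const (u 0 - v 0))
      refine h2.congr_deriv ?_
      rw [hu' y hy, hv' y hy]
      simp
    intro y hy
    have h3 := (convex_Icc (0 : ℝ) 1).norm_image_sub_le_of_norm_hasDerivWithin_le
      (C := 0) hd (fun _ _ => by simp) (left_mem_Icc.2 zero_le_one) hy
    simp only [zero_mul, norm_le_zero_iff] at h3
    simpa [h0, g0] using h3
  have hz : u 0 - v 0 = 0 := by
    have := key 1 (right_mem_Icc.2 zero_le_one)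
    simp only [h1, g1, Complex.ofReal_one] at this
    linear_combination -this
  intro y hy
  have := key y hy
  rw [hz, mul_zero, sub_zero] at this
  exact sub_eq_zero.1 this

/-- `𝒰[ω] = (∂_y Φ[ω](0), ∂_y Φ[ω](1))`, with one-sided derivatives at the end points. -/
def boundaryVelocity (ω : L2) : ℂ × ℂ :=
  (derivWithin (streamFunction ω) (Icc 0 1) 0, derivWithin (streamFunction ω) (Icc 0 1) 1)

/-- These one-sided derivatives exist, and are the boundary values of the velocity. -/
theorem boundaryVelocity_eq (ω : L2) :
    boundaryVelocity ω = (velocity ω 0, velocity ω 1) := by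
  have hu := uniqueDiffOn_Icc (zero_lt_one (α := ℝ))
  have h (y : ℝ) (hy : y ∈ Icc (0 : ℝ) 1) :=
    (hasDerivWithinAt_streamFunction (intervalIntegrable_coe ω) hy).derivWithin (hu y hy)
  simp only [boundaryVelocity, h 0 (left_mem_Icc.2 zero_le_one), h 1 (right_mem_Icc.2 zero_le_one)]

/-- The data space `H = {ω ∈ L²((0,1)) : 𝒰[ω] = 0}`. -/
def H : Set L2 := {ω | boundaryVelocity ω = 0}

/-- `g ∈ L²((0,1))` is the second derivative of `ω ∈ L²((0,1))` in the sense of distributions on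
`(0,1)`. (On an interval, `ω ∈ H²((0,1))` if and only if such a `g` exists.) -/
def HasWeakSecondDeriv (ω g : L2) : Prop :=
  ∀ φ : ℝ → ℝ, ContDiff ℝ ((⊤ : ℕ∞) : WithTop ℕ∞) φ → HasCompactSupport φ → tsupport φ ⊆ Ioo 0 1 →
    ∫ y in Ioo (0 : ℝ) 1, ω y * ((deriv (deriv φ) y : ℝ) : ℂ) =
      ∫ y in Ioo (0 : ℝ) 1, g y * ((φ y : ℝ) : ℂ)

/-- `ω` is an `H²((0,1))` solution of the resolvent equation
`lam ω + i k U ω - i k U'' Φ[ω] - ω'' = f` on `(0,1)`, subject to `𝒰[ω] = 0`. -/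
def IsResolventSolution (U : ℝ → ℝ) (k : ℝ) (lam : ℂ) (f ω : L2) : Prop :=
  boundaryVelocity ω = 0 ∧
    ∃ ω₂ : L2, HasWeakSecondDeriv ω ω₂ ∧
      ∀ᵐ y ∂(volume.restrict (Ioo (0 : ℝ) 1)),
        lam * ω y + Complex.I * k * U y * ω y
          - Complex.I * k * ((iteratedDerivWithin 2 U (Icc 0 1) y : ℝ) : ℂ) * streamFunction ω y
          - ω₂ y = f y

end HydrostaticNS

end

/-! Write `p = λ + ikU`, `u = Φ'`, `v = ω'`, `r² = Re λ`, `l² = |λ|`, and let `n²` be the smaller of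
the values of `|p|` at the two ends.

The nonlocal term `ikU''Φ` is neutralised by concavity. Tested with `-ω̄/U''` the equation contains
`ikΦω̄`, and after an integration by parts this contributes only the imaginary quantity `-ik‖u‖²`.
Under the artificial condition `v = 0` at both ends the real part of the identity therefore gives
`r²‖ω‖ ≲ ‖f‖` without loss (`Sol.energy_re`, `Sol.neumann_bounds`). The loss in the theorem comes
from the true condition `u = 0`.

Integrating the equation once shows that a clamped solution whose force has zero mean satisfies
`v(0) = v(1)` (`Sol.flux_eq`). Hence `ω = ω₁ + v(0) ω_G`, where `ω₁` has force `f` and no vorticity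
flux, and `ω_G` has no force and flux one at both ends. By `exists_unit_flux`, `ω_G` consists of two
boundary layers and a small corrector, with `‖ω_G‖² ≲ n⁻³` and `|p(0)u_G(0)| ≥ 1/2`. The condition
`u(0) = 0` then gives `|v(0)| ≤ 2|p(0)u₁(0)|`. Everything reduces to `FluxBound`, that is
`|p(0)u₁(0)|² r⁴ ≲ n³ l ‖f‖²`: the powers of `n` cancel, `‖ω‖² r⁴ ≲ l‖f‖²` (`Regime.clamped_bound`),
and `r² ≥ |k|^(2/3)`.

`Profile.exists_fluxBound` distinguishes three cases. If `n ≲ l`, the bound `|u| ≤ ‖ω‖` at the ends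
suffices. Otherwise `|λ|` is small against `|k|`, `U` does not vanish at the ends, and `n ≳ √|k|`.
If moreover `U ≤ 0`, the imaginary part of the weighted identity controls `‖u‖`. If `U` is positive
somewhere, put `C₁ = p(0)u₁(0)`; the integrated equation `pu - ikU'Φ = v + ∫f + C₁` divided by `p²`
has the left side `(Φ/p)'`, of zero integral, so `C₁ ∫p⁻² = -∫(v + ∫f) p⁻²`. The right side is
estimated by the singular integral bounds for `Shear`, and `∫p⁻²` stays away from zero after
rescaling by `k²` (`Profile.exists_nondegenerate`).

Existence follows from uniqueness by shooting for the system `Sol`, and uniqueness from the estimate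
with `f = 0`. -/

noncomputable section

namespace HydrostaticNS

/-! ### Primitives on the unit interval -/

/-- `F` is a primitive of the integrable function `f` on `[0,1]`. -/
def IsPrim {E : Type*} [NormedAddCommGroup E] [NormedSpace ℝ E] (F f : ℝ → E) : Prop :=
  IntervalIntegrable f volume 0 1 ∧ ∀ y ∈ Icc (0 : ℝ) 1, F y = F 0 + ∫ s in (0 : ℝ)..y, f s

theorem zero_mem_unit : (0 : ℝ) ∈ Icc (0 : ℝ) 1 := ⟨le_rfl, zero_le_one⟩

theorem one_mem_unit : (1 : ℝ) ∈ Icc (0 : ℝ) 1 := ⟨zero_le_one, le_rfl⟩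

theorem uIcc_unit : uIcc (0 : ℝ) 1 = Icc 0 1 := uIcc_of_le zero_le_one

theorem intervalIntegrable_of_continuousOn {E : Type*} [NormedAddCommGroup E]
    {f : ℝ → E} (h : ContinuousOn f (Icc 0 1)) : IntervalIntegrable f volume 0 1 :=
  ContinuousOn.intervalIntegrable (by rwa [uIcc_unit])

theorem intervalIntegrable_sub {E : Type*} [NormedAddCommGroup E]
    {f : ℝ → E} (hf : IntervalIntegrable f volume 0 1) {a b : ℝ} (ha : a ∈ Icc (0 : ℝ) 1)
    (hb : b ∈ Icc (0 : ℝ) 1) : IntervalIntegrable f volume a b := by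
  refine hf.mono_set ?_
  rw [uIcc_unit]
  exact uIcc_subset_Icc ha hb

theorem integral_congr_unit {E : Type*} [NormedAddCommGroup E] [NormedSpace ℝ E] {f g : ℝ → E}
    (h : ∀ y ∈ Icc (0 : ℝ) 1, f y = g y) : ∫ y in (0 : ℝ)..1, f y = ∫ y in (0 : ℝ)..1, g y :=
  intervalIntegral.integral_congr (by rwa [uIcc_unit])

theorem integral_mono_unit {f g : ℝ → ℝ} (hf : IntervalIntegrable f volume 0 1)
    (hg : IntervalIntegrable g volume 0 1) (h : ∀ y ∈ Icc (0 : ℝ) 1, f y ≤ g y) :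
    ∫ y in (0 : ℝ)..1, f y ≤ ∫ y in (0 : ℝ)..1, g y :=
  intervalIntegral.integral_mono_on zero_le_one hf hg h

theorem intervalIntegrable_congr_unit {E : Type*} [NormedAddCommGroup E] {f g : ℝ → E}
    (h : ∀ y ∈ Icc (0 : ℝ) 1, f y = g y) (hf : IntervalIntegrable f volume 0 1) :
    IntervalIntegrable g volume 0 1 :=
  hf.congr fun y hy => h y (by
    rw [uIoc_of_le zero_le_one] at hy
    exact Ioc_subset_Icc_self hy)

namespace IsPrim

section basic
variable {E : Type*} [NormedAddCommGroup E] [NormedSpace ℝ E] {F G f g : ℝ → E}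

theorem sub_eq (h : IsPrim F f) {a b : ℝ} (ha : a ∈ Icc (0 : ℝ) 1) (hb : b ∈ Icc (0 : ℝ) 1) :
    F b - F a = ∫ s in a..b, f s := by
  rw [h.2 a ha, h.2 b hb, add_sub_add_left_eq_sub,
    intervalIntegral.integral_interval_sub_left (intervalIntegrable_sub h.1 zero_mem_unit hb)
      (intervalIntegrable_sub h.1 zero_mem_unit ha)]

theorem integral_eq (h : IsPrim F f) : ∫ s in (0 : ℝ)..1, f s = F 1 - F 0 :=
  (h.sub_eq zero_mem_unit one_mem_unit).symm

theorem continuousOn (h : IsPrim F f) : ContinuousOn F (Icc 0 1) := by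
  have h1 := intervalIntegral.continuousOn_primitive_interval
    (f := f) (μ := volume) (a := 0) (b := 1) (by
      rw [uIcc_unit, integrableOn_Icc_iff_integrableOn_Ioc]
      exact (intervalIntegrable_iff_integrableOn_Ioc_of_le zero_le_one).1 h.1)
  rw [uIcc_unit] at h1
  exact (continuousOn_const.add h1).congr h.2

theorem intervalIntegrable (h : IsPrim F f) : IntervalIntegrable F volume 0 1 :=
  intervalIntegrable_of_continuousOn h.continuousOn

theorem congr_left (h : IsPrim F f) (hG : ∀ y ∈ Icc (0 : ℝ) 1, G y = F y) : IsPrim G f :=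
  ⟨h.1, fun y hy => by rw [hG y hy, hG 0 zero_mem_unit, h.2 y hy]⟩

theorem congr_right (h : IsPrim F f) (hg : ∀ y ∈ Icc (0 : ℝ) 1, g y = f y) : IsPrim F g :=
  ⟨intervalIntegrable_congr_unit (fun y hy => (hg y hy).symm) h.1, fun y hy => by
    rw [h.2 y hy]
    congr 1
    refine intervalIntegral.integral_congr fun s hs => (hg s ?_).symm
    rw [uIcc_of_le hy.1] at hs
    exact ⟨hs.1, hs.2.trans hy.2⟩⟩

theorem congr_ae (h : IsPrim F f) (hg : ∀ᵐ y ∂(volume.restrict (Ioc (0 : ℝ) 1)), g y = f y) :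
    IsPrim F g := by
  have hg' : f =ᵐ[volume.restrict (uIoc (0 : ℝ) 1)] g := by
    rw [uIoc_of_le zero_le_one]
    filter_upwards [hg] with y hy using hy.symm
  refine ⟨h.1.congr_ae hg', fun y hy => ?_⟩
  rw [h.2 y hy]
  congr 1
  refine intervalIntegral.integral_congr_ae ?_
  rw [← ae_restrict_iff' measurableSet_uIoc]
  refine ae_restrict_of_ae_restrict_of_subset ?_ hg'
  rw [uIoc_of_le zero_le_one, uIoc_of_le hy.1]
  exact Ioc_subset_Ioc_right hy.2

theorem of_integrable (hf : IntervalIntegrable f volume 0 1) (c : E) :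
    IsPrim (fun y => c + ∫ s in (0 : ℝ)..y, f s) f :=
  ⟨hf, fun y _ => by simp⟩

theorem const (c : E) : IsPrim (fun _ => c) (fun _ => 0) :=
  ⟨by simp, fun y _ => by simp⟩

theorem add (hF : IsPrim F f) (hG : IsPrim G g) :
    IsPrim (fun y => F y + G y) (fun y => f y + g y) :=
  ⟨hF.1.add hG.1, fun y hy => by
    beta_reduce
    rw [intervalIntegral.integral_add (intervalIntegrable_sub hF.1 zero_mem_unit hy)
      (intervalIntegrable_sub hG.1 zero_mem_unit hy), hF.2 y hy, hG.2 y hy]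
    abel⟩

theorem neg (hF : IsPrim F f) : IsPrim (fun y => -F y) (fun y => -f y) :=
  ⟨hF.1.neg, fun y hy => by
    beta_reduce
    rw [intervalIntegral.integral_neg, hF.2 y hy]
    abel⟩

theorem sub (hF : IsPrim F f) (hG : IsPrim G g) :
    IsPrim (fun y => F y - G y) (fun y => f y - g y) := by
  simpa only [sub_eq_add_neg] using hF.add hG.neg

theorem of_hasDerivWithinAt (hd : ∀ y ∈ Icc (0 : ℝ) 1, HasDerivWithinAt F (f y) (Icc 0 1) y)
    [CompleteSpace E] (hc : ContinuousOn f (Icc 0 1)) : IsPrim F f := by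
  refine ⟨intervalIntegrable_of_continuousOn hc, fun y hy => ?_⟩
  rw [intervalIntegral.integral_eq_sub_of_hasDerivAt_of_le hy.1]
  · abel
  · exact fun x hx => ((hd x ⟨hx.1, hx.2.trans hy.2⟩).continuousWithinAt).mono
      (Icc_subset_Icc_right hy.2)
  · exact fun x hx => (hd x ⟨hx.1.le, hx.2.le.trans hy.2⟩).hasDerivAt
      (Icc_mem_nhds hx.1 (hx.2.trans_le hy.2))
  · exact intervalIntegrable_sub (intervalIntegrable_of_continuousOn hc) zero_mem_unit hy

theorem hasDerivWithinAt [CompleteSpace E] (hF : IsPrim F f) (hc : ContinuousOn f (Icc 0 1))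
    {y : ℝ} (hy : y ∈ Icc (0 : ℝ) 1) : HasDerivWithinAt F (f y) (Icc 0 1) y := by
  have : Fact (y ∈ Icc (0 : ℝ) 1) := ⟨hy⟩
  have h : HasDerivWithinAt (fun t => F 0 + ∫ s in (0 : ℝ)..t, f s) (f y) (Icc 0 1) y := by
    refine HasDerivWithinAt.const_add _ ?_
    exact intervalIntegral.integral_hasDerivWithinAt_right (s := Icc 0 1) (t := Icc 0 1)
      (intervalIntegrable_sub hF.1 zero_mem_unit hy)
      (hc.stronglyMeasurableAtFilter_nhdsWithin measurableSet_Icc y) (hc y hy)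
  exact h.congr hF.2 (hF.2 y hy)

theorem comp_clm {E' : Type*} [NormedAddCommGroup E'] [NormedSpace ℝ E'] [CompleteSpace E]
    [CompleteSpace E']
    (T : E →L[ℝ] E') (hF : IsPrim F f) : IsPrim (fun y => T (F y)) (fun y => T (f y)) :=
  ⟨⟨T.integrable_comp hF.1.1, T.integrable_comp hF.1.2⟩, fun y hy => by
    beta_reduce
    rw [T.intervalIntegral_comp_comm (intervalIntegrable_sub hF.1 zero_mem_unit hy), hF.2 y hy,
      map_add]⟩

/-- Each increment of `F` is dominated by the increment of the primitive of `‖f‖`. -/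
theorem absolutelyContinuousOnInterval (hF : IsPrim F f) :
    AbsolutelyContinuousOnInterval F 0 1 := by
  have hP := hF.1.norm.absolutelyContinuousOnInterval_intervalIntegral
    (c := 0) (by simp)
  unfold AbsolutelyContinuousOnInterval at hP ⊢
  refine squeeze_zero' (Filter.Eventually.of_forall fun _ =>
    Finset.sum_nonneg fun _ _ => dist_nonneg) ?_ hP
  rw [Filter.eventually_inf_principal]
  filter_upwards with ⟨n, I⟩ hnI
  simp only [AbsolutelyContinuousOnInterval.disjWithin, uIcc_unit] at hnI
  refine Finset.sum_le_sum fun i hi => ?_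
  obtain ⟨h1, h2⟩ := hnI.1 i hi
  rw [dist_comm, dist_eq_norm, hF.sub_eq h1 h2, dist_comm, Real.dist_eq,
    intervalIntegral.integral_interval_sub_left (intervalIntegrable_sub hF.1.norm zero_mem_unit h2)
      (intervalIntegrable_sub hF.1.norm zero_mem_unit h1)]
  exact intervalIntegral.norm_integral_le_abs_integral_norm

end basic

section mul
variable {𝕜 : Type*} [RCLike 𝕜] {F G f g : ℝ → 𝕜}

theorem const_mul (c : 𝕜) (hF : IsPrim F f) : IsPrim (fun y => c * F y) (fun y => c * f y) :=
  ⟨hF.1.const_mul c, fun y hy => by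
    beta_reduce
    rw [intervalIntegral.integral_const_mul, hF.2 y hy, mul_add]⟩

theorem ae_hasDerivAt (hF : IsPrim F f) :
    ∀ᵐ x, x ∈ Icc (0 : ℝ) 1 → HasDerivAt F (f x) x := by
  have h0 : ∀ᵐ x : ℝ, x ≠ 0 := by simp [ae_iff, measure_singleton]
  have h1 : ∀ᵐ x : ℝ, x ≠ 1 := by simp [ae_iff, measure_singleton]
  filter_upwards [hF.1.ae_hasDerivAt_integral, h0, h1] with x hx hx0 hx1 hxI
  rw [uIcc_unit] at hx
  have h := (hx hxI 0 zero_mem_unit).const_add (F 0)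
  refine h.congr_of_eventuallyEq ?_
  filter_upwards [Icc_mem_nhds (lt_of_le_of_ne hxI.1 hx0.symm) (lt_of_le_of_ne hxI.2 hx1)]
    with y hy using hF.2 y hy

/-- The factors are merely absolutely continuous, so Leibniz' rule holds only almost everywhere. The
product minus the primitive of its formal derivative is absolutely continuous with derivative zero
almost everywhere, hence constant. -/
theorem mul (hF : IsPrim F f) (hG : IsPrim G g) :
    IsPrim (fun y => F y * G y) (fun y => f y * G y + F y * g y) := by
  have hi : IntervalIntegrable (fun y => f y * G y + F y * g y) volume 0 1 :=
    (hF.1.mul_continuousOn (by rw [uIcc_unit]; exact hG.continuousOn)).add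
      (hG.1.continuousOn_mul (by rw [uIcc_unit]; exact hF.continuousOn))
  have hP := of_integrable hi 0
  have hac : AbsolutelyContinuousOnInterval
      (fun y => F y * G y - (0 + ∫ s in (0 : ℝ)..y, (f s * G s + F s * g s))) 0 1 :=
    (hF.absolutelyContinuousOnInterval.smul hG.absolutelyContinuousOnInterval).sub
      hP.absolutelyContinuousOnInterval
  obtain ⟨C, hC⟩ := hac.const_of_ae_hasDerivAt_zero (by
    filter_upwards [hF.ae_hasDerivAt, hG.ae_hasDerivAt, hP.ae_hasDerivAt] with x h1 h2 h3 hx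
    rw [uIcc_unit] at hx
    have h := ((h1 hx).mul (h2 hx)).sub (h3 hx)
    rw [sub_self] at h
    exact h)
  rw [uIcc_unit] at hC
  refine ⟨hi, fun y hy => ?_⟩
  have e1 := hC y hy
  have e0 := hC 0 zero_mem_unit
  simp only [intervalIntegral.integral_same, zero_add, add_zero, sub_zero] at e0 e1
  beta_reduce
  rw [e0, ← e1]
  ring

end mul

theorem conj {F f : ℝ → ℂ} (hF : IsPrim F f) :
    IsPrim (fun y => starRingEnd ℂ (F y)) (fun y => starRingEnd ℂ (f y)) :=
  hF.comp_clm (Complex.conjCLE : ℂ →L[ℝ] ℂ)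

theorem ofReal {F f : ℝ → ℝ} (hF : IsPrim F f) :
    IsPrim (fun y => (F y : ℂ)) (fun y => (f y : ℂ)) :=
  hF.comp_clm Complex.ofRealCLM

theorem re {F f : ℝ → ℂ} (hF : IsPrim F f) : IsPrim (fun y => (F y).re) (fun y => (f y).re) :=
  hF.comp_clm Complex.reCLM

theorem id : IsPrim (fun y : ℝ => y) (fun _ => 1) :=
  ⟨by simp, fun y _ => by simp⟩

end IsPrim

/-! ### Square integrable functions on the unit interval -/

/-- Square integrability on `(0,1)`. -/
def SqInt (f : ℝ → ℂ) : Prop := MemLp f 2 (volume.restrict (Ioc (0 : ℝ) 1))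

/-- The square of the norm of `L²((0,1))`. -/
def normSq (f : ℝ → ℂ) : ℝ := ∫ y in (0 : ℝ)..1, ‖f y‖ ^ 2

theorem normSq_nonneg (f : ℝ → ℂ) : 0 ≤ normSq f :=
  intervalIntegral.integral_nonneg zero_le_one fun _ _ => by positivity

theorem integrable_iff_unit {E : Type*} [NormedAddCommGroup E] {f : ℝ → E} :
    IntervalIntegrable f volume 0 1 ↔ Integrable f (volume.restrict (Ioc (0 : ℝ) 1)) :=
  intervalIntegrable_iff_integrableOn_Ioc_of_le zero_le_one

theorem sqInt_of_continuousOn {f : ℝ → ℂ} (h : ContinuousOn f (Icc 0 1)) : SqInt f := by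
  obtain ⟨C, hC⟩ := isCompact_Icc.exists_bound_of_continuousOn h
  refine MemLp.of_bound (integrable_iff_unit.1
    (intervalIntegrable_of_continuousOn h)).aestronglyMeasurable C ?_
  filter_upwards [ae_restrict_mem measurableSet_Ioc] with y hy using hC y (Ioc_subset_Icc_self hy)

namespace SqInt
variable {f g : ℝ → ℂ}

theorem intervalIntegrable (hf : SqInt f) : IntervalIntegrable f volume 0 1 :=
  integrable_iff_unit.2 (MemLp.integrable (by norm_num) hf)

theorem intervalIntegrable_sq (hf : SqInt f) :
    IntervalIntegrable (fun y => ‖f y‖ ^ 2) volume 0 1 :=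
  integrable_iff_unit.2 (MemLp.integrable_norm_pow hf (by norm_num))

theorem intervalIntegrable_mul (hf : SqInt f) (hg : SqInt g) :
    IntervalIntegrable (fun y => ‖f y‖ * ‖g y‖) volume 0 1 :=
  integrable_iff_unit.2 (MemLp.integrable_mul (MemLp.norm hf) (MemLp.norm hg))

/-- The Cauchy–Schwarz inequality. -/
theorem integral_mul_le (hf : SqInt f) (hg : SqInt g) :
    ∫ y in (0 : ℝ)..1, ‖f y‖ * ‖g y‖ ≤ √(normSq f) * √(normSq g) := by
  have h := integral_mul_norm_le_Lp_mul_Lq (μ := volume.restrict (Ioc (0 : ℝ) 1)) (f := f) (g := g)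
    Real.HolderConjugate.two_two (by simpa [SqInt] using hf) (by simpa [SqInt] using hg)
  simp only [Real.rpow_ofNat] at h
  rw [normSq, normSq, Real.sqrt_eq_rpow, Real.sqrt_eq_rpow,
    intervalIntegral.integral_of_le zero_le_one, intervalIntegral.integral_of_le zero_le_one,
    intervalIntegral.integral_of_le zero_le_one]
  exact h

theorem integral_norm_le (hf : SqInt f) : ∫ y in (0 : ℝ)..1, ‖f y‖ ≤ √(normSq f) := by
  have h := hf.integral_mul_le (g := fun _ => 1) (sqInt_of_continuousOn continuousOn_const)
  simpa [normSq] using h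

theorem add (hf : SqInt f) (hg : SqInt g) : SqInt (fun y => f y + g y) := MemLp.add hf hg

theorem const_mul (hf : SqInt f) (c : ℂ) : SqInt (fun y => c * f y) := MemLp.const_mul hf c

theorem normSq_add_le (hf : SqInt f) (hg : SqInt g) :
    normSq (fun y => f y + g y) ≤ 2 * normSq f + 2 * normSq g := by
  have h := intervalIntegral.integral_mono_on zero_le_one (hf.add hg).intervalIntegrable_sq
    ((hf.intervalIntegrable_sq.const_mul 2).add (hg.intervalIntegrable_sq.const_mul 2))
    (fun y _ => show ‖f y + g y‖ ^ 2 ≤ 2 * ‖f y‖ ^ 2 + 2 * ‖g y‖ ^ 2 by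
      nlinarith [norm_add_le (f y) (g y), norm_nonneg (f y + g y), norm_nonneg (f y),
        norm_nonneg (g y), sq_nonneg (‖f y‖ - ‖g y‖)])
  rw [intervalIntegral.integral_add (hf.intervalIntegrable_sq.const_mul 2)
    (hg.intervalIntegrable_sq.const_mul 2), intervalIntegral.integral_const_mul,
    intervalIntegral.integral_const_mul] at h
  exact h

end SqInt

theorem normSq_const_mul (c : ℂ) (f : ℝ → ℂ) :
    normSq (fun y => c * f y) = ‖c‖ ^ 2 * normSq f := by
  simp only [normSq, norm_mul, mul_pow, intervalIntegral.integral_const_mul]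

theorem normSq_le_of_bound {f : ℝ → ℂ} {C : ℝ} (hf : ContinuousOn f (Icc 0 1))
    (h : ∀ y ∈ Icc (0 : ℝ) 1, ‖f y‖ ≤ C) : normSq f ≤ C ^ 2 := by
  have := integral_mono_unit (sqInt_of_continuousOn hf).intervalIntegrable_sq
    (intervalIntegrable_const (c := C ^ 2))
    (fun y hy => pow_le_pow_left₀ (norm_nonneg _) (h y hy) 2)
  simpa [normSq] using this

theorem norm_integral_unit_le {E : Type*} [NormedAddCommGroup E] [NormedSpace ℝ E] (f : ℝ → E) :
    ‖∫ y in (0 : ℝ)..1, f y‖ ≤ ∫ y in (0 : ℝ)..1, ‖f y‖ :=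
  intervalIntegral.norm_integral_le_integral_norm zero_le_one

namespace IsPrim
variable {F f : ℝ → ℂ}

theorem sqInt (h : IsPrim F f) : SqInt F := sqInt_of_continuousOn h.continuousOn

/-- The one-dimensional Sobolev inequality. -/
theorem norm_sq_le (h : IsPrim F f) (hf : SqInt f) {y : ℝ} (hy : y ∈ Icc (0 : ℝ) 1) :
    ‖F y‖ ^ 2 ≤ normSq F + 2 * (√(normSq F) * √(normSq f)) := by
  have hP := (h.mul h.conj).re
  -- This compares `y` with an arbitrary point `z`; averaging over `z` turns `‖F z‖ ^ 2` into
  -- `normSq F`.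
  have hle : ∀ z ∈ Icc (0 : ℝ) 1, ‖F y‖ ^ 2 ≤ ‖F z‖ ^ 2 + 2 * (√(normSq F) * √(normSq f)) := by
    intro z hz
    have e := hP.sub_eq hz hy
    have e2 (x : ℝ) : (F x * starRingEnd ℂ (F x)).re = ‖F x‖ ^ 2 := by
      rw [Complex.mul_conj, Complex.ofReal_re, Complex.normSq_eq_norm_sq]
    rw [e2, e2] at e
    have hb : ‖∫ s in z..y, (f s * starRingEnd ℂ (F s) + F s * starRingEnd ℂ (f s)).re‖
        ≤ 2 * (√(normSq F) * √(normSq f)) := by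
      refine (intervalIntegral.norm_integral_le_integral_norm_uIoc).trans ?_
      have hi := (h.sqInt.intervalIntegrable_mul hf).const_mul 2
      calc ∫ s in uIoc z y, ‖(f s * starRingEnd ℂ (F s) + F s * starRingEnd ℂ (f s)).re‖
          ≤ ∫ s in Ioc 0 1, ‖(f s * starRingEnd ℂ (F s) + F s * starRingEnd ℂ (f s)).re‖ := by
            refine setIntegral_mono_set (integrable_iff_unit.1 hP.1.norm)
              (Filter.Eventually.of_forall fun _ => norm_nonneg _)
              (LE.le.eventuallyLE ?_)
            exact Ioc_subset_Ioc (le_min hz.1 hy.1) (max_le hz.2 hy.2)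
        _ ≤ ∫ s in Ioc 0 1, 2 * (‖F s‖ * ‖f s‖) := by
            refine integral_mono (integrable_iff_unit.1 hP.1.norm) (integrable_iff_unit.1 hi) ?_
            intro s
            refine (Complex.abs_re_le_norm _).trans ((norm_add_le _ _).trans (le_of_eq ?_))
            simp only [norm_mul, RCLike.norm_conj]
            ring
        _ ≤ _ := by
            rw [← intervalIntegral.integral_of_le zero_le_one, intervalIntegral.integral_const_mul]
            linarith [h.sqInt.integral_mul_le hf]
    have := (Real.le_norm_self _).trans hb
    linarith
  have := integral_mono_unit (intervalIntegrable_const (c := ‖F y‖ ^ 2))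
    (h.sqInt.intervalIntegrable_sq.add (intervalIntegrable_const
      (c := 2 * (√(normSq F) * √(normSq f))))) hle
  rw [intervalIntegral.integral_add h.sqInt.intervalIntegrable_sq intervalIntegrable_const] at this
  simpa [normSq] using this

end IsPrim

/-! ### Existence for linear boundary value problems -/

/-- A Volterra integral equation with a Lipschitz nonlinearity is solvable on `[0,1]`. -/
theorem exists_volterra {E : Type*} [NormedAddCommGroup E] [NormedSpace ℝ E] [CompleteSpace E]
    {g : ℝ → E → E} (hg : Continuous (Function.uncurry g)) {M : ℝ} (hM : 0 ≤ M)
    (hL : ∀ s x y, ‖g s x - g s y‖ ≤ M * ‖x - y‖) {b : ℝ → E} (hb : Continuous b) :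
    ∃ x : ℝ → E, Continuous x ∧ ∀ y ∈ Icc (0 : ℝ) 1, x y = b y + ∫ s in (0 : ℝ)..y, g s (x s) := by
  -- Conjugation by `exp (-κ y)` makes the integral operator a contraction on the whole interval at
  -- once, with constant at most `M / κ ≤ 1 / 2`.
  set κ : ℝ := 2 * M + 1 with hκ
  have hκ0 : 0 < κ := by positivity
  let pr : ℝ → Icc (0 : ℝ) 1 := projIcc 0 1 zero_le_one
  have hpr : Continuous pr := continuous_projIcc
  let I : C(Icc (0 : ℝ) 1, E) → ℝ → E := fun z s => g s (Real.exp (κ * s) • z (pr s))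
  have hI (z : C(Icc (0 : ℝ) 1, E)) : Continuous (I z) := by
    have : Continuous fun s : ℝ => (s, Real.exp (κ * s) • z (pr s)) := by fun_prop
    exact hg.comp this
  have hJ (z : C(Icc (0 : ℝ) 1, E)) : Continuous fun y : ℝ => ∫ s in (0 : ℝ)..y, I z s :=
    intervalIntegral.continuous_primitive (fun a b => (hI z).intervalIntegrable a b) 0
  let T : C(Icc (0 : ℝ) 1, E) → C(Icc (0 : ℝ) 1, E) := fun z =>
    ⟨fun y => Real.exp (-(κ * y)) • (b y + ∫ s in (0 : ℝ)..y, I z s), by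
      have := (hJ z).comp (continuous_subtype_val (p := fun y => y ∈ Icc (0 : ℝ) 1))
      have h2 := hb.comp (continuous_subtype_val (p := fun y => y ∈ Icc (0 : ℝ) 1))
      exact Continuous.smul (by fun_prop) (h2.add this)⟩
  have hT : ContractingWith (1 / 2) T := by
    refine ⟨by norm_num, LipschitzWith.of_dist_le_mul fun z w => ?_⟩
    rw [ContinuousMap.dist_le (by positivity)]
    intro y
    have hy := y.2
    have hD : 0 ≤ dist z w := dist_nonneg
    have h1 : ‖∫ s in (0 : ℝ)..y, (I z s - I w s)‖
        ≤ ∫ s in (0 : ℝ)..y, M * dist z w * Real.exp (κ * s) := by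
      refine intervalIntegral.norm_integral_le_of_norm_le hy.1 ?_
        (Continuous.intervalIntegrable (by fun_prop) _ _)
      refine Filter.Eventually.of_forall fun s _ => (hL _ _ _).trans ?_
      rw [← smul_sub, norm_smul, Real.norm_eq_abs, Real.abs_exp, ← dist_eq_norm]
      have := ContinuousMap.dist_apply_le_dist (f := z) (g := w) (pr s)
      have h3 := mul_le_mul_of_nonneg_left this (mul_nonneg hM (Real.exp_pos (κ * s)).le)
      linarith
    have h2 : ∫ s in (0 : ℝ)..y, M * dist z w * Real.exp (κ * s)
        = M * dist z w * ((Real.exp (κ * y) - 1) / κ) := by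
      rw [intervalIntegral.integral_const_mul,
        intervalIntegral.integral_comp_mul_left (fun x => Real.exp x) hκ0.ne', integral_exp]
      simp [div_eq_inv_mul]
    have e : T z y - T w y = Real.exp (-(κ * y)) • ∫ s in (0 : ℝ)..y, (I z s - I w s) := by
      rw [intervalIntegral.integral_sub ((hI z).intervalIntegrable _ _)
        ((hI w).intervalIntegrable _ _)]
      change Real.exp (-(κ * y)) • (b y + ∫ s in (0 : ℝ)..y, I z s)
        - Real.exp (-(κ * y)) • (b y + ∫ s in (0 : ℝ)..y, I w s) = _
      rw [← smul_sub, add_sub_add_left_eq_sub]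
    rw [dist_eq_norm, e, norm_smul, Real.norm_eq_abs, Real.abs_exp]
    have h4 : Real.exp (-(κ * y)) * (Real.exp (κ * y) - 1) ≤ 1 := by
      rw [mul_sub, ← Real.exp_add]
      simp [(Real.exp_pos _).le]
    have h5 : M / κ ≤ 1 / 2 := by
      rw [div_le_div_iff₀ hκ0 two_pos]
      linarith
    calc _ ≤ Real.exp (-(κ * y)) * (M * dist z w * ((Real.exp (κ * y) - 1) / κ)) := by
          gcongr
          exact h1.trans h2.le
      _ = (M / κ) * dist z w * (Real.exp (-(κ * y)) * (Real.exp (κ * y) - 1)) := by ring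
      _ ≤ (M / κ) * dist z w * 1 := by gcongr
      _ ≤ 1 / 2 * dist z w := by
          rw [mul_one]
          gcongr
      _ = _ := by simp
  set z := hT.fixedPoint T
  have hz : T z = z := hT.fixedPoint_isFixedPt
  refine ⟨fun y => Real.exp (κ * y) • z (pr y), by fun_prop, fun y hy => ?_⟩
  have h6 : pr y = ⟨y, hy⟩ := projIcc_of_mem _ hy
  have h7 := congrArg (fun F : C(Icc (0 : ℝ) 1, E) => F ⟨y, hy⟩) hz
  change Real.exp (-(κ * y)) • (b y + ∫ s in (0 : ℝ)..y, I z s) = z ⟨y, hy⟩ at h7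
  beta_reduce
  rw [h6, ← h7, smul_smul, ← Real.exp_add]
  simp [I]

/-- The system of first order equations `Φ' = u`, `u' = ω`, `ω' = v`, `v' = p ω - q Φ - f`. -/
structure Sol (p q f Φ u ω v : ℝ → ℂ) : Prop where
  stream : IsPrim Φ u
  vel : IsPrim u ω
  vort : IsPrim ω v
  flux : IsPrim v (fun y => p y * ω y - q y * Φ y - f y)

namespace Sol
variable {p q f f' Φ u ω v Φ' u' ω' v' : ℝ → ℂ}

theorem add (h : Sol p q f Φ u ω v) (h' : Sol p q f' Φ' u' ω' v') :
    Sol p q (fun y => f y + f' y) (fun y => Φ y + Φ' y) (fun y => u y + u' y)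
      (fun y => ω y + ω' y) (fun y => v y + v' y) :=
  ⟨h.stream.add h'.stream, h.vel.add h'.vel, h.vort.add h'.vort,
    (h.flux.add h'.flux).congr_right fun y _ => by ring⟩

theorem const_mul (c : ℂ) (h : Sol p q f Φ u ω v) :
    Sol p q (fun y => c * f y) (fun y => c * Φ y) (fun y => c * u y)
      (fun y => c * ω y) (fun y => c * v y) :=
  ⟨h.stream.const_mul c, h.vel.const_mul c, h.vort.const_mul c,
    (h.flux.const_mul c).congr_right fun y _ => by ring⟩

theorem congr_force (h : Sol p q f Φ u ω v) (hf : ∀ y ∈ Icc (0 : ℝ) 1, f' y = f y) :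
    Sol p q f' Φ u ω v :=
  ⟨h.stream, h.vel, h.vort, h.flux.congr_right fun y hy => by rw [hf y hy]⟩

theorem congr_coeff {q' : ℝ → ℂ} (h : Sol p q f Φ u ω v)
    (hf : ∀ y ∈ Icc (0 : ℝ) 1, q' y * Φ y + f' y = q y * Φ y + f y) :
    Sol p q' f' Φ u ω v :=
  ⟨h.stream, h.vel, h.vort, h.flux.congr_right fun y hy => by linear_combination -(hf y hy)⟩

end Sol

/-- The extension of a function on `[0,1]` which is constant outside of `[0,1]`. -/
def extendUnit (h : ℝ → ℂ) (y : ℝ) : ℂ := h (projIcc 0 1 zero_le_one y)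

theorem continuous_extendUnit {h : ℝ → ℂ} (hh : ContinuousOn h (Icc 0 1)) :
    Continuous (extendUnit h) :=
  hh.comp_continuous (continuous_subtype_val.comp continuous_projIcc)
    fun y => (projIcc 0 1 zero_le_one y).2

theorem extendUnit_of_mem (h : ℝ → ℂ) {y : ℝ} (hy : y ∈ Icc (0 : ℝ) 1) : extendUnit h y = h y := by
  rw [extendUnit, projIcc_of_mem _ hy]

/-- Solvability of the initial value problem. -/
theorem exists_sol {p q f : ℝ → ℂ} (hp : ContinuousOn p (Icc 0 1)) (hq : ContinuousOn q (Icc 0 1))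
    (hf : IntervalIntegrable f volume 0 1) (Φ₀ u₀ ω₀ v₀ : ℂ) :
    ∃ Φ u ω v, Sol p q f Φ u ω v ∧ Φ 0 = Φ₀ ∧ u 0 = u₀ ∧ ω 0 = ω₀ ∧ v 0 = v₀ := by
  let p' : ℝ → ℂ := extendUnit p
  let q' : ℝ → ℂ := extendUnit q
  have hp' : Continuous p' := continuous_extendUnit hp
  have hq' : Continuous q' := continuous_extendUnit hq
  obtain ⟨P, hP⟩ := isCompact_Icc.exists_bound_of_continuousOn hp
  obtain ⟨Q, hQ⟩ := isCompact_Icc.exists_bound_of_continuousOn hq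
  have hP' (s : ℝ) : ‖p' s‖ ≤ P := hP _ (projIcc 0 1 zero_le_one s).2
  have hQ' (s : ℝ) : ‖q' s‖ ≤ Q := hQ _ (projIcc 0 1 zero_le_one s).2
  have hP0 : 0 ≤ P := (norm_nonneg _).trans (hP' 0)
  have hQ0 : 0 ≤ Q := (norm_nonneg _).trans (hQ' 0)
  let g : ℝ → ℂ × ℂ × ℂ × ℂ → ℂ × ℂ × ℂ × ℂ := fun s x =>
    (x.2.1, x.2.2.1, x.2.2.2, p' s * x.2.2.1 - q' s * x.1)
  have hg : Continuous (Function.uncurry g) := by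
    simp only [Function.uncurry_def, g]
    fun_prop
  have hL : ∀ s x y, ‖g s x - g s y‖ ≤ (1 + P + Q) * ‖x - y‖ := by
    intro s x y
    have a1 : ‖x.1 - y.1‖ ≤ ‖x - y‖ := norm_fst_le (x - y)
    have a0 : ‖(x - y).2‖ ≤ ‖x - y‖ := norm_snd_le (x - y)
    have a2 : ‖x.2.1 - y.2.1‖ ≤ ‖x - y‖ := (norm_fst_le (x - y).2).trans a0
    have a3' : ‖(x - y).2.2‖ ≤ ‖x - y‖ := (norm_snd_le (x - y).2).trans a0
    have a3 : ‖x.2.2.1 - y.2.2.1‖ ≤ ‖x - y‖ := (norm_fst_le (x - y).2.2).trans a3'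
    have a4 : ‖x.2.2.2 - y.2.2.2‖ ≤ ‖x - y‖ := (norm_snd_le (x - y).2.2).trans a3'
    have hn := norm_nonneg (x - y)
    have hle : ‖x - y‖ ≤ (1 + P + Q) * ‖x - y‖ := by nlinarith [mul_nonneg hP0 hn, mul_nonneg hQ0 hn]
    have a5 : ‖(p' s * x.2.2.1 - q' s * x.1) - (p' s * y.2.2.1 - q' s * y.1)‖
        ≤ (1 + P + Q) * ‖x - y‖ := by
      have : (p' s * x.2.2.1 - q' s * x.1) - (p' s * y.2.2.1 - q' s * y.1)
          = p' s * (x.2.2.1 - y.2.2.1) - q' s * (x.1 - y.1) := by ring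
      rw [this]
      refine (norm_sub_le _ _).trans ?_
      rw [norm_mul, norm_mul]
      have b1 := mul_le_mul (hP' s) a3 (norm_nonneg _) hP0
      have b2 := mul_le_mul (hQ' s) a1 (norm_nonneg _) hQ0
      linarith
    exact norm_prod_le_iff.2 ⟨a2.trans hle, norm_prod_le_iff.2 ⟨a3.trans hle,
      norm_prod_le_iff.2 ⟨a4.trans hle, a5⟩⟩⟩
  have hF := IsPrim.of_integrable hf 0
  -- The force is only integrable, so its continuous primitive goes into the inhomogeneity and not
  -- into the vector field.
  let b : ℝ → ℂ × ℂ × ℂ × ℂ := fun y =>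
    (Φ₀, u₀, ω₀, v₀ - extendUnit (fun y => 0 + ∫ s in (0 : ℝ)..y, f s) y)
  have hb : Continuous b := by
    have := continuous_extendUnit hF.continuousOn
    fun_prop
  obtain ⟨x, hx, hxe⟩ := exists_volterra hg (by positivity) hL hb
  have hgx : Continuous fun s => g s (x s) := hg.comp (by fun_prop : Continuous fun s => (s, x s))
  have hX : IsPrim (fun y => x y - b y) (fun s => g s (x s)) := by
    refine (IsPrim.of_integrable (hgx.intervalIntegrable 0 1) 0).congr_left fun y hy => ?_
    rw [hxe y hy]
    abel
  have hx0 : x 0 = (Φ₀, u₀, ω₀, v₀) := by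
    rw [hxe 0 zero_mem_unit]
    simp [b, extendUnit_of_mem _ zero_mem_unit]
  refine ⟨fun y => (x y).1, fun y => (x y).2.1, fun y => (x y).2.2.1, fun y => (x y).2.2.2,
    ⟨?_, ?_, ?_, ?_⟩, ?_, ?_, ?_, ?_⟩
  · have h := hX.comp_clm (ContinuousLinearMap.fst ℝ ℂ (ℂ × ℂ × ℂ))
    exact (h.add (IsPrim.const Φ₀)).congr_left (fun y _ => by simp [b]) |>.congr_right
      fun y _ => by simp [g]
  · have h := hX.comp_clm ((ContinuousLinearMap.fst ℝ ℂ (ℂ × ℂ)).comp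
      (ContinuousLinearMap.snd ℝ ℂ (ℂ × ℂ × ℂ)))
    exact (h.add (IsPrim.const u₀)).congr_left (fun y _ => by simp [b]) |>.congr_right
      fun y _ => by simp [g]
  · have h := hX.comp_clm ((ContinuousLinearMap.fst ℝ ℂ ℂ).comp
      ((ContinuousLinearMap.snd ℝ ℂ (ℂ × ℂ)).comp (ContinuousLinearMap.snd ℝ ℂ (ℂ × ℂ × ℂ))))
    exact (h.add (IsPrim.const ω₀)).congr_left (fun y _ => by simp [b]) |>.congr_right
      fun y _ => by simp [g]
  · have h := hX.comp_clm ((ContinuousLinearMap.snd ℝ ℂ ℂ).comp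
      ((ContinuousLinearMap.snd ℝ ℂ (ℂ × ℂ)).comp (ContinuousLinearMap.snd ℝ ℂ (ℂ × ℂ × ℂ))))
    refine (h.add ((IsPrim.const v₀).sub hF)).congr_left (fun y hy => ?_) |>.congr_right
      fun y hy => ?_
    · simp [b, extendUnit_of_mem _ hy]
    · simp [g, p', q', extendUnit_of_mem _ hy, sub_eq_add_neg]
  all_goals simp [hx0]

/-- If the determinant vanished, `(d, -c)` and `(b, -a)` would lie in the kernel, so all entries
would be zero and `(1, 0)` would lie in the kernel too. -/
theorem solve_two_by_two {a b c d : ℂ}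
    (h : ∀ s t : ℂ, s * a + t * b = 0 → s * c + t * d = 0 → s = 0 ∧ t = 0) (e f : ℂ) :
    ∃ s t : ℂ, s * a + t * b = e ∧ s * c + t * d = f := by
  have hdet : a * d - b * c ≠ 0 := by
    intro h0
    obtain ⟨h1, h2⟩ := h d (-c) (by linear_combination h0) (by ring)
    obtain ⟨h3, h4⟩ := h b (-a) (by ring) (by linear_combination -h0)
    obtain ⟨h5, -⟩ := h 1 0 (by linear_combination -h4) (by linear_combination -h2)
    exact one_ne_zero h5
  refine ⟨(e * d - b * f) / (a * d - b * c), (a * f - c * e) / (a * d - b * c), ?_, ?_⟩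
  · rw [div_mul_eq_mul_div, div_mul_eq_mul_div, ← add_div, div_eq_iff hdet]
    ring
  · rw [div_mul_eq_mul_div, div_mul_eq_mul_div, ← add_div, div_eq_iff hdet]
    ring

/-- The problem with Neumann conditions is solvable as soon as it has uniqueness. -/
theorem exists_neumann {p q f : ℝ → ℂ} (hp : ContinuousOn p (Icc 0 1))
    (hq : ContinuousOn q (Icc 0 1)) (hf : IntervalIntegrable f volume 0 1)
    (huniq : ∀ Φ u ω v, Sol p q (fun _ => 0) Φ u ω v → Φ 0 = 0 → Φ 1 = 0 → v 0 = 0 → v 1 = 0 →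
      ∀ y ∈ Icc (0 : ℝ) 1, ω y = 0) (α β : ℂ) :
    ∃ Φ u ω v, Sol p q f Φ u ω v ∧ Φ 0 = 0 ∧ Φ 1 = 0 ∧ v 0 = α ∧ v 1 = β := by
  have h0 : IntervalIntegrable (fun _ : ℝ => (0 : ℂ)) volume 0 1 := by simp
  -- Shooting: the free initial data are `u 0` and `ω 0`, the third solution carries the force and
  -- `v 0 = α`, and uniqueness makes the map to the values of `(Φ, v)` at `1` injective.
  obtain ⟨Φ₁, u₁, ω₁, v₁, s1, a1, b1, c1, d1⟩ := exists_sol hp hq h0 0 1 0 0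
  obtain ⟨Φ₂, u₂, ω₂, v₂, s2, a2, b2, c2, d2⟩ := exists_sol hp hq h0 0 0 1 0
  obtain ⟨Φ₃, u₃, ω₃, v₃, s3, a3, b3, c3, d3⟩ := exists_sol hp hq hf 0 0 0 α
  obtain ⟨s, t, e1, e2⟩ := solve_two_by_two (a := Φ₁ 1) (b := Φ₂ 1) (c := v₁ 1) (d := v₂ 1) (by
    intro s t e1 e2
    have S := ((s1.const_mul s).add (s2.const_mul t)).congr_force (f' := fun _ => 0)
      (fun y _ => by simp)
    have hz := huniq _ _ _ _ S (by simp [a1, a2]) e1 (by simp [d1, d2]) e2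
    have ht : t = 0 := by simpa [c1, c2] using hz 0 zero_mem_unit
    -- Uniqueness only kills the vorticity. Then the velocity is the constant `s`, and `s = 0`
    -- because the stream function vanishes at both ends.
    have hu : ∀ y ∈ Icc (0 : ℝ) 1, s * u₁ y + t * u₂ y = s := by
      intro y hy
      have h3 := S.vel.2 y hy
      simp only [b1, b2] at h3
      rw [h3, intervalIntegral.integral_congr (g := fun _ => 0)]
      · simp
      · intro x hx
        rw [uIcc_of_le hy.1] at hx
        exact hz x ⟨hx.1, hx.2.trans hy.2⟩
    have h4 := (S.stream.congr_right (g := fun _ => s) fun y hy => (hu y hy).symm).2 1 one_mem_unit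
    simp only [e1, a1, a2] at h4
    simp at h4
    exact ⟨h4.symm, ht⟩) (-Φ₃ 1) (β - v₃ 1)
  refine ⟨_, _, _, _, (((s1.const_mul s).add (s2.const_mul t)).add s3).congr_force
    (fun y _ => by simp), ?_, ?_, ?_, ?_⟩
  · simp [a1, a2, a3]
  · rw [e1]
    ring
  · simp [d1, d2, d3]
  · rw [e2]
    ring

/-- The problem with clamped stream function is solvable as soon as it has uniqueness. -/
theorem exists_clamped {p q f : ℝ → ℂ} (hp : ContinuousOn p (Icc 0 1))
    (hq : ContinuousOn q (Icc 0 1)) (hf : IntervalIntegrable f volume 0 1)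
    (huniq : ∀ Φ u ω v, Sol p q (fun _ => 0) Φ u ω v → Φ 0 = 0 → Φ 1 = 0 → u 0 = 0 → u 1 = 0 →
      ∀ y ∈ Icc (0 : ℝ) 1, ω y = 0) :
    ∃ Φ u ω v, Sol p q f Φ u ω v ∧ Φ 0 = 0 ∧ Φ 1 = 0 ∧ u 0 = 0 ∧ u 1 = 0 := by
  have h0 : IntervalIntegrable (fun _ : ℝ => (0 : ℂ)) volume 0 1 := by simp
  -- Here the free initial data are `ω 0` and `v 0`, and the targets are the values of `(Φ, u)` at
  -- `1`.
  obtain ⟨Φ₁, u₁, ω₁, v₁, s1, a1, b1, c1, d1⟩ := exists_sol hp hq h0 0 0 1 0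
  obtain ⟨Φ₂, u₂, ω₂, v₂, s2, a2, b2, c2, d2⟩ := exists_sol hp hq h0 0 0 0 1
  obtain ⟨Φ₃, u₃, ω₃, v₃, s3, a3, b3, c3, d3⟩ := exists_sol hp hq hf 0 0 0 0
  obtain ⟨s, t, e1, e2⟩ := solve_two_by_two (a := Φ₁ 1) (b := Φ₂ 1) (c := u₁ 1) (d := u₂ 1) (by
    intro s t e1 e2
    have S := ((s1.const_mul s).add (s2.const_mul t)).congr_force (f' := fun _ => 0)
      (fun y _ => by simp)
    have hz := huniq _ _ _ _ S (by simp [a1, a2]) e1 (by simp [b1, b2]) e2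
    have hs : s = 0 := by simpa [c1, c2] using hz 0 zero_mem_unit
    have hd := S.vort.hasDerivWithinAt S.flux.continuousOn zero_mem_unit
    have hd' := (hasDerivWithinAt_const (0 : ℝ) (Icc (0 : ℝ) 1) (0 : ℂ)).congr hz
      (hz 0 zero_mem_unit)
    have h3 := (uniqueDiffOn_Icc (zero_lt_one (α := ℝ)) 0 zero_mem_unit).eq_deriv _ hd hd'
    simp only [d1, d2] at h3
    exact ⟨hs, by simpa using h3⟩) (-Φ₃ 1) (-u₃ 1)
  refine ⟨_, _, _, _, (((s1.const_mul s).add (s2.const_mul t)).add s3).congr_force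
    (fun y _ => by simp), ?_, ?_, ?_, ?_⟩
  · simp [a1, a2, a3]
  · rw [e1]
    ring
  · simp [b1, b2, b3]
  · rw [e2]
    ring

/-! ### Weak second derivatives -/

theorem restrict_Ioo_eq_Ioc :
    (volume.restrict (Ioo (0 : ℝ) 1)) = volume.restrict (Ioc (0 : ℝ) 1) :=
  Measure.restrict_congr_set Ioo_ae_eq_Ioc

theorem setIntegral_Ioo_eq {E : Type*} [NormedAddCommGroup E] [NormedSpace ℝ E] (f : ℝ → E) :
    ∫ y in Ioo (0 : ℝ) 1, f y = ∫ y in (0 : ℝ)..1, f y := by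
  rw [intervalIntegral.integral_of_le zero_le_one, restrict_Ioo_eq_Ioc]

/-- Smooth functions with compact support in `(0,1)`. -/
structure IsTest (φ : ℝ → ℝ) : Prop where
  smooth : ContDiff ℝ ((⊤ : ℕ∞) : WithTop ℕ∞) φ
  compact : HasCompactSupport φ
  supp : tsupport φ ⊆ Ioo 0 1

namespace IsTest
variable {φ ψ : ℝ → ℝ}

theorem eq_zero (h : IsTest φ) {y : ℝ} (hy : y ∉ Ioo (0 : ℝ) 1) : φ y = 0 :=
  image_eq_zero_of_notMem_tsupport fun hy' => hy (h.supp hy')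

theorem isTest_deriv (h : IsTest φ) : IsTest (deriv φ) :=
  ⟨(contDiff_infty_iff_deriv.1 h.smooth).2, h.compact.deriv,
    (tsupport_deriv_subset).trans h.supp⟩

theorem continuous (h : IsTest φ) : Continuous φ := h.smooth.continuous

theorem hasDerivAt (h : IsTest φ) (y : ℝ) : HasDerivAt φ (deriv φ y) y :=
  ((contDiff_infty_iff_deriv.1 h.smooth).1 y).hasDerivAt

theorem isPrim (h : IsTest φ) :
    IsPrim (fun y => (φ y : ℂ)) (fun y => ((deriv φ y : ℝ) : ℂ)) :=
  (IsPrim.of_hasDerivWithinAt (fun y _ => (h.hasDerivAt y).hasDerivWithinAt)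
    h.isTest_deriv.continuous.continuousOn).ofReal

theorem sub_const_mul (h : IsTest φ) (h' : IsTest ψ) (c : ℝ) :
    IsTest (fun y => φ y - c * ψ y) := by
  have hs : tsupport (fun y => φ y - c * ψ y) ⊆ tsupport φ ∪ tsupport ψ := by
    refine closure_minimal ?_ ((isClosed_tsupport _).union (isClosed_tsupport _))
    intro y hy
    by_contra hn
    rw [mem_union, not_or] at hn
    apply hy
    simp [image_eq_zero_of_notMem_tsupport hn.1, image_eq_zero_of_notMem_tsupport hn.2]
  exact ⟨h.smooth.sub (contDiff_const.mul h'.smooth),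
    IsCompact.of_isClosed_subset (h.compact.union h'.compact) (isClosed_tsupport _) hs,
    hs.trans (union_subset h.supp h'.supp)⟩

/-- The zero mean makes the primitive starting at `0` vanish also to the right of the support of
`ψ`. -/
theorem exists_primitive (h : IsTest ψ) (h0 : ∫ y in (0 : ℝ)..1, ψ y = 0) :
    ∃ φ, IsTest φ ∧ deriv φ = ψ := by
  obtain ⟨a, b, ha, hb, hab⟩ : ∃ a b, 0 < a ∧ b < 1 ∧ tsupport ψ ⊆ Icc a b := by
    rcases (tsupport ψ).eq_empty_or_nonempty with he | hne
    · exact ⟨1, 0, one_pos, one_pos, by simp [he]⟩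
    · obtain ⟨a, ha⟩ := h.compact.exists_isLeast hne
      obtain ⟨b, hb⟩ := h.compact.exists_isGreatest hne
      exact ⟨a, b, (h.supp ha.1).1, (h.supp hb.1).2, fun y hy => ⟨ha.2 hy, hb.2 hy⟩⟩
  have hz : ∀ y, y ∉ Icc a b → ψ y = 0 := fun y hy =>
    image_eq_zero_of_notMem_tsupport fun h' => hy (hab h')
  have hd : ∀ y, HasDerivAt (fun y => ∫ s in (0 : ℝ)..y, ψ s) (ψ y) y := fun y =>
    intervalIntegral.integral_hasDerivAt_right (h.continuous.intervalIntegrable _ _)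
      (h.continuous.stronglyMeasurableAtFilter _ _) h.continuous.continuousAt
  have hder : deriv (fun y => ∫ s in (0 : ℝ)..y, ψ s) = ψ := funext fun y => (hd y).deriv
  have hs : tsupport (fun y => ∫ s in (0 : ℝ)..y, ψ s) ⊆ Icc a b := by
    refine closure_minimal ?_ isClosed_Icc
    intro y hy
    by_contra hn
    apply hy
    rw [mem_Icc, not_and_or, not_le, not_le] at hn
    rcases hn with hn | hn
    · beta_reduce
      rw [intervalIntegral.integral_congr (g := fun _ => 0), intervalIntegral.integral_zero]
      intro s hs
      exact hz s fun hs' => not_lt.2 (hs'.1.trans hs.2) (max_lt ha hn)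
    · beta_reduce
      rw [← intervalIntegral.integral_add_adjacent_intervals
        (h.continuous.intervalIntegrable 0 1) (h.continuous.intervalIntegrable 1 y), h0, zero_add,
        intervalIntegral.integral_congr (g := fun _ => 0), intervalIntegral.integral_zero]
      intro s hs
      exact hz s fun hs' => not_lt.2 (hs.1.trans hs'.2) (lt_min hb hn)
  refine ⟨_, ⟨contDiff_infty_iff_deriv.2 ⟨fun y => (hd y).differentiableAt, ?_⟩,
    IsCompact.of_isClosed_subset isCompact_Icc (isClosed_tsupport _) hs,
    hs.trans (Icc_subset_Ioo ha hb)⟩, hder⟩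
  rw [hder]
  exact h.smooth

end IsTest

theorem exists_isTest_integral_eq_one : ∃ θ, IsTest θ ∧ ∫ y in (0 : ℝ)..1, θ y = 1 := by
  let f : ContDiffBump (1 / 2 : ℝ) := ⟨1 / 8, 1 / 4, by norm_num, by norm_num⟩
  have hs : tsupport (f.normed volume) ⊆ Ioo 0 1 := by
    rw [f.tsupport_normed_eq, Real.closedBall_eq_Icc]
    refine Icc_subset_Ioo ?_ ?_ <;> norm_num [f]
  refine ⟨f.normed volume, ⟨f.contDiff_normed, f.hasCompactSupport_normed, hs⟩, ?_⟩
  rw [← setIntegral_Ioo_eq, setIntegral_eq_integral_of_forall_compl_eq_zero, f.integral_normed]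
  exact fun y hy => image_eq_zero_of_notMem_tsupport fun h' => hy (hs h')

theorem IsTest.integral_ofReal {φ : ℝ → ℝ} :
    ∫ y in (0 : ℝ)..1, ((φ y : ℝ) : ℂ) = ((∫ y in (0 : ℝ)..1, φ y : ℝ) : ℂ) :=
  intervalIntegral.integral_ofReal

theorem IsTest.intervalIntegrable_mul {φ : ℝ → ℝ} (hφ : IsTest φ) {h : ℝ → ℂ}
    (hh : IntervalIntegrable h volume 0 1) :
    IntervalIntegrable (fun y => h y * (φ y : ℂ)) volume 0 1 :=
  hh.mul_continuousOn (Complex.continuous_ofReal.comp hφ.continuous).continuousOn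

/-- A function which is orthogonal to the derivatives of all test functions is constant. -/
theorem ae_eq_const_of_forall_integral_deriv {h : ℝ → ℂ} (hh : IntervalIntegrable h volume 0 1)
    (ho : ∀ φ, IsTest φ → ∫ y in (0 : ℝ)..1, h y * ((deriv φ y : ℝ) : ℂ) = 0) :
    ∃ a : ℂ, ∀ᵐ y ∂(volume.restrict (Ioc (0 : ℝ) 1)), h y = a := by
  obtain ⟨θ, hθ, hθ1⟩ := exists_isTest_integral_eq_one
  set a := ∫ y in (0 : ℝ)..1, h y * (θ y : ℂ) with ha
  have hha : IntervalIntegrable (fun y => h y - a) volume 0 1 := hh.sub intervalIntegrable_const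
  refine ⟨a, ?_⟩
  have hloc : LocallyIntegrableOn (fun y => h y - a) (Ioo 0 1) volume := by
    refine IntegrableOn.locallyIntegrableOn ?_
    rw [IntegrableOn, restrict_Ioo_eq_Ioc]
    exact integrable_iff_unit.1 hha
  have key := isOpen_Ioo.ae_eq_zero_of_integral_contDiff_smul_eq_zero hloc (by
    intro ψ h1 h2 h3
    have hψ : IsTest ψ := ⟨h1, h2, h3⟩
    rw [← setIntegral_eq_integral_of_forall_compl_eq_zero (s := Ioo 0 1)
      (fun y hy => by simp [hψ.eq_zero hy]), setIntegral_Ioo_eq]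
    set c := ∫ y in (0 : ℝ)..1, ψ y with hc
    -- Removing the mean with the fixed bump `θ` leaves the derivative of a test function, against
    -- which `h` integrates to zero.
    obtain ⟨φ, hφ, hφ'⟩ := (hψ.sub_const_mul hθ c).exists_primitive (by
      rw [intervalIntegral.integral_sub (hψ.continuous.intervalIntegrable _ _)
        ((hθ.continuous.intervalIntegrable _ _).const_mul c),
        intervalIntegral.integral_const_mul, hθ1, ← hc]
      ring)
    have h4 := ho φ hφ
    rw [hφ'] at h4
    have i1 := hψ.intervalIntegrable_mul hh
    have i2 := hθ.intervalIntegrable_mul hh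
    have i3 : IntervalIntegrable (fun y => (ψ y : ℂ)) volume 0 1 :=
      (Complex.continuous_ofReal.comp hψ.continuous).intervalIntegrable _ _
    have e1 : ∫ y in (0 : ℝ)..1, h y * ((ψ y - c * θ y : ℝ) : ℂ)
        = (∫ y in (0 : ℝ)..1, h y * (ψ y : ℂ)) - c * a := by
      rw [ha, ← intervalIntegral.integral_const_mul,
        ← intervalIntegral.integral_sub i1 (i2.const_mul _)]
      congr 1
      ext y
      push_cast
      ring
    have e2 : ∫ y in (0 : ℝ)..1, ψ y • (h y - a)
        = (∫ y in (0 : ℝ)..1, h y * (ψ y : ℂ)) - a * ∫ y in (0 : ℝ)..1, (ψ y : ℂ) := by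
      rw [← intervalIntegral.integral_const_mul,
        ← intervalIntegral.integral_sub i1 (i3.const_mul _)]
      congr 1
      ext y
      rw [Complex.real_smul]
      ring
    rw [e1] at h4
    rw [e2, IsTest.integral_ofReal, ← hc]
    linear_combination h4)
  rw [← restrict_Ioo_eq_Ioc]
  rw [ae_restrict_iff' measurableSet_Ioo]
  filter_upwards [key] with y hy hy' using sub_eq_zero.1 (hy hy')

theorem IsTest.integral_id_mul_deriv {ψ : ℝ → ℝ} (hψ : IsTest ψ) :
    ∫ y in (0 : ℝ)..1, (y : ℂ) * ((deriv ψ y : ℝ) : ℂ) = -∫ y in (0 : ℝ)..1, (ψ y : ℂ) := by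
  have h := (IsPrim.id.ofReal.mul hψ.isPrim).integral_eq
  rw [hψ.eq_zero (y := 1) (by simp), hψ.eq_zero (y := 0) (by simp),
    intervalIntegral.integral_add] at h
  · simp only [Complex.ofReal_one, one_mul] at h
    simp only [Complex.ofReal_zero, mul_zero, sub_zero] at h
    linear_combination h
  · exact (continuous_const.mul
      (Complex.continuous_ofReal.comp hψ.continuous)).intervalIntegrable _ _
  · exact (Complex.continuous_ofReal.mul
      (Complex.continuous_ofReal.comp hψ.isTest_deriv.continuous)).intervalIntegrable _ _

/-- A function which is orthogonal to the second derivatives of all test functions is affine. -/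
theorem ae_eq_affine_of_forall_integral_deriv_deriv {h : ℝ → ℂ}
    (hh : IntervalIntegrable h volume 0 1)
    (ho : ∀ φ, IsTest φ → ∫ y in (0 : ℝ)..1, h y * ((deriv (deriv φ) y : ℝ) : ℂ) = 0) :
    ∃ a b : ℂ, ∀ᵐ y ∂(volume.restrict (Ioc (0 : ℝ) 1)), h y = a + b * y := by
  obtain ⟨θ, hθ, hθ1⟩ := exists_isTest_integral_eq_one
  set c := ∫ y in (0 : ℝ)..1, h y * ((deriv θ y : ℝ) : ℂ) with hc
  have hid : Continuous fun y : ℝ => c * (y : ℂ) := by fun_prop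
  -- The slope `-c` is read off from the bump; `h + c y` is then orthogonal to all first derivatives
  -- of test functions, hence constant.
  obtain ⟨a, ha⟩ := ae_eq_const_of_forall_integral_deriv
    (h := fun y => h y + c * y) (hh.add (hid.intervalIntegrable _ _)) (by
    intro ψ hψ
    set e := ∫ y in (0 : ℝ)..1, ψ y with he
    obtain ⟨φ, hφ, hφ'⟩ := (hψ.sub_const_mul hθ e).exists_primitive (by
      rw [intervalIntegral.integral_sub (hψ.continuous.intervalIntegrable _ _)
        ((hθ.continuous.intervalIntegrable _ _).const_mul e),
        intervalIntegral.integral_const_mul, hθ1, ← he]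
      ring)
    have h4 := ho φ hφ
    have hdd : deriv (fun y => ψ y - e * θ y) = fun y => deriv ψ y - e * deriv θ y := by
      ext y
      exact ((hψ.hasDerivAt y).sub ((hθ.hasDerivAt y).const_mul e)).deriv
    rw [hφ', hdd] at h4
    have i1 := hψ.isTest_deriv.intervalIntegrable_mul hh
    have i2 := hθ.isTest_deriv.intervalIntegrable_mul hh
    have i3 := hψ.isTest_deriv.intervalIntegrable_mul
      ((Complex.continuous_ofReal.intervalIntegrable (μ := volume) 0 1))
    have e1 : ∫ y in (0 : ℝ)..1, h y * ((deriv ψ y - e * deriv θ y : ℝ) : ℂ)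
        = (∫ y in (0 : ℝ)..1, h y * ((deriv ψ y : ℝ) : ℂ)) - e * c := by
      rw [hc, ← intervalIntegral.integral_const_mul,
        ← intervalIntegral.integral_sub i1 (i2.const_mul _)]
      congr 1
      ext y
      push_cast
      ring
    have e2 : ∫ y in (0 : ℝ)..1, (h y + c * y) * ((deriv ψ y : ℝ) : ℂ)
        = (∫ y in (0 : ℝ)..1, h y * ((deriv ψ y : ℝ) : ℂ))
          + c * ∫ y in (0 : ℝ)..1, (y : ℂ) * ((deriv ψ y : ℝ) : ℂ) := by
      rw [← intervalIntegral.integral_const_mul,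
        ← intervalIntegral.integral_add i1 (i3.const_mul _)]
      congr 1
      ext y
      ring
    rw [e1] at h4
    rw [e2, hψ.integral_id_mul_deriv, IsTest.integral_ofReal, ← he]
    linear_combination h4)
  exact ⟨a, -c, by filter_upwards [ha] with y hy using by linear_combination hy⟩

theorem IsPrim.integral_deriv_deriv {ω v g : ℝ → ℂ} (hω : IsPrim ω v) (hv : IsPrim v g)
    {φ : ℝ → ℝ} (hφ : IsTest φ) :
    ∫ y in (0 : ℝ)..1, ω y * ((deriv (deriv φ) y : ℝ) : ℂ)
      = ∫ y in (0 : ℝ)..1, g y * ((φ y : ℝ) : ℂ) := by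
  have h := ((hω.mul hφ.isTest_deriv.isPrim).sub (hv.mul hφ.isPrim)).integral_eq
  rw [hφ.eq_zero (y := 1) (by simp), hφ.eq_zero (y := 0) (by simp),
    hφ.isTest_deriv.eq_zero (y := 1) (by simp), hφ.isTest_deriv.eq_zero (y := 0) (by simp)] at h
  have i1 := hφ.isTest_deriv.isTest_deriv.intervalIntegrable_mul hω.intervalIntegrable
  have i2 := hφ.intervalIntegrable_mul hv.1
  rw [← sub_eq_zero, ← intervalIntegral.integral_sub i1 i2]
  simp only [Complex.ofReal_zero, mul_zero, sub_zero] at h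
  rw [← h]
  congr 1
  ext y
  ring

/-- A function with an integrable weak second derivative is twice a primitive. -/
theorem exists_isPrim_of_weak {ω g : ℝ → ℂ} (hω : IntervalIntegrable ω volume 0 1)
    (hg : IntervalIntegrable g volume 0 1)
    (h : ∀ φ, IsTest φ → ∫ y in (0 : ℝ)..1, ω y * ((deriv (deriv φ) y : ℝ) : ℂ)
      = ∫ y in (0 : ℝ)..1, g y * ((φ y : ℝ) : ℂ)) :
    ∃ ω' v, IsPrim ω' v ∧ IsPrim v g ∧
      ∀ᵐ y ∂(volume.restrict (Ioc (0 : ℝ) 1)), ω y = ω' y := by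
  have hV := IsPrim.of_integrable hg 0
  have hW := IsPrim.of_integrable hV.intervalIntegrable 0
  -- After subtraction of a double primitive of `g` the weak second derivative is zero.
  obtain ⟨a, b, hab⟩ := ae_eq_affine_of_forall_integral_deriv_deriv
    (hω.sub hW.intervalIntegrable) (by
      intro φ hφ
      have i1 := hφ.isTest_deriv.isTest_deriv.intervalIntegrable_mul hω
      have i2 := hφ.isTest_deriv.isTest_deriv.intervalIntegrable_mul hW.intervalIntegrable
      simp only [sub_mul]
      rw [intervalIntegral.integral_sub i1 i2, h φ hφ, hW.integral_deriv_deriv hV hφ, sub_self])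
  refine ⟨_, _, hW.add ((IsPrim.const a).add (IsPrim.id.ofReal.const_mul b)),
    (hV.add (IsPrim.const b)).congr_left (fun y _ => by simp) |>.congr_right
      fun y _ => by simp, ?_⟩
  filter_upwards [hab] with y hy
  linear_combination hy

/-! ### The weighted energy estimate -/

/-- A strictly concave profile `U` with derivatives `U1`, `U2`, the weight `W = -1 / U2` and its
derivative `W1`, and a common bound `L`. -/
structure Profile (U U1 U2 W W1 : ℝ → ℝ) (L : ℝ) : Prop where
  one_le : 1 ≤ L
  prim : IsPrim U U1
  prim1 : IsPrim U1 U2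
  cont2 : ContinuousOn U2 (Icc 0 1)
  primW : IsPrim W W1
  weight : ∀ y ∈ Icc (0 : ℝ) 1, W y * U2 y = -1
  abs_le : ∀ y ∈ Icc (0 : ℝ) 1, |U y| ≤ L
  abs1_le : ∀ y ∈ Icc (0 : ℝ) 1, |U1 y| ≤ L
  abs2_le : ∀ y ∈ Icc (0 : ℝ) 1, |U2 y| ≤ L
  le_W : ∀ y ∈ Icc (0 : ℝ) 1, 1 / L ≤ W y
  W_le : ∀ y ∈ Icc (0 : ℝ) 1, W y ≤ L
  absW1_le : ∀ y ∈ Icc (0 : ℝ) 1, |W1 y| ≤ L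

/-- The coefficient `λ + i k U`. -/
def pCoeff (U : ℝ → ℝ) (k : ℝ) (lam : ℂ) (y : ℝ) : ℂ := lam + Complex.I * k * U y

/-- The coefficient `i k U''`. -/
def qCoeff (U2 : ℝ → ℝ) (k : ℝ) (y : ℝ) : ℂ := Complex.I * k * U2 y

theorem mul_conj_eq (z : ℂ) : z * starRingEnd ℂ z = ((‖z‖ ^ 2 : ℝ) : ℂ) := by
  rw [Complex.mul_conj, Complex.normSq_eq_norm_sq]

theorem IsPrim.im {F f : ℝ → ℂ} (hF : IsPrim F f) :
    IsPrim (fun y => (F y).im) (fun y => (f y).im) :=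
  hF.comp_clm Complex.imCLM

theorem sqrt_normSq_sq (f : ℝ → ℂ) : √(normSq f) ^ 2 = normSq f := Real.sq_sqrt (normSq_nonneg f)

theorem IsPrim.pCoeff {U U1 : ℝ → ℝ} (h : IsPrim U U1) (k : ℝ) (lam : ℂ) :
    IsPrim (pCoeff U k lam) (fun y => Complex.I * k * U1 y) :=
  ((IsPrim.const lam).add (h.ofReal.const_mul (Complex.I * k))).congr_right
    fun y _ => by simp

theorem continuousOn_qCoeff {U2 : ℝ → ℝ} (h : ContinuousOn U2 (Icc 0 1)) (k : ℝ) :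
    ContinuousOn (qCoeff U2 k) (Icc 0 1) :=
  continuousOn_const.mul (Complex.continuous_ofReal.comp_continuousOn h)

section energy
variable {U U1 U2 W W1 : ℝ → ℝ} {L k : ℝ} {lam : ℂ} {f Φ u ω v : ℝ → ℂ}

/-- The equation is tested with `W ω̄`. Since `W U'' = -1`, the nonlocal term becomes `ikΦω̄`, which
the derivative of `-ikΦū` cancels up to the imaginary quantity `-ik|u|²`. Only the commutator with
`W'` and the force remain without a definite real or imaginary character. -/
theorem Sol.energy_identity (hU : Profile U U1 U2 W W1 L)
    (h : Sol (pCoeff U k lam) (qCoeff U2 k) f Φ u ω v)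
    (hΦ0 : Φ 0 = 0) (hΦ1 : Φ 1 = 0) (hv0 : v 0 = 0) (hv1 : v 1 = 0) :
    IsPrim (fun y => W y * (v y * starRingEnd ℂ (ω y)) - Complex.I * k * (Φ y * starRingEnd ℂ (u y)))
      (fun y => ((W y * lam.re * ‖ω y‖ ^ 2 + W y * ‖v y‖ ^ 2 : ℝ) : ℂ)
        + Complex.I * ((W y * (lam.im + k * U y) * ‖ω y‖ ^ 2 - k * ‖u y‖ ^ 2 : ℝ) : ℂ)
        + (W1 y * (v y * starRingEnd ℂ (ω y)) - W y * (f y * starRingEnd ℂ (ω y)))) ∧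
    ∫ y in (0 : ℝ)..1, (((W y * lam.re * ‖ω y‖ ^ 2 + W y * ‖v y‖ ^ 2 : ℝ) : ℂ)
        + Complex.I * ((W y * (lam.im + k * U y) * ‖ω y‖ ^ 2 - k * ‖u y‖ ^ 2 : ℝ) : ℂ)
        + (W1 y * (v y * starRingEnd ℂ (ω y)) - W y * (f y * starRingEnd ℂ (ω y)))) = 0 := by
  have hP : IsPrim (fun y => W y * (v y * starRingEnd ℂ (ω y))
      - Complex.I * k * (Φ y * starRingEnd ℂ (u y)))
      (fun y => ((W y * lam.re * ‖ω y‖ ^ 2 + W y * ‖v y‖ ^ 2 : ℝ) : ℂ)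
        + Complex.I * ((W y * (lam.im + k * U y) * ‖ω y‖ ^ 2 - k * ‖u y‖ ^ 2 : ℝ) : ℂ)
        + (W1 y * (v y * starRingEnd ℂ (ω y)) - W y * (f y * starRingEnd ℂ (ω y)))) := by
    refine ((hU.primW.ofReal.mul (h.flux.mul h.vort.conj)).sub
      ((h.stream.mul h.vel.conj).const_mul (Complex.I * k))).congr_right fun y hy => ?_
    have hw : (W y : ℂ) * U2 y = -1 := by exact_mod_cast hU.weight y hy
    have e1 := mul_conj_eq (ω y)
    have e2 := mul_conj_eq (v y)
    have e3 := mul_conj_eq (u y)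
    have e4 : lam = lam.re + lam.im * Complex.I := (Complex.re_add_im lam).symm
    simp only [HydrostaticNS.pCoeff, qCoeff]
    push_cast at e1 e2 e3 ⊢
    rw [← e1, ← e2, ← e3]
    rw [e4]
    simp only [Complex.add_re, Complex.add_im, Complex.mul_re, Complex.mul_im, Complex.ofReal_re,
      Complex.ofReal_im, Complex.I_re, Complex.I_im]
    push_cast
    linear_combination Complex.I * k * Φ y * (starRingEnd ℂ (ω y)) * hw
  refine ⟨hP, ?_⟩
  rw [hP.integral_eq]
  simp [hΦ0, hΦ1, hv0, hv1]

/-- The stream function and velocity have dropped out, their contribution being purely imaginary. -/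
theorem Sol.energy_re (hU : Profile U U1 U2 W W1 L) (hlam : 0 ≤ lam.re)
    (h : Sol (pCoeff U k lam) (qCoeff U2 k) f Φ u ω v) (hf : SqInt f)
    (hΦ0 : Φ 0 = 0) (hΦ1 : Φ 1 = 0) (hv0 : v 0 = 0) (hv1 : v 1 = 0) :
    lam.re / L * normSq ω + 1 / L * normSq v
      ≤ L * (√(normSq f) * √(normSq ω)) + L * (√(normSq v) * √(normSq ω)) := by
  obtain ⟨hP, h0⟩ := h.energy_identity hU hΦ0 hΦ1 hv0 hv1
  have hL : 0 < L := one_pos.trans_le hU.one_le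
  have i1 := hf.intervalIntegrable_mul h.vort.sqInt
  have i2 := h.flux.sqInt.intervalIntegrable_mul h.vort.sqInt
  have i3 := h.vort.sqInt.intervalIntegrable_sq
  have i4 := h.flux.sqInt.intervalIntegrable_sq
  have e := (hP.re).integral_eq
  simp only [hΦ0, hΦ1, hv0, hv1] at e
  have key := integral_mono_unit ((i3.const_mul (lam.re / L)).add (i4.const_mul (1 / L)))
    ((hP.re.1.add (i1.const_mul L)).add (i2.const_mul L)) (by
      intro y hy
      have hw := hU.le_W y hy
      have hw2 := hU.W_le y hy
      have hw0 : 0 ≤ W y := (by positivity : (0 : ℝ) ≤ 1 / L).trans hw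
      have b1 : ((W1 y : ℂ) * (v y * starRingEnd ℂ (ω y))).re ≥ -(L * (‖v y‖ * ‖ω y‖)) := by
        have := (abs_le.1 (Complex.abs_re_le_norm ((W1 y : ℂ) * (v y * starRingEnd ℂ (ω y))))).1
        rw [norm_mul, norm_mul, RCLike.norm_conj, Complex.norm_real, Real.norm_eq_abs] at this
        have h3 := mul_le_mul_of_nonneg_right (hU.absW1_le y hy)
          (by positivity : 0 ≤ ‖v y‖ * ‖ω y‖)
        linarith
      have b2 : ((W y : ℂ) * (f y * starRingEnd ℂ (ω y))).re ≤ L * (‖f y‖ * ‖ω y‖) := by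
        have := (abs_le.1 (Complex.abs_re_le_norm ((W y : ℂ) * (f y * starRingEnd ℂ (ω y))))).2
        rw [norm_mul, norm_mul, RCLike.norm_conj, Complex.norm_real, Real.norm_eq_abs,
          abs_of_nonneg hw0] at this
        have h3 := mul_le_mul_of_nonneg_right hw2 (by positivity : 0 ≤ ‖f y‖ * ‖ω y‖)
        linarith
      have b3 : lam.re / L * ‖ω y‖ ^ 2 ≤ W y * lam.re * ‖ω y‖ ^ 2 := by
        have := mul_le_mul_of_nonneg_right hw (by positivity : 0 ≤ lam.re * ‖ω y‖ ^ 2)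
        calc _ = 1 / L * (lam.re * ‖ω y‖ ^ 2) := by ring
          _ ≤ _ := this
          _ = _ := by ring
      have b4 := mul_le_mul_of_nonneg_right hw (by positivity : 0 ≤ ‖v y‖ ^ 2)
      have e5 : (Complex.I * ((W y * (lam.im + k * U y) * ‖ω y‖ ^ 2 - k * ‖u y‖ ^ 2 : ℝ) : ℂ)).re
          = 0 := by rw [Complex.re_mul_ofReal, Complex.I_re, zero_mul]
      simp only [Complex.add_re, Complex.sub_re, Complex.ofReal_re, e5]
      linarith)
  rw [intervalIntegral.integral_add (i3.const_mul _) (i4.const_mul _),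
    intervalIntegral.integral_add (hP.re.1.add (i1.const_mul L)) (i2.const_mul L),
    intervalIntegral.integral_add hP.re.1 (i1.const_mul L), e] at key
  simp only [intervalIntegral.integral_const_mul] at key
  have c1 := mul_le_mul_of_nonneg_left (hf.integral_mul_le h.vort.sqInt) hL.le
  have c2 := mul_le_mul_of_nonneg_left (h.flux.sqInt.integral_mul_le h.vort.sqInt) hL.le
  simp only [zero_mul, mul_zero, sub_zero, Complex.zero_re, zero_add] at key
  simp only [normSq] at c1 c2 ⊢
  linarith

/-- The threshold `2 L⁴` absorbs the commutator: `L²‖v‖‖ω‖ ≤ ‖v‖²/2 + L⁴‖ω‖²/2`, and the last term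
is at most a quarter of `Re λ ‖ω‖²`. -/
theorem Sol.neumann_bounds (hU : Profile U U1 U2 W W1 L) (hlam : 2 * L ^ 4 ≤ lam.re)
    (h : Sol (pCoeff U k lam) (qCoeff U2 k) f Φ u ω v) (hf : SqInt f)
    (hΦ0 : Φ 0 = 0) (hΦ1 : Φ 1 = 0) (hv0 : v 0 = 0) (hv1 : v 1 = 0) :
    lam.re * √(normSq ω) ≤ 2 * L ^ 2 * √(normSq f) ∧
      lam.re * normSq v ≤ 4 * L ^ 4 * normSq f := by
  have hL := hU.one_le
  have hL0 : 0 < L := one_pos.trans_le hL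
  have hL4 : 0 < L ^ 4 := by positivity
  have hr : 0 < lam.re := by linarith
  have key := h.energy_re hU hr.le hf hΦ0 hΦ1 hv0 hv1
  rw [← sqrt_normSq_sq ω, ← sqrt_normSq_sq v, ← sqrt_normSq_sq f] at *
  have ha := Real.sqrt_nonneg (normSq ω)
  have hb := Real.sqrt_nonneg (normSq v)
  have hF := Real.sqrt_nonneg (normSq f)
  simp only [Real.sqrt_sq ha, Real.sqrt_sq hb, Real.sqrt_sq hF] at *
  generalize √(normSq ω) = a at *
  generalize √(normSq v) = b at *
  generalize √(normSq f) = F at *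
  generalize lam.re = r at *
  have k1 : r * a ^ 2 + b ^ 2 ≤ L ^ 2 * (F * a) + L ^ 2 * (b * a) := by
    have := mul_le_mul_of_nonneg_left key hL0.le
    calc _ = L * (r / L * a ^ 2 + 1 / L * b ^ 2) := by field_simp
      _ ≤ _ := this
      _ = _ := by ring
  have k2 : L ^ 2 * (b * a) ≤ b ^ 2 / 2 + L ^ 4 * a ^ 2 / 2 := by
    nlinarith [sq_nonneg (b - L ^ 2 * a)]
  have k3 : L ^ 4 * a ^ 2 / 2 ≤ r * a ^ 2 / 4 := by nlinarith [sq_nonneg a]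
  have k4 : 3 / 4 * (r * a ^ 2) + b ^ 2 / 2 ≤ L ^ 2 * (F * a) := by linarith
  have k5 : r * a ≤ 2 * L ^ 2 * F := by
    rcases ha.eq_or_lt with h0 | h0
    · rw [← h0, mul_zero]
      positivity
    · have : (r * a) * a ≤ (2 * L ^ 2 * F) * a := by nlinarith [sq_nonneg b, mul_nonneg hF ha]
      exact le_of_mul_le_mul_right this h0
  refine ⟨k5, ?_⟩
  have k6 : b ^ 2 ≤ 2 * L ^ 2 * F * a := by nlinarith [mul_nonneg hr.le (sq_nonneg a)]
  calc r * b ^ 2 ≤ r * (2 * L ^ 2 * F * a) := by gcongr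
    _ = 2 * L ^ 2 * F * (r * a) := by ring
    _ ≤ 2 * L ^ 2 * F * (2 * L ^ 2 * F) := by gcongr
    _ = _ := by ring

/-- If `U ≤ 0`, the imaginary part of the energy identity controls the velocity. -/
theorem Sol.velocity_bound (hU : Profile U U1 U2 W W1 L) (hneg : ∀ y ∈ Icc (0 : ℝ) 1, U y ≤ 0)
    (h : Sol (pCoeff U k lam) (qCoeff U2 k) f Φ u ω v) (hf : SqInt f)
    (hΦ0 : Φ 0 = 0) (hΦ1 : Φ 1 = 0) (hv0 : v 0 = 0) (hv1 : v 1 = 0) :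
    |k| * normSq u ≤ L * (|lam.im| * normSq ω + √(normSq f) * √(normSq ω)
      + √(normSq v) * √(normSq ω)) := by
  obtain ⟨hP, -⟩ := h.energy_identity hU hΦ0 hΦ1 hv0 hv1
  have hL : 0 < L := one_pos.trans_le hU.one_le
  have i1 := hf.intervalIntegrable_mul h.vort.sqInt
  have i2 := h.flux.sqInt.intervalIntegrable_mul h.vort.sqInt
  have i3 := h.vort.sqInt.intervalIntegrable_sq
  have i4 := h.vel.sqInt.intervalIntegrable_sq
  have i5 : IntervalIntegrable (fun y => W y * U y * ‖ω y‖ ^ 2) volume 0 1 :=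
    intervalIntegrable_of_continuousOn ((hU.primW.continuousOn.mul hU.prim.continuousOn).mul
      (h.vort.continuousOn.norm.pow 2))
  have e := (hP.im).integral_eq
  simp only [hΦ0, hΦ1, hv0, hv1] at e
  have hX : IntervalIntegrable (fun y => ‖u y‖ ^ 2 - W y * U y * ‖ω y‖ ^ 2) volume 0 1 := i4.sub i5
  have hR := ((i3.const_mul (L * |lam.im|)).add (i1.const_mul L)).add (i2.const_mul L)
  have hpt : ∀ y ∈ Icc (0 : ℝ) 1, ‖k * (‖u y‖ ^ 2 - W y * U y * ‖ω y‖ ^ 2)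
      + (((W y * lam.re * ‖ω y‖ ^ 2 + W y * ‖v y‖ ^ 2 : ℝ) : ℂ)
        + Complex.I * ((W y * (lam.im + k * U y) * ‖ω y‖ ^ 2 - k * ‖u y‖ ^ 2 : ℝ) : ℂ)
        + (W1 y * (v y * starRingEnd ℂ (ω y)) - W y * (f y * starRingEnd ℂ (ω y)))).im‖
      ≤ L * |lam.im| * ‖ω y‖ ^ 2 + L * (‖f y‖ * ‖ω y‖) + L * (‖v y‖ * ‖ω y‖) := by
    intro y hy
    have hw := hU.le_W y hy
    have hw2 := hU.W_le y hy
    have hw0 : 0 ≤ W y := (by positivity : (0 : ℝ) ≤ 1 / L).trans hw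
    have e5 : (Complex.I * ((W y * (lam.im + k * U y) * ‖ω y‖ ^ 2 - k * ‖u y‖ ^ 2 : ℝ) : ℂ)).im
        = W y * (lam.im + k * U y) * ‖ω y‖ ^ 2 - k * ‖u y‖ ^ 2 := by
      rw [Complex.im_mul_ofReal, Complex.I_im, one_mul]
    have e6 : k * (‖u y‖ ^ 2 - W y * U y * ‖ω y‖ ^ 2)
        + (((W y * lam.re * ‖ω y‖ ^ 2 + W y * ‖v y‖ ^ 2 : ℝ) : ℂ)
        + Complex.I * ((W y * (lam.im + k * U y) * ‖ω y‖ ^ 2 - k * ‖u y‖ ^ 2 : ℝ) : ℂ)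
        + (W1 y * (v y * starRingEnd ℂ (ω y)) - W y * (f y * starRingEnd ℂ (ω y)))).im
        = W y * lam.im * ‖ω y‖ ^ 2 + ((W1 y : ℂ) * (v y * starRingEnd ℂ (ω y))).im
          - ((W y : ℂ) * (f y * starRingEnd ℂ (ω y))).im := by
      simp only [Complex.add_im, Complex.sub_im, Complex.ofReal_im, e5]
      ring
    rw [e6]
    have b1 : |((W1 y : ℂ) * (v y * starRingEnd ℂ (ω y))).im| ≤ L * (‖v y‖ * ‖ω y‖) := by
      have := Complex.abs_im_le_norm ((W1 y : ℂ) * (v y * starRingEnd ℂ (ω y)))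
      rw [norm_mul, norm_mul, RCLike.norm_conj, Complex.norm_real, Real.norm_eq_abs] at this
      exact this.trans (mul_le_mul_of_nonneg_right (hU.absW1_le y hy) (by positivity))
    have b2 : |((W y : ℂ) * (f y * starRingEnd ℂ (ω y))).im| ≤ L * (‖f y‖ * ‖ω y‖) := by
      have := Complex.abs_im_le_norm ((W y : ℂ) * (f y * starRingEnd ℂ (ω y)))
      rw [norm_mul, norm_mul, RCLike.norm_conj, Complex.norm_real, Real.norm_eq_abs,
        abs_of_nonneg hw0] at this
      exact this.trans (mul_le_mul_of_nonneg_right hw2 (by positivity))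
    have b3 : |W y * lam.im * ‖ω y‖ ^ 2| ≤ L * |lam.im| * ‖ω y‖ ^ 2 := by
      rw [abs_mul, abs_mul, abs_of_nonneg hw0, abs_of_nonneg (sq_nonneg ‖ω y‖)]
      gcongr
    rw [Real.norm_eq_abs]
    refine (abs_sub _ _).trans ?_
    linarith [abs_add_le (W y * lam.im * ‖ω y‖ ^ 2)
      ((W1 y : ℂ) * (v y * starRingEnd ℂ (ω y))).im]
  -- As `W > 0` and `U ≤ 0`, the vorticity term has the same sign as `‖u‖ ^ 2` and can be dropped.
  have hX2 : normSq u ≤ ∫ y in (0 : ℝ)..1, (‖u y‖ ^ 2 - W y * U y * ‖ω y‖ ^ 2) := by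
    refine integral_mono_unit i4 hX fun y hy => ?_
    have hw0 : 0 ≤ W y := (by positivity : (0 : ℝ) ≤ 1 / L).trans (hU.le_W y hy)
    have := mul_nonneg (mul_nonneg hw0 (neg_nonneg.2 (hneg y hy))) (sq_nonneg ‖ω y‖)
    linarith
  have hsum := intervalIntegral.norm_integral_le_of_norm_le (μ := volume) zero_le_one
    (Filter.Eventually.of_forall fun y hy => hpt y (Ioc_subset_Icc_self hy)) hR
  rw [intervalIntegral.integral_add (hX.const_mul k) hP.im.1, e,
    intervalIntegral.integral_add ((i3.const_mul _).add (i1.const_mul L)) (i2.const_mul L),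
    intervalIntegral.integral_add (i3.const_mul _) (i1.const_mul L)] at hsum
  simp only [intervalIntegral.integral_const_mul, zero_mul, mul_zero, sub_zero, Complex.zero_im,
    add_zero, norm_mul, Real.norm_eq_abs] at hsum
  rw [abs_of_nonneg ((normSq_nonneg u).trans hX2)] at hsum
  have c1 := mul_le_mul_of_nonneg_left (hf.integral_mul_le h.vort.sqInt) hL.le
  have c2 := mul_le_mul_of_nonneg_left (h.flux.sqInt.integral_mul_le h.vort.sqInt) hL.le
  have c3 := mul_le_mul_of_nonneg_left hX2 (abs_nonneg k)
  simp only [normSq] at c1 c2 c3 ⊢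
  linarith

end energy

/-! ### Boundary layers of the local problem -/

/-- A weighted energy. -/
def wNormSq (g : ℝ → ℝ) (ω : ℝ → ℂ) : ℝ := ∫ y in (0 : ℝ)..1, g y ^ 2 * ‖ω y‖ ^ 2

theorem wNormSq_nonneg (g : ℝ → ℝ) (ω : ℝ → ℂ) : 0 ≤ wNormSq g ω :=
  intervalIntegral.integral_nonneg zero_le_one fun _ _ => by positivity

theorem wNormSq_one (ω : ℝ → ℂ) : wNormSq (fun _ => 1) ω = normSq ω := by
  simp [wNormSq, normSq]

theorem intervalIntegrable_wNormSq {g : ℝ → ℝ} {ω : ℝ → ℂ} (hg : ContinuousOn g (Icc 0 1))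
    (hω : ContinuousOn ω (Icc 0 1)) :
    IntervalIntegrable (fun y => g y ^ 2 * ‖ω y‖ ^ 2) volume 0 1 :=
  intervalIntegrable_of_continuousOn ((hg.pow 2).mul (hω.norm.pow 2))

section local_problem
variable {U : ℝ → ℝ} {L k Ue : ℝ} {lam : ℂ} {ω v : ℝ → ℂ} {d : ℝ → ℝ}

/-- The local equation `ω'' = pω` is tested with `g² ω̄`, and the cross term is split as `½ g²|v|² +
2 g'²|ω|²`. In the imaginary part `U` is frozen at the end value `Ue`; the error is a moment with
the extra factor `d`. -/
theorem weighted_energy {g g1 : ℝ → ℝ} {β : ℝ} (hg : IsPrim g g1) (hg1 : ContinuousOn g1 (Icc 0 1))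
    (hω : IsPrim ω v)
    (hv : IsPrim v (fun y => pCoeff U k lam y * ω y))
    (hβ : ‖(g 1 : ℂ) ^ 2 * (v 1 * starRingEnd ℂ (ω 1))
      - (g 0 : ℂ) ^ 2 * (v 0 * starRingEnd ℂ (ω 0))‖ ≤ β)
    (hd : ContinuousOn d (Icc 0 1)) (hUd : ∀ y ∈ Icc (0 : ℝ) 1, |U y - Ue| ≤ L * d y) :
    lam.re * wNormSq g ω + 1 / 2 * wNormSq g v ≤ 2 * wNormSq g1 ω + β ∧
    |lam.im + k * Ue| * wNormSq g ω ≤ |k| * L * (∫ y in (0 : ℝ)..1, d y * (g y ^ 2 * ‖ω y‖ ^ 2))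
      + 1 / 2 * wNormSq g v + 2 * wNormSq g1 ω + β := by
  have j1 := intervalIntegrable_wNormSq hg.continuousOn hω.continuousOn
  have j2 := intervalIntegrable_wNormSq hg.continuousOn hv.continuousOn
  have j3 := intervalIntegrable_wNormSq hg1 hω.continuousOn
  have j4 : IntervalIntegrable (fun y => d y * (g y ^ 2 * ‖ω y‖ ^ 2)) volume 0 1 :=
    intervalIntegrable_of_continuousOn
      (hd.mul ((hg.continuousOn.pow 2).mul (hω.continuousOn.norm.pow 2)))
  have hP : IsPrim (fun y => (g y : ℂ) ^ 2 * (v y * starRingEnd ℂ (ω y)))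
      (fun y => ((lam.re * (g y ^ 2 * ‖ω y‖ ^ 2) + g y ^ 2 * ‖v y‖ ^ 2 : ℝ) : ℂ)
        + Complex.I * (((lam.im + k * U y) * (g y ^ 2 * ‖ω y‖ ^ 2) : ℝ) : ℂ)
        + 2 * g y * g1 y * (v y * starRingEnd ℂ (ω y))) := by
    refine ((hg.ofReal.mul hg.ofReal).mul (hv.mul hω.conj)).congr_right (fun y _ => ?_)
      |>.congr_left fun y _ => by ring
    have e1 := mul_conj_eq (ω y)
    have e2 := mul_conj_eq (v y)
    have e4 : lam = lam.re + lam.im * Complex.I := (Complex.re_add_im lam).symm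
    simp only [pCoeff]
    push_cast at e1 e2 ⊢
    rw [← e1, ← e2]
    rw [e4]
    simp only [Complex.add_re, Complex.add_im, Complex.mul_re, Complex.mul_im, Complex.ofReal_re,
      Complex.ofReal_im, Complex.I_re, Complex.I_im]
    push_cast
    ring
  have hcross : ∀ y, ‖2 * (g y : ℂ) * g1 y * (v y * starRingEnd ℂ (ω y))‖
      ≤ 1 / 2 * (g y ^ 2 * ‖v y‖ ^ 2) + 2 * (g1 y ^ 2 * ‖ω y‖ ^ 2) := by
    intro y
    rw [norm_mul, norm_mul, norm_mul, norm_mul, RCLike.norm_conj, Complex.norm_real,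
      Complex.norm_real, Real.norm_eq_abs, Real.norm_eq_abs, Complex.norm_two]
    rw [← sq_abs (g y), ← sq_abs (g1 y)]
    nlinarith [sq_nonneg (|g y| * ‖v y‖ - 2 * (|g1 y| * ‖ω y‖))]
  constructor
  · have e := hP.re.integral_eq
    have key := integral_mono_unit ((j1.const_mul lam.re).add (j2.const_mul (1 / 2)))
      (hP.re.1.add (j3.const_mul 2)) (by
        intro y hy
        have c1 := (abs_le.1 ((Complex.abs_re_le_norm _).trans (hcross y))).1
        have e5 : (Complex.I * (((lam.im + k * U y) * (g y ^ 2 * ‖ω y‖ ^ 2) : ℝ) : ℂ)).re = 0 := by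
          rw [Complex.re_mul_ofReal, Complex.I_re, zero_mul]
        simp only [Complex.add_re, Complex.ofReal_re, e5]
        linarith)
    rw [intervalIntegral.integral_add (j1.const_mul _) (j2.const_mul _),
      intervalIntegral.integral_add hP.re.1 (j3.const_mul 2), e, ← Complex.sub_re] at key
    simp only [intervalIntegral.integral_const_mul] at key
    have := (Complex.re_le_norm _).trans hβ
    simp only [wNormSq]
    linarith
  · have e := hP.im.integral_eq
    have hint : IntervalIntegrable (fun y => (((lam.im + k * Ue) * (g y ^ 2 * ‖ω y‖ ^ 2)
        - (((lam.re * (g y ^ 2 * ‖ω y‖ ^ 2) + g y ^ 2 * ‖v y‖ ^ 2 : ℝ) : ℂ)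
        + Complex.I * (((lam.im + k * U y) * (g y ^ 2 * ‖ω y‖ ^ 2) : ℝ) : ℂ)
        + 2 * g y * g1 y * (v y * starRingEnd ℂ (ω y))).im))) volume 0 1 :=
      (j1.const_mul _).sub hP.im.1
    have hpt := intervalIntegral.norm_integral_le_of_norm_le (μ := volume) zero_le_one
      (f := fun y => (((lam.im + k * Ue) * (g y ^ 2 * ‖ω y‖ ^ 2)
        - (((lam.re * (g y ^ 2 * ‖ω y‖ ^ 2) + g y ^ 2 * ‖v y‖ ^ 2 : ℝ) : ℂ)
        + Complex.I * (((lam.im + k * U y) * (g y ^ 2 * ‖ω y‖ ^ 2) : ℝ) : ℂ)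
        + 2 * g y * g1 y * (v y * starRingEnd ℂ (ω y))).im)))
      (Filter.Eventually.of_forall fun y hy => by
        have hy' := Ioc_subset_Icc_self hy
        have e5 : (Complex.I * (((lam.im + k * U y) * (g y ^ 2 * ‖ω y‖ ^ 2) : ℝ) : ℂ)).im
            = (lam.im + k * U y) * (g y ^ 2 * ‖ω y‖ ^ 2) := by
          rw [Complex.im_mul_ofReal, Complex.I_im, one_mul]
        simp only [Complex.add_im, Complex.ofReal_im, e5]
        have e6 : (lam.im + k * Ue) * (g y ^ 2 * ‖ω y‖ ^ 2) - (0 + (lam.im + k * U y)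
            * (g y ^ 2 * ‖ω y‖ ^ 2) + (2 * (g y : ℂ) * g1 y * (v y * starRingEnd ℂ (ω y))).im)
            = -(k * (U y - Ue) * (g y ^ 2 * ‖ω y‖ ^ 2))
              - (2 * (g y : ℂ) * g1 y * (v y * starRingEnd ℂ (ω y))).im := by ring
        rw [e6, Real.norm_eq_abs]
        refine (abs_sub _ _).trans (add_le_add (b := |k| * L * (d y * (g y ^ 2 * ‖ω y‖ ^ 2))) ?_
          ((Complex.abs_im_le_norm _).trans (hcross y)))
        rw [abs_neg, abs_mul, abs_mul, abs_of_nonneg (by positivity : 0 ≤ g y ^ 2 * ‖ω y‖ ^ 2)]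
        calc |k| * |U y - Ue| * (g y ^ 2 * ‖ω y‖ ^ 2)
            ≤ |k| * (L * d y) * (g y ^ 2 * ‖ω y‖ ^ 2) := by
              gcongr
              exact hUd y hy'
          _ = _ := by ring)
      ((j4.const_mul (|k| * L)).add ((j2.const_mul (1 / 2)).add (j3.const_mul 2)))
    rw [intervalIntegral.integral_sub (j1.const_mul _) hP.im.1, e, ← Complex.sub_im,
      intervalIntegral.integral_add (j4.const_mul _) ((j2.const_mul _).add (j3.const_mul 2)),
      intervalIntegral.integral_add (j2.const_mul _) (j3.const_mul 2)] at hpt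
    simp only [intervalIntegral.integral_const_mul] at hpt
    have h1 := (Complex.abs_im_le_norm _).trans hβ
    have h2 := abs_sub_abs_le_abs_sub ((lam.im + k * Ue) * wNormSq g ω)
      ((g 1 : ℂ) ^ 2 * (v 1 * starRingEnd ℂ (ω 1)) - (g 0 : ℂ) ^ 2 * (v 0 * starRingEnd ℂ (ω 0))).im
    rw [abs_mul, abs_of_nonneg (wNormSq_nonneg g ω)] at h2
    rw [Real.norm_eq_abs] at hpt
    simp only [wNormSq] at h2 ⊢
    linarith

/-- Hypotheses on the distance `d` to one end point, where `U = Ue`. -/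
structure IsEndDist (U d : ℝ → ℝ) (L Ue σ : ℝ) : Prop where
  sq_eq : σ ^ 2 = 1
  deriv : ∀ y, HasDerivAt d σ y
  nonneg : ∀ y ∈ Icc (0 : ℝ) 1, 0 ≤ d y
  diff_le : ∀ y ∈ Icc (0 : ℝ) 1, |U y - Ue| ≤ L * d y

theorem IsEndDist.isPrim {σ : ℝ} (h : IsEndDist U d L Ue σ) : IsPrim d (fun _ => σ) :=
  IsPrim.of_hasDerivWithinAt (fun y _ => (h.deriv y).hasDerivWithinAt) continuousOn_const

theorem IsEndDist.isPrim_pow {σ : ℝ} (h : IsEndDist U d L Ue σ) (j : ℕ) :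
    IsPrim (fun y => d y ^ j) (fun y => j * d y ^ (j - 1) * σ) :=
  IsPrim.of_hasDerivWithinAt (fun y _ => ((h.deriv y).pow j).hasDerivWithinAt)
    ((continuousOn_const.mul (h.isPrim.continuousOn.pow _)).mul continuousOn_const)

/-- The energies with the weights `d ^ j`. -/
theorem weighted_energy_pow {σ β : ℝ} (hd : IsEndDist U d L Ue σ)
    (hω : IsPrim ω v)
    (hv : IsPrim v (fun y => pCoeff U k lam y * ω y)) (h0 : d 0 = 0 ∨ v 0 = 0)
    (h1 : d 1 = 0 ∨ v 1 = 0) (j : ℕ)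
    (hβ : j = 0 → ‖v 1 * starRingEnd ℂ (ω 1) - v 0 * starRingEnd ℂ (ω 0)‖ ≤ β)
    (hβ0 : 0 ≤ β) (hL : 1 ≤ L) {r : ℝ} (hr : 0 < r) (hlam : lam.re = r ^ 2)
    (hk : (1 + 2 * (j + 1) ^ 2) * L * |k| ≤ r ^ 3) :
    r ^ 2 * wNormSq (fun y => d y ^ j) ω + 1 / 2 * wNormSq (fun y => d y ^ j) v
      ≤ 2 * j ^ 2 * wNormSq (fun y => d y ^ (j - 1)) ω + β ∧
    ‖lam + Complex.I * k * Ue‖ * wNormSq (fun y => d y ^ j) ω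
      ≤ 8 * j ^ 2 * wNormSq (fun y => d y ^ (j - 1)) ω + 4 * β := by
  have hdc := hd.isPrim.continuousOn
  -- For `i = 0` the truncated exponent `i - 1` is harmless because of the factor `i`.
  have hder (i : ℕ) : wNormSq (fun y => i * d y ^ (i - 1) * σ) ω
      = i ^ 2 * wNormSq (fun y => d y ^ (i - 1)) ω := by
    rw [wNormSq, wNormSq, ← intervalIntegral.integral_const_mul]
    congr 1
    ext y
    rw [mul_pow, hd.sq_eq]
    ring
  have hc (i : ℕ) : ContinuousOn (fun y => i * d y ^ (i - 1) * σ) (Icc 0 1) :=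
    (continuousOn_const.mul (hdc.pow _)).mul continuousOn_const
  have hz (i : ℕ) (hi : i ≠ 0) : (((d 1 ^ i : ℝ) : ℂ)) ^ 2 * (v 1 * starRingEnd ℂ (ω 1))
      - ((d 0 ^ i : ℝ) : ℂ) ^ 2 * (v 0 * starRingEnd ℂ (ω 0)) = 0 := by
    rcases h0 with h0 | h0 <;> rcases h1 with h1 | h1 <;> simp [h0, h1, hi]
  obtain ⟨a1, a2⟩ := weighted_energy (β := β) (hd.isPrim_pow j) (hc j) hω hv (by
    rcases eq_or_ne j 0 with h | h
    · simpa [h] using hβ h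
    · rw [hz j h]
      simpa using hβ0) hdc hd.diff_le
  -- The weight `d ^ (j + 1)` vanishes at the end that carries flux, so there is no boundary term.
  -- This bound of the next moment by the present one absorbs the error from freezing `U`.
  obtain ⟨b1, -⟩ := weighted_energy (β := 0) (hd.isPrim_pow (j + 1)) (hc (j + 1)) hω hv (by
    rw [hz _ j.succ_ne_zero]
    simp) hdc hd.diff_le
  rw [hder, hlam] at a1
  rw [hder, hlam] at b1
  rw [hder] at a2
  simp only [Nat.add_sub_cancel, add_zero] at b1
  push_cast at b1
  have hA := wNormSq_nonneg (fun y => d y ^ j) ω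
  have hA1 := wNormSq_nonneg (fun y => d y ^ (j + 1)) ω
  have hB := wNormSq_nonneg (fun y => d y ^ j) v
  have hB1 := wNormSq_nonneg (fun y => d y ^ (j + 1)) v
  have jA := intervalIntegrable_wNormSq (g := fun y => d y ^ j) (hdc.pow j) hω.continuousOn
  have jA1 := intervalIntegrable_wNormSq (g := fun y => d y ^ (j + 1)) (hdc.pow (j + 1)) hω.continuousOn
  -- Young's inequality `d ≤ (1/r + r d²)/2`. The next moment is smaller by a factor of order `r⁻²`,
  -- so the error is of order `|k| L / r` times the present moment, which `hk` makes at most `r²/2`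
  -- times it.
  have hmid : ∫ y in (0 : ℝ)..1, d y * ((d y ^ j) ^ 2 * ‖ω y‖ ^ 2)
      ≤ 1 / 2 * (1 / r * wNormSq (fun y => d y ^ j) ω + r * wNormSq (fun y => d y ^ (j + 1)) ω) := by
    have := integral_mono_unit (f := fun y => d y * ((d y ^ j) ^ 2 * ‖ω y‖ ^ 2))
      (intervalIntegrable_of_continuousOn
        (hdc.mul (((hdc.pow j).pow 2).mul (hω.continuousOn.norm.pow 2))))
      ((jA.const_mul (1 / 2 * (1 / r))).add (jA1.const_mul (1 / 2 * r))) (by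
        intro y hy
        have e : d y ≤ 1 / 2 * (1 / r) + 1 / 2 * r * d y ^ 2 := by
          have : 0 ≤ (1 - r * d y) ^ 2 / (2 * r) := by positivity
          have e2 : (1 - r * d y) ^ 2 / (2 * r) = 1 / 2 * (1 / r) + 1 / 2 * r * d y ^ 2 - d y := by
            field_simp
            ring
          linarith
        calc d y * ((d y ^ j) ^ 2 * ‖ω y‖ ^ 2)
            ≤ (1 / 2 * (1 / r) + 1 / 2 * r * d y ^ 2) * ((d y ^ j) ^ 2 * ‖ω y‖ ^ 2) := by gcongr
          _ = _ := by ring)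
    rw [intervalIntegral.integral_add (jA.const_mul _) (jA1.const_mul _),
      intervalIntegral.integral_const_mul, intervalIntegral.integral_const_mul] at this
    simp only [wNormSq]
    linarith
  simp only [wNormSq] at hmid
  have hr2 : 0 < r ^ 2 := by positivity
  set A := wNormSq (fun y => d y ^ j) ω with hAdef
  set A1 := wNormSq (fun y => d y ^ (j + 1)) ω with hA1def
  set B := wNormSq (fun y => d y ^ j) v
  set A' := wNormSq (fun y => d y ^ (j - 1)) ω
  refine ⟨by linarith, ?_⟩
  have hkL : 0 ≤ |k| * L := by positivity
  have c1 : r * A1 ≤ 2 * (j + 1) ^ 2 * A / r := by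
    rw [le_div_iff₀ hr]
    linarith
  have c2 : |k| * L * (1 / 2 * (1 / r * A + r * A1)) ≤ 1 / 2 * (r ^ 2 * A) := by
    calc |k| * L * (1 / 2 * (1 / r * A + r * A1))
        ≤ |k| * L * (1 / 2 * (1 / r * A + 2 * (j + 1) ^ 2 * A / r)) := by gcongr
      _ = 1 / 2 * (((1 + 2 * (j + 1) ^ 2) * L * |k|) * A / r) := by ring
      _ ≤ 1 / 2 * (r ^ 3 * A / r) := by gcongr
      _ = _ := by field_simp
  have c3 : |lam.im + k * Ue| * A ≤ 1 / 2 * (r ^ 2 * A) + 1 / 2 * B + 2 * (j ^ 2 * A') + β := by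
    refine a2.trans ?_
    have := mul_le_mul_of_nonneg_left hmid hkL
    simp only [hAdef, hA1def, wNormSq] at c2 ⊢
    linarith
  have c4 : ‖lam + Complex.I * k * Ue‖ ≤ r ^ 2 + |lam.im + k * Ue| := by
    have := Complex.norm_le_abs_re_add_abs_im (lam + Complex.I * k * Ue)
    have e1 : (lam + Complex.I * k * Ue).re = r ^ 2 := by simp [hlam]
    have e2 : (lam + Complex.I * k * Ue).im = lam.im + k * Ue := by simp
    rw [e1, e2, abs_of_pos hr2] at this
    exact this
  have c5 := mul_le_mul_of_nonneg_right c4 hA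
  have c6 : 0 ≤ |lam.im + k * Ue| * A := by positivity
  nlinarith

theorem integral_inv_one_add_sq_le {σ n : ℝ} (hd : IsEndDist U d L Ue σ) (hn : 0 < n) :
    ∫ y in (0 : ℝ)..1, 1 / (1 + (n * d y) ^ 2) ≤ 2 / n := by
  have hP : IsPrim (fun y => σ * (Real.arctan (n * d y) / n)) (fun y => 1 / (1 + (n * d y) ^ 2)) := by
    refine IsPrim.of_hasDerivWithinAt (fun y _ => HasDerivAt.hasDerivWithinAt ?_) ?_
    · have h := (((hd.deriv y).const_mul n).arctan.div_const n).const_mul σ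
      refine h.congr_deriv ?_
      field_simp
      exact hd.sq_eq
    · refine continuousOn_const.div ?_ fun y _ => by positivity
      exact continuousOn_const.add ((continuousOn_const.mul hd.isPrim.continuousOn).pow 2)
  rw [hP.integral_eq, ← mul_sub, ← sub_div]
  have h0 := Real.arctan_nonneg.2 (mul_nonneg hn.le (hd.nonneg 0 zero_mem_unit))
  have h1 := Real.arctan_nonneg.2 (mul_nonneg hn.le (hd.nonneg 1 one_mem_unit))
  have h2 := Real.arctan_lt_pi_div_two (n * d 0)
  have h3 := Real.arctan_lt_pi_div_two (n * d 1)
  have h4 := Real.pi_le_four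
  have hσ : |σ| = 1 := by
    rw [← sq_eq_sq₀ (abs_nonneg _) zero_le_one, sq_abs, hd.sq_eq, one_pow]
  refine (le_abs_self _).trans ?_
  rw [abs_mul, hσ, one_mul, abs_div, abs_of_pos hn]
  gcongr
  rw [abs_le]
  constructor <;> linarith

/-- Bounds for the boundary layer at one end point. -/
theorem layer_bounds {σ w r : ℝ} (hd : IsEndDist U d L Ue σ)
    (hω : IsPrim ω v)
    (hv : IsPrim v (fun y => pCoeff U k lam y * ω y)) (h0 : d 0 = 0 ∨ v 0 = 0)
    (h1 : d 1 = 0 ∨ v 1 = 0)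
    (hβ : ‖v 1 * starRingEnd ℂ (ω 1) - v 0 * starRingEnd ℂ (ω 0)‖ ≤ w)
    (hw : w = ‖ω 0‖ ∨ w = ‖ω 1‖) (hL : 1 ≤ L) (hr : 1 ≤ r) (hlam : lam.re = r ^ 2)
    (hk : 19 * L * |k| ≤ r ^ 3) {n : ℝ} (hn : 1 ≤ n) (hn2 : ‖lam + Complex.I * k * Ue‖ = n ^ 2) :
    normSq ω ≤ 40 / n ^ 3 ∧ (∀ y ∈ Icc (0 : ℝ) 1, ‖ω y‖ ≤ 10 / n) ∧
      ∫ y in (0 : ℝ)..1, d y * ‖ω y‖ ≤ 5281 / n ^ 3 := by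
  have hdc := hd.isPrim.continuousOn
  have hw0 : 0 ≤ w := (norm_nonneg _).trans hβ
  have hn0 : 0 < n := one_pos.trans_le hn
  have hLk : 0 ≤ L * |k| := by positivity
  -- The moments `j = 0, 1, 2` are used; the constant `19 = 1 + 2 · 3²` is the requirement for `j =
  -- 2`.
  obtain ⟨a1, a2⟩ := weighted_energy_pow hd hω hv h0 h1 0 (fun _ => hβ) hw0 hL
    (one_pos.trans_le hr) hlam (by norm_num; linarith)
  obtain ⟨-, b2⟩ := weighted_energy_pow (β := 0) hd hω hv h0 h1 1 (by simp) le_rfl hL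
    (one_pos.trans_le hr) hlam (by norm_num; linarith)
  obtain ⟨-, c2⟩ := weighted_energy_pow (β := 0) hd hω hv h0 h1 2 (by simp) le_rfl hL
    (one_pos.trans_le hr) hlam (by norm_num; linarith)
  rw [hn2] at a2 b2 c2
  simp only [pow_zero, pow_one, wNormSq_one] at a1 a2 b2 c2
  norm_num [wNormSq_one] at a1 a2 b2 c2
  have hA0 := normSq_nonneg ω
  have hB0 := normSq_nonneg v
  have hB : normSq v ≤ 2 * w := by nlinarith [mul_nonneg (sq_nonneg r) hA0]
  -- Sobolev's inequality with `‖ω‖² ≤ 4w/n²` and `‖v‖² ≤ 2w`. Since `w` is itself a value of `‖ω‖`,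
  -- this closes: `w² ≤ 10w/n` gives `w ≤ 10/n`.
  have hsup : ∀ y ∈ Icc (0 : ℝ) 1, ‖ω y‖ ^ 2 ≤ 10 * w / n := by
    intro y hy
    refine (hω.norm_sq_le hv.sqInt hy).trans ?_
    have e1 : normSq ω ≤ 4 * w / n := by
      rw [le_div_iff₀ hn0]
      nlinarith [mul_nonneg hA0 (by nlinarith : 0 ≤ n ^ 2 - n)]
    have e2 : √(normSq ω) * √(normSq v) ≤ 3 * w / n := by
      rw [← Real.sqrt_mul hA0]
      refine Real.sqrt_le_iff.2 ⟨by positivity, ?_⟩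
      have e3 : normSq ω ≤ 4 * w / n ^ 2 := by
        rw [le_div_iff₀ (by positivity)]
        linarith
      calc normSq ω * normSq v ≤ 4 * w / n ^ 2 * (2 * w) := by gcongr
        _ = 8 * w ^ 2 / n ^ 2 := by ring
        _ ≤ 9 * w ^ 2 / n ^ 2 := by
          gcongr
          norm_num
        _ = _ := by ring
    calc _ ≤ 4 * w / n + 2 * (3 * w / n) := by gcongr
      _ = _ := by ring
  have hwn : w ≤ 10 / n := by
    have : w ^ 2 ≤ 10 * w / n := by
      rcases hw with h | h
      · rw [h] at hsup ⊢
        exact hsup 0 zero_mem_unit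
      · rw [h] at hsup ⊢
        exact hsup 1 one_mem_unit
    rcases hw0.eq_or_lt with h | h
    · rw [← h]
      positivity
    · refine le_of_mul_le_mul_right ?_ h
      calc w * w = w ^ 2 := by ring
        _ ≤ _ := this
        _ = _ := by ring
  have hA : normSq ω ≤ 40 / n ^ 3 := by
    have : normSq ω ≤ 4 * w / n ^ 2 := by
      rw [le_div_iff₀ (by positivity)]
      linarith
    calc normSq ω ≤ 4 * w / n ^ 2 := this
      _ ≤ 4 * (10 / n) / n ^ 2 := by gcongr
      _ = _ := by
        field_simp
        norm_num
  have hA1 : wNormSq d ω ≤ 320 / n ^ 5 := by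
    have : wNormSq d ω ≤ 8 * normSq ω / n ^ 2 := by
      rw [le_div_iff₀ (by positivity)]
      linarith
    calc _ ≤ 8 * normSq ω / n ^ 2 := this
      _ ≤ 8 * (40 / n ^ 3) / n ^ 2 := by gcongr
      _ = _ := by
        field_simp
        norm_num
  have hA2 : wNormSq (fun y => d y ^ 2) ω ≤ 10240 / n ^ 7 := by
    have : wNormSq (fun y => d y ^ 2) ω ≤ 32 * wNormSq d ω / n ^ 2 := by
      rw [le_div_iff₀ (by positivity)]
      linarith
    calc _ ≤ 32 * wNormSq d ω / n ^ 2 := this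
      _ ≤ 32 * (320 / n ^ 5) / n ^ 2 := by gcongr
      _ = _ := by
        field_simp
        norm_num
  refine ⟨hA, fun y hy => ?_, ?_⟩
  · refine abs_le_of_sq_le_sq' ?_ (by positivity) |>.2
    calc ‖ω y‖ ^ 2 ≤ 10 * w / n := hsup y hy
      _ ≤ 10 * (10 / n) / n := by gcongr
      _ = _ := by ring
  · have j1 := intervalIntegrable_wNormSq hdc hω.continuousOn
    have j2 := intervalIntegrable_wNormSq (g := fun y => d y ^ 2) (hdc.pow 2) hω.continuousOn
    have j3 : IntervalIntegrable (fun y => 1 / (1 + (n * d y) ^ 2)) volume 0 1 :=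
      intervalIntegrable_of_continuousOn (continuousOn_const.div
        (continuousOn_const.add ((continuousOn_const.mul hdc).pow 2)) fun y _ => by positivity)
    -- Young's inequality with the weight `1 / (1 + (n d)²)`, of integral at most `2/n`, trades the
    -- `L¹` moment for two `L²` moments; the constants add up to `160 + 5120 + 1 = 5281`.
    have key := integral_mono_unit (f := fun y => d y * ‖ω y‖)
      (intervalIntegrable_of_continuousOn (hdc.mul hω.continuousOn.norm))
      (((j1.const_mul (n ^ 2 / 2)).add (j2.const_mul (n ^ 4 / 2))).add
        (j3.const_mul (1 / (2 * n ^ 2)))) (by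
        intro y hy
        have hs : 0 < 1 + (n * d y) ^ 2 := by positivity
        have e : n ^ 2 / 2 * (d y ^ 2 * ‖ω y‖ ^ 2) + n ^ 4 / 2 * ((d y ^ 2) ^ 2 * ‖ω y‖ ^ 2)
            + 1 / (2 * n ^ 2) * (1 / (1 + (n * d y) ^ 2)) - d y * ‖ω y‖
            = (n ^ 2 * (1 + (n * d y) ^ 2) * (d y * ‖ω y‖) - 1) ^ 2
              / (2 * n ^ 2 * (1 + (n * d y) ^ 2)) := by
          field_simp
          ring
        have : 0 ≤ (n ^ 2 * (1 + (n * d y) ^ 2) * (d y * ‖ω y‖) - 1) ^ 2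
              / (2 * n ^ 2 * (1 + (n * d y) ^ 2)) := by positivity
        linarith)
    rw [intervalIntegral.integral_add ((j1.const_mul _).add (j2.const_mul _)) (j3.const_mul _),
      intervalIntegral.integral_add (j1.const_mul _) (j2.const_mul _),
      intervalIntegral.integral_const_mul, intervalIntegral.integral_const_mul,
      intervalIntegral.integral_const_mul] at key
    have h3 := integral_inv_one_add_sq_le hd hn0
    simp only [wNormSq] at hA1 hA2
    refine key.trans ?_
    calc _ ≤ n ^ 2 / 2 * (320 / n ^ 5) + n ^ 4 / 2 * (10240 / n ^ 7) + 1 / (2 * n ^ 2) * (2 / n) := by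
          gcongr
      _ = _ := by
        field_simp
        norm_num

end local_problem

/-! ### Identities and estimates for the stream function -/

section stream
variable {Φ u ω : ℝ → ℂ}

theorem integral_id_mul_vort (hΦ : IsPrim Φ u) (hu : IsPrim u ω) (h0 : Φ 0 = 0) {y : ℝ}
    (hy : y ∈ Icc (0 : ℝ) 1) : ∫ s in (0 : ℝ)..y, (s : ℂ) * ω s = y * u y - Φ y := by
  have h := (((IsPrim.id.ofReal.mul hu).sub hΦ).congr_right (g := fun s : ℝ => (s : ℂ) * ω s)
    fun s _ => by simp).sub_eq zero_mem_unit hy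
  rw [← h]
  simp [h0]

theorem integral_one_sub_mul_vort (hΦ : IsPrim Φ u) (hu : IsPrim u ω) (h1 : Φ 1 = 0) {y : ℝ}
    (hy : y ∈ Icc (0 : ℝ) 1) :
    ∫ s in y..1, (1 - (s : ℂ)) * ω s = -((1 - y) * u y) - Φ y := by
  have h := (((((IsPrim.const 1).sub IsPrim.id.ofReal).mul hu).add hΦ).congr_right
    (g := fun s : ℝ => (1 - (s : ℂ)) * ω s) fun s _ => by simp).sub_eq hy one_mem_unit
  rw [← h]
  simp [h1]
  ring

theorem continuousOn_ofReal_id : ContinuousOn (fun y : ℝ => (y : ℂ)) (Icc 0 1) :=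
  Complex.continuous_ofReal.continuousOn

theorem norm_velocity_le (hΦ : IsPrim Φ u) (hu : IsPrim u ω) (hω : ContinuousOn ω (Icc 0 1))
    (h0 : Φ 0 = 0) (h1 : Φ 1 = 0) :
    ‖u 0‖ ≤ √(normSq ω) ∧ ‖u 1‖ ≤ √(normSq ω) := by
  have hi := (sqInt_of_continuousOn hω).integral_norm_le
  have hn := (intervalIntegrable_of_continuousOn hω).norm
  constructor
  · have h := integral_one_sub_mul_vort hΦ hu h1 zero_mem_unit
    rw [h0] at h
    have e : ‖u 0‖ = ‖∫ s in (0 : ℝ)..1, (1 - (s : ℂ)) * ω s‖ := by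
      rw [h]
      simp
    rw [e]
    refine ((norm_integral_unit_le _).trans (integral_mono_unit ?_ hn fun s hs => ?_)).trans hi
    · exact (intervalIntegrable_of_continuousOn
        ((continuousOn_const.sub continuousOn_ofReal_id).mul hω)).norm
    · have e2 : (1 - (s : ℂ)) = ((1 - s : ℝ) : ℂ) := by push_cast; ring
      rw [e2, norm_mul, Complex.norm_real, Real.norm_eq_abs, abs_of_nonneg (sub_nonneg.2 hs.2)]
      exact mul_le_of_le_one_left (norm_nonneg _) (by linarith [hs.1])
  · have h := integral_id_mul_vort hΦ hu h0 one_mem_unit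
    rw [h1] at h
    have e : ‖u 1‖ = ‖∫ s in (0 : ℝ)..1, (s : ℂ) * ω s‖ := by
      rw [h]
      simp
    rw [e]
    refine ((norm_integral_unit_le _).trans (integral_mono_unit ?_ hn fun s hs => ?_)).trans hi
    · exact (intervalIntegrable_of_continuousOn (continuousOn_ofReal_id.mul hω)).norm
    · rw [norm_mul, Complex.norm_real, Real.norm_eq_abs, abs_of_nonneg hs.1]
      exact mul_le_of_le_one_left (norm_nonneg _) hs.2

/-- A bound of the stream function by a weighted norm of the vorticity. -/
theorem norm_stream_le (hΦ : IsPrim Φ u) (hu : IsPrim u ω) (hω : ContinuousOn ω (Icc 0 1))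
    (h0 : Φ 0 = 0) (h1 : Φ 1 = 0) {d : ℝ → ℝ} (hd : ContinuousOn d (Icc 0 1))
    (hd1 : ∀ y ∈ Icc (0 : ℝ) 1, ∀ s ∈ Icc (0 : ℝ) y, (1 - y) * s ≤ d s)
    (hd2 : ∀ y ∈ Icc (0 : ℝ) 1, ∀ s ∈ Icc y 1, y * (1 - s) ≤ d s)
    {y : ℝ} (hy : y ∈ Icc (0 : ℝ) 1) : ‖Φ y‖ ≤ ∫ s in (0 : ℝ)..1, d s * ‖ω s‖ := by
  have e1 := integral_id_mul_vort hΦ hu h0 hy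
  have e2 := integral_one_sub_mul_vort hΦ hu h1 hy
  have hI : IntervalIntegrable (fun s => d s * ‖ω s‖) volume 0 1 :=
    intervalIntegrable_of_continuousOn (hd.mul hω.norm)
  -- The Dirichlet Green function, split at `s = y`. Both pieces are dominated by `d`, which will be
  -- the distance to either end.
  have e3 : Φ y = -((∫ s in (0 : ℝ)..y, ((1 - y : ℝ) : ℂ) * ((s : ℂ) * ω s))
      + ∫ s in y..1, (y : ℂ) * ((1 - (s : ℂ)) * ω s)) := by
    rw [intervalIntegral.integral_const_mul, intervalIntegral.integral_const_mul, e1, e2]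
    push_cast
    ring
  have n1 : ‖∫ s in (0 : ℝ)..y, ((1 - y : ℝ) : ℂ) * ((s : ℂ) * ω s)‖
      ≤ ∫ s in (0 : ℝ)..y, d s * ‖ω s‖ := by
    refine intervalIntegral.norm_integral_le_of_norm_le hy.1 (Filter.Eventually.of_forall
      fun s hs => ?_) (intervalIntegrable_sub hI zero_mem_unit hy)
    rw [norm_mul, norm_mul, Complex.norm_real, Complex.norm_real, Real.norm_eq_abs,
      Real.norm_eq_abs, abs_of_nonneg hs.1.le, abs_of_nonneg (sub_nonneg.2 hy.2), ← mul_assoc]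
    exact mul_le_mul_of_nonneg_right (hd1 y hy s (Ioc_subset_Icc_self hs)) (norm_nonneg _)
  have n2 : ‖∫ s in y..1, (y : ℂ) * ((1 - (s : ℂ)) * ω s)‖ ≤ ∫ s in y..1, d s * ‖ω s‖ := by
    refine intervalIntegral.norm_integral_le_of_norm_le hy.2 (Filter.Eventually.of_forall
      fun s hs => ?_) (intervalIntegrable_sub hI hy one_mem_unit)
    have e4 : (1 - (s : ℂ)) = ((1 - s : ℝ) : ℂ) := by push_cast; ring
    rw [e4, norm_mul, norm_mul, Complex.norm_real, Complex.norm_real, Real.norm_eq_abs,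
      Real.norm_eq_abs, abs_of_nonneg hy.1, abs_of_nonneg (sub_nonneg.2 hs.2), ← mul_assoc]
    exact mul_le_mul_of_nonneg_right (hd2 y hy s (Ioc_subset_Icc_self hs)) (norm_nonneg _)
  rw [e3, norm_neg, ← intervalIntegral.integral_add_adjacent_intervals
    (intervalIntegrable_sub hI zero_mem_unit hy) (intervalIntegrable_sub hI hy one_mem_unit)]
  exact (norm_add_le _ _).trans (add_le_add n1 n2)

theorem eq_zero_of_normSq_eq_zero {v : ℝ → ℂ} (hω : IsPrim ω v) (hv : SqInt v)
    (h : normSq ω = 0) : ∀ y ∈ Icc (0 : ℝ) 1, ω y = 0 := by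
  intro y hy
  have := hω.norm_sq_le hv hy
  rw [h] at this
  simpa using this

end stream

/-! ### Relations between velocity and vorticity flux at the boundary -/

section identities
variable {U U1 U2 : ℝ → ℝ} {L k : ℝ} {lam : ℂ} {f Φ u ω v : ℝ → ℂ}

/-- The once integrated vorticity equation. -/
theorem Sol.isPrim_flux (hU : IsPrim U U1) (hU1 : IsPrim U1 U2)
    (h : Sol (pCoeff U k lam) (qCoeff U2 k) f Φ u ω v) :
    IsPrim (fun y => pCoeff U k lam y * u y - Complex.I * k * U1 y * Φ y - v y) f :=
  ((((hU.pCoeff k lam).mul h.vel).sub ((hU1.ofReal.const_mul (Complex.I * k)).mul h.stream)).sub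
    h.flux).congr_right fun y _ => by
      simp only [qCoeff]
      ring

/-- This couples the two ends. For a force of zero mean, a clamped solution has equal vorticity
fluxes, and a solution with equal vorticity fluxes has equal values of `p u`. -/
theorem Sol.flux_eq (hU : IsPrim U U1) (hU1 : IsPrim U1 U2)
    (h : Sol (pCoeff U k lam) (qCoeff U2 k) f Φ u ω v) (h0 : Φ 0 = 0) (h1 : Φ 1 = 0) :
    pCoeff U k lam 1 * u 1 - v 1 - (pCoeff U k lam 0 * u 0 - v 0) = ∫ y in (0 : ℝ)..1, f y := by
  rw [(h.isPrim_flux hU hU1).integral_eq, h0, h1]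
  ring

theorem continuousOn_pCoeff (hUc : ContinuousOn U (Icc 0 1)) (k : ℝ) (lam : ℂ) :
    ContinuousOn (pCoeff U k lam) (Icc 0 1) :=
  continuousOn_const.add (continuousOn_const.mul (Complex.continuous_ofReal.comp_continuousOn hUc))

/-- Testing with the affine function `1 - y`, which vanishes at the far end, and freezing `U` at `U
0` turns `∫(1 - y)pω` into `-p(0)u(0)` plus a moment. For a thin layer the right side is small, so
`p(0)u(0)` nearly equals `v(0)`. -/
theorem Sol.local_left (hUc : ContinuousOn U (Icc 0 1))
    (h : Sol (pCoeff U k lam) (fun _ => 0) (fun _ => 0) Φ u ω v)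
    (hUd : ∀ y ∈ Icc (0 : ℝ) 1, |U y - U 0| ≤ L * y) (h0 : Φ 0 = 0) (h1 : Φ 1 = 0) :
    ‖pCoeff U k lam 0 * u 0 - v 0‖
      ≤ |k| * L * (∫ y in (0 : ℝ)..1, y * (1 - y) * ‖ω y‖) + ‖ω 1 - ω 0‖ := by
  have hω := h.vort.continuousOn
  have e1 := integral_one_sub_mul_vort h.stream h.vel h1 zero_mem_unit
  have e2 := (((((IsPrim.const 1).sub IsPrim.id.ofReal).mul h.flux).add h.vort).congr_right
    (g := fun y : ℝ => pCoeff U k lam 0 * ((1 - (y : ℂ)) * ω y)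
      + Complex.I * k * ((1 - y) * (U y - U 0) * ω y)) fun y _ => by
        simp [pCoeff]
        ring).integral_eq
  have c1 : ContinuousOn (fun y : ℝ => (1 - (y : ℂ)) * ω y) (Icc 0 1) :=
    (continuousOn_const.sub continuousOn_ofReal_id).mul hω
  have c2 : ContinuousOn (fun y : ℝ => (1 - (y : ℂ)) * (U y - U 0) * ω y) (Icc 0 1) :=
    ((continuousOn_const.sub continuousOn_ofReal_id).mul
      ((Complex.continuous_ofReal.comp_continuousOn hUc).sub continuousOn_const)).mul hω
  rw [intervalIntegral.integral_add
    ((intervalIntegrable_of_continuousOn c1).const_mul _)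
    ((intervalIntegrable_of_continuousOn c2).const_mul _),
    intervalIntegral.integral_const_mul, intervalIntegral.integral_const_mul, e1] at e2
  have e3 : pCoeff U k lam 0 * u 0 - v 0 = Complex.I * k *
      (∫ y in (0 : ℝ)..1, (1 - (y : ℂ)) * (U y - U 0) * ω y) - (ω 1 - ω 0) := by
    simp only [h0, Complex.ofReal_zero, Complex.ofReal_one] at e2
    linear_combination -e2
  rw [e3]
  refine (norm_sub_le _ _).trans (add_le_add ?_ le_rfl)
  rw [norm_mul, norm_mul, Complex.norm_I, one_mul, Complex.norm_real, Real.norm_eq_abs, mul_assoc,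
    ← intervalIntegral.integral_const_mul]
  refine mul_le_mul_of_nonneg_left ((norm_integral_unit_le _).trans (integral_mono_unit
    (intervalIntegrable_of_continuousOn c2).norm ((intervalIntegrable_of_continuousOn
      ((continuousOn_id.mul (continuousOn_const.sub continuousOn_id)).mul hω.norm)).const_mul L)
    fun y hy => ?_)) (abs_nonneg _)
  have e4 : (1 - (y : ℂ)) * (U y - U 0) = (((1 - y) * (U y - U 0) : ℝ) : ℂ) := by push_cast; ring
  rw [e4, norm_mul, Complex.norm_real, Real.norm_eq_abs, abs_mul, abs_of_nonneg (sub_nonneg.2 hy.2)]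
  have := mul_le_mul_of_nonneg_left (hUd y hy)
    (mul_nonneg (sub_nonneg.2 hy.2) (norm_nonneg (ω y)))
  linarith

theorem Sol.local_right (hUc : ContinuousOn U (Icc 0 1))
    (h : Sol (pCoeff U k lam) (fun _ => 0) (fun _ => 0) Φ u ω v)
    (hUd : ∀ y ∈ Icc (0 : ℝ) 1, |U y - U 1| ≤ L * (1 - y)) (h0 : Φ 0 = 0) (h1 : Φ 1 = 0) :
    ‖pCoeff U k lam 1 * u 1 - v 1‖
      ≤ |k| * L * (∫ y in (0 : ℝ)..1, y * (1 - y) * ‖ω y‖) + ‖ω 1 - ω 0‖ := by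
  have hω := h.vort.continuousOn
  have e1 := integral_id_mul_vort h.stream h.vel h0 one_mem_unit
  have e2 := (((IsPrim.id.ofReal.mul h.flux).sub h.vort).congr_right
    (g := fun y : ℝ => pCoeff U k lam 1 * ((y : ℂ) * ω y)
      + Complex.I * k * (y * (U y - U 1) * ω y)) fun y _ => by
        simp [pCoeff]
        ring).integral_eq
  have c1 : ContinuousOn (fun y : ℝ => (y : ℂ) * ω y) (Icc 0 1) :=
    continuousOn_ofReal_id.mul hω
  have c2 : ContinuousOn (fun y : ℝ => (y : ℂ) * (U y - U 1) * ω y) (Icc 0 1) :=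
    (continuousOn_ofReal_id.mul
      ((Complex.continuous_ofReal.comp_continuousOn hUc).sub continuousOn_const)).mul hω
  rw [intervalIntegral.integral_add
    ((intervalIntegrable_of_continuousOn c1).const_mul _)
    ((intervalIntegrable_of_continuousOn c2).const_mul _),
    intervalIntegral.integral_const_mul, intervalIntegral.integral_const_mul, e1] at e2
  have e3 : pCoeff U k lam 1 * u 1 - v 1 = -(Complex.I * k *
      (∫ y in (0 : ℝ)..1, (y : ℂ) * (U y - U 1) * ω y)) - (ω 1 - ω 0) := by
    simp only [h1, Complex.ofReal_zero, Complex.ofReal_one] at e2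
    linear_combination e2
  rw [e3]
  refine (norm_sub_le _ _).trans (add_le_add ?_ le_rfl)
  rw [norm_neg, norm_mul, norm_mul, Complex.norm_I, one_mul, Complex.norm_real, Real.norm_eq_abs,
    mul_assoc, ← intervalIntegral.integral_const_mul]
  refine mul_le_mul_of_nonneg_left ((norm_integral_unit_le _).trans (integral_mono_unit
    (intervalIntegrable_of_continuousOn c2).norm ((intervalIntegrable_of_continuousOn
      ((continuousOn_id.mul (continuousOn_const.sub continuousOn_id)).mul hω.norm)).const_mul L)
    fun y hy => ?_)) (abs_nonneg _)
  have e4 : (y : ℂ) * (U y - U 1) = ((y * (U y - U 1) : ℝ) : ℂ) := by push_cast; ring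
  rw [e4, norm_mul, Complex.norm_real, Real.norm_eq_abs, abs_mul, abs_of_nonneg hy.1]
  have := mul_le_mul_of_nonneg_left (hUd y hy) (mul_nonneg hy.1 (norm_nonneg (ω y)))
  linarith

end identities

/-! ### The solution with unit vorticity flux at both ends -/

section unit_flux
variable {U U1 U2 W W1 : ℝ → ℝ} {L k : ℝ} {lam : ℂ}

theorem IsPrim.abs_sub_le {F f : ℝ → ℝ} {C : ℝ} (h : IsPrim F f)
    (hf : ∀ y ∈ Icc (0 : ℝ) 1, |f y| ≤ C) {a b : ℝ} (ha : a ∈ Icc (0 : ℝ) 1)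
    (hb : b ∈ Icc (0 : ℝ) 1) : |F b - F a| ≤ C * |b - a| := by
  rw [h.sub_eq ha hb, ← Real.norm_eq_abs]
  refine intervalIntegral.norm_integral_le_of_norm_le_const fun y hy => ?_
  exact hf y (uIcc_subset_Icc ha hb (uIoc_subset_uIcc hy))

theorem local_unique {Φ u ω v : ℝ → ℂ} (hUc : ContinuousOn U (Icc 0 1)) (hlam : 0 < lam.re)
    (h : Sol (pCoeff U k lam) (fun _ => 0) (fun _ => 0) Φ u ω v) (h0 : v 0 = 0) (h1 : v 1 = 0) :
    ∀ y ∈ Icc (0 : ℝ) 1, ω y = 0 := by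
  obtain ⟨B, hB⟩ := isCompact_Icc.exists_bound_of_continuousOn hUc
  have hv : IsPrim v (fun y => pCoeff U k lam y * ω y) := h.flux.congr_right fun y _ => by ring
  obtain ⟨e, -⟩ := weighted_energy (Ue := 0) (L := B) (d := fun _ => 1) (IsPrim.const (1 : ℝ))
    continuousOn_const h.vort hv (β := 0) (by simp [h0, h1]) continuousOn_const
    (fun y hy => by simpa using hB y hy)
  rw [wNormSq_one, wNormSq_one] at e
  refine eq_zero_of_normSq_eq_zero h.vort h.flux.sqInt (le_antisymm ?_ (normSq_nonneg ω))
  have e2 : wNormSq (fun _ => 0) ω = 0 := by simp [wNormSq]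
  rw [e2] at e
  have := normSq_nonneg v
  by_contra hc
  rw [not_le] at hc
  nlinarith [mul_pos hlam hc]

theorem Profile.neumann_unique {Φ u ω v : ℝ → ℂ} (hU : Profile U U1 U2 W W1 L)
    (hlam : 2 * L ^ 4 ≤ lam.re)
    (h : Sol (pCoeff U k lam) (qCoeff U2 k) (fun _ => 0) Φ u ω v)
    (hΦ0 : Φ 0 = 0) (hΦ1 : Φ 1 = 0) (h0 : v 0 = 0) (h1 : v 1 = 0) :
    ∀ y ∈ Icc (0 : ℝ) 1, ω y = 0 := by
  have hL : 0 < L := one_pos.trans_le hU.one_le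
  have hr : 0 < lam.re := (by positivity : (0 : ℝ) < 2 * L ^ 4).trans_le hlam
  obtain ⟨e, -⟩ := h.neumann_bounds hU hlam (sqInt_of_continuousOn continuousOn_const)
    hΦ0 hΦ1 h0 h1
  have e2 : normSq (fun _ => (0 : ℂ)) = 0 := by simp [normSq]
  rw [e2, Real.sqrt_zero, mul_zero] at e
  refine eq_zero_of_normSq_eq_zero h.vort h.flux.sqInt ?_
  have := Real.sqrt_nonneg (normSq ω)
  have h3 : √(normSq ω) = 0 := by
    refine le_antisymm ?_ this
    by_contra hc
    rw [not_le] at hc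
    nlinarith [mul_pos hr hc]
  exact (Real.sqrt_eq_zero (normSq_nonneg ω)).1 h3

/-- Existence and bounds of the solution with unit vorticity flux at both ends. -/
theorem exists_unit_flux (hU : Profile U U1 U2 W W1 L) {r : ℝ} (hr : 320 ≤ r)
    (hrL : 2 * L ^ 4 ≤ r ^ 2) (hlam : lam.re = r ^ 2) (hk : 200000 * L ^ 3 * |k| ≤ r ^ 3)
    {n : ℝ} (hn0 : 0 < n) (hn : n ^ 2 = min ‖pCoeff U k lam 0‖ ‖pCoeff U k lam 1‖) :
    ∃ Φ u ω v, Sol (pCoeff U k lam) (qCoeff U2 k) (fun _ => 0) Φ u ω v ∧ Φ 0 = 0 ∧ Φ 1 = 0 ∧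
      v 0 = 1 ∧ v 1 = 1 ∧ normSq ω ≤ 321 / n ^ 3 ∧ 1 / 2 ≤ ‖pCoeff U k lam 0 * u 0‖ := by
  have hL := hU.one_le
  have hUc := hU.prim.continuousOn
  have hr0 : 0 < r := by linarith
  have hLk : 0 ≤ L * |k| := by positivity
  have hL3 : L * |k| ≤ L ^ 3 * |k| := by
    have : L ≤ L ^ 3 := le_self_pow₀ hL (by norm_num)
    gcongr
  have hk19 : 19 * L * |k| ≤ r ^ 3 := by nlinarith
  have hre (y : ℝ) : (pCoeff U k lam y).re = r ^ 2 := by simp [pCoeff, hlam]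
  have hge (y : ℝ) : r ^ 2 ≤ ‖pCoeff U k lam y‖ := by
    rw [← hre y]
    exact Complex.re_le_norm _
  have hrn : r ≤ n := by
    refine le_of_sq_le_sq ?_ hn0.le
    rw [hn]
    exact le_min (hge 0) (hge 1)
  have hpc := continuousOn_pCoeff hUc k lam
  have hz : IntervalIntegrable (fun _ : ℝ => (0 : ℂ)) volume 0 1 := by simp
  have hlu := fun Φ u ω v (h : Sol (pCoeff U k lam) (fun _ => 0) (fun _ => 0) Φ u ω v)
    (_ : Φ 0 = 0) (_ : Φ 1 = 0) (h0 : v 0 = 0) (h1 : v 1 = 0) =>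
      local_unique hUc (by rw [hlam]; positivity) h h0 h1
  have hd0 : ∀ y ∈ Icc (0 : ℝ) 1, |U y - U 0| ≤ L * y := fun y hy => by
    have := hU.prim.abs_sub_le hU.abs1_le zero_mem_unit hy
    rwa [sub_zero, abs_of_nonneg hy.1] at this
  have hd1 : ∀ y ∈ Icc (0 : ℝ) 1, |U y - U 1| ≤ L * (1 - y) := fun y hy => by
    have := hU.prim.abs_sub_le hU.abs1_le one_mem_unit hy
    rwa [abs_sub_comm y 1, abs_of_nonneg (sub_nonneg.2 hy.2)] at this
  -- One boundary layer for each end, solving the equation without the stream function.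
  obtain ⟨Φa, ua, ωa, va, sa, a0, a1, a2, a3⟩ := exists_neumann hpc continuousOn_const hz hlu 1 0
  obtain ⟨Φb, ub, ωb, vb, sb, b0, b1, b2, b3⟩ := exists_neumann hpc continuousOn_const hz hlu 0 1
  have hva : IsPrim va (fun y => pCoeff U k lam y * ωa y) := sa.flux.congr_right fun y _ => by ring
  have hvb : IsPrim vb (fun y => pCoeff U k lam y * ωb y) := sb.flux.congr_right fun y _ => by ring
  have mono3 {C m : ℝ} (hC : 0 ≤ C) (hm : n ≤ m) (j : ℕ) : C / m ^ j ≤ C / n ^ j := by gcongr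
  obtain ⟨A1, A2, A3⟩ : normSq ωa ≤ 40 / n ^ 3 ∧ (∀ y ∈ Icc (0 : ℝ) 1, ‖ωa y‖ ≤ 10 / n) ∧
      ∫ y in (0 : ℝ)..1, y * ‖ωa y‖ ≤ 5281 / n ^ 3 := by
    have hm : n ≤ √‖pCoeff U k lam 0‖ := Real.le_sqrt_of_sq_le (hn ▸ min_le_left _ _)
    obtain ⟨c1, c2, c3⟩ := layer_bounds (d := fun y => y) (σ := 1) (w := ‖ωa 0‖) (L := L)
      ⟨by norm_num, fun y => hasDerivAt_id y, fun y hy => hy.1, hd0⟩ sa.vort hva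
      (Or.inl rfl) (Or.inr a3) (by simp [a2, a3]) (Or.inl rfl) hL (by linarith) hlam hk19
      (n := √‖pCoeff U k lam 0‖) (by linarith) (Real.sq_sqrt (norm_nonneg _)).symm
    exact ⟨c1.trans (mono3 (by norm_num) hm 3),
      fun y hy => (c2 y hy).trans (by simpa using mono3 (C := 10) (by norm_num) hm 1),
      c3.trans (mono3 (by norm_num) hm 3)⟩
  obtain ⟨B1, B2, B3⟩ : normSq ωb ≤ 40 / n ^ 3 ∧ (∀ y ∈ Icc (0 : ℝ) 1, ‖ωb y‖ ≤ 10 / n) ∧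
      ∫ y in (0 : ℝ)..1, (1 - y) * ‖ωb y‖ ≤ 5281 / n ^ 3 := by
    have hm : n ≤ √‖pCoeff U k lam 1‖ := Real.le_sqrt_of_sq_le (hn ▸ min_le_right _ _)
    obtain ⟨c1, c2, c3⟩ := layer_bounds (d := fun y => 1 - y) (σ := -1) (w := ‖ωb 1‖) (L := L)
      ⟨by norm_num, fun y => by simpa using (hasDerivAt_id y).const_sub 1,
        fun y hy => sub_nonneg.2 hy.2, hd1⟩ sb.vort hvb
      (Or.inr b2) (Or.inl (by simp)) (by simp [b2, b3]) (Or.inr rfl) hL (by linarith) hlam hk19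
      (n := √‖pCoeff U k lam 1‖) (by linarith) (Real.sq_sqrt (norm_nonneg _)).symm
    exact ⟨c1.trans (mono3 (by norm_num) hm 3),
      fun y hy => (c2 y hy).trans (by simpa using mono3 (C := 10) (by norm_num) hm 1),
      c3.trans (mono3 (by norm_num) hm 3)⟩
  have hΦa : ∀ y ∈ Icc (0 : ℝ) 1, ‖Φa y‖ ≤ 5281 / n ^ 3 := fun y hy =>
    (norm_stream_le sa.stream sa.vel sa.vort.continuousOn a0 a1 (d := fun y => y) continuousOn_id
      (fun y hy s hs => by nlinarith [hs.1, hy.1]) (fun y hy s hs => by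
        nlinarith [hs.1, hs.2, hy.1, hy.2]) hy).trans A3
  have hΦb : ∀ y ∈ Icc (0 : ℝ) 1, ‖Φb y‖ ≤ 5281 / n ^ 3 := fun y hy =>
    (norm_stream_le sb.stream sb.vel sb.vort.continuousOn b0 b1 (d := fun y => 1 - y)
      (continuousOn_const.sub continuousOn_id)
      (fun y hy s hs => by nlinarith [hs.1, hs.2, hy.1, hy.2]) (fun y hy s hs => by
        nlinarith [hs.1, hs.2, hy.1, hy.2]) hy).trans B3
  have hqc := continuousOn_qCoeff hU.cont2 k
  have hfc : ContinuousOn (fun y => qCoeff U2 k y * (Φa y + Φb y)) (Icc 0 1) :=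
    hqc.mul (sa.stream.continuousOn.add sb.stream.continuousOn)
  have hfb : √(normSq fun y => qCoeff U2 k y * (Φa y + Φb y)) ≤ |k| * L * (10562 / n ^ 3) := by
    refine Real.sqrt_le_iff.2 ⟨by positivity, normSq_le_of_bound hfc fun y hy => ?_⟩
    rw [norm_mul, qCoeff, norm_mul, norm_mul, Complex.norm_I, one_mul, Complex.norm_real,
      Complex.norm_real, Real.norm_eq_abs, Real.norm_eq_abs]
    have h1 := hU.abs2_le y hy
    have h2 : ‖Φa y + Φb y‖ ≤ 10562 / n ^ 3 := by
      refine (norm_add_le _ _).trans ((add_le_add (hΦa y hy) (hΦb y hy)).trans (le_of_eq ?_))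
      ring
    gcongr
  -- The corrector restores the neglected nonlocal term and carries no vorticity flux, so the
  -- weighted energy estimate applies to it.
  obtain ⟨Φc, uc, ωc, vc, sc, c0, c1, c2, c3⟩ := exists_neumann hpc hqc
    (intervalIntegrable_of_continuousOn hfc)
    (fun Φ u ω v h => hU.neumann_unique (by rw [hlam]; exact hrL) h) 0 0
  -- This is where the factor `200000` is spent: the bound needs `16 · 10562 · L³|k| ≤ r³`.
  have hωc : √(normSq ωc) ≤ 1 / (8 * n ^ 2) := by
    obtain ⟨e, -⟩ := sc.neumann_bounds hU (by rw [hlam]; exact hrL)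
      (sqInt_of_continuousOn hfc) c0 c1 c2 c3
    rw [hlam] at e
    have e2 : r ^ 2 * √(normSq ωc) ≤ 2 * L ^ 2 * (|k| * L * (10562 / n ^ 3)) := e.trans (by gcongr)
    have e3 : 2 * L ^ 2 * (|k| * L * (10562 / n ^ 3)) ≤ r ^ 2 * (1 / (8 * n ^ 2)) := by
      have h4 : 2 * L ^ 2 * (|k| * L * 10562) ≤ r ^ 2 * n / 8 := by
        have : r ^ 3 ≤ r ^ 2 * n := by nlinarith [sq_nonneg r]
        nlinarith [mul_nonneg (pow_nonneg (zero_le_one.trans hL) 3) (abs_nonneg k)]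
      calc _ = 2 * L ^ 2 * (|k| * L * 10562) / n ^ 3 := by ring
        _ ≤ (r ^ 2 * n / 8) / n ^ 3 := by gcongr
        _ = _ := by field_simp
    exact le_of_mul_le_mul_left (e2.trans e3) (by positivity)
  have sG : Sol (pCoeff U k lam) (qCoeff U2 k) (fun _ => 0) _ _ _ _ :=
    (((sa.add sb).congr_coeff (q' := qCoeff U2 k)
      (f' := fun y => -(qCoeff U2 k y * (Φa y + Φb y))) (fun y _ => by ring)).add sc).congr_force
        (fun y _ => by ring)
  have hvG0 : va 0 + vb 0 + vc 0 = 1 := by rw [a2, b2, c2]; ring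
  have hvG1 : va 1 + vb 1 + vc 1 = 1 := by rw [a3, b3, c3]; ring
  refine ⟨_, _, _, _, sG, by simp [a0, b0, c0], by simp [a1, b1, c1], hvG0, hvG1, ?_, ?_⟩
  · have h1 := (sa.vort.sqInt.add sb.vort.sqInt).normSq_add_le sc.vort.sqInt
    have h2 := sa.vort.sqInt.normSq_add_le sb.vort.sqInt
    have h3 : normSq ωc ≤ 1 / (64 * n ^ 4) := by
      rw [← sqrt_normSq_sq ωc]
      calc _ ≤ (1 / (8 * n ^ 2)) ^ 2 := by gcongr
        _ = _ := by ring
    have h4 : 1 / (64 * n ^ 4) ≤ 1 / (64 * n ^ 3) := by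
      have : n ^ 3 ≤ n ^ 4 := pow_le_pow_right₀ (by linarith) (by norm_num)
      gcongr
    calc _ ≤ 2 * (2 * (40 / n ^ 3) + 2 * (40 / n ^ 3)) + 2 * (1 / (64 * n ^ 3)) := by linarith
      _ = (320 + 1 / 32) / n ^ 3 := by ring
      _ ≤ _ := by
        gcongr
        norm_num
  · have hint : ∀ (ω : ℝ → ℂ) (d : ℝ → ℝ), ContinuousOn ω (Icc 0 1) → ContinuousOn d (Icc 0 1) →
        (∀ y ∈ Icc (0 : ℝ) 1, y * (1 - y) ≤ d y) → ∫ y in (0 : ℝ)..1, d y * ‖ω y‖ ≤ 5281 / n ^ 3 →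
        |k| * L * (∫ y in (0 : ℝ)..1, y * (1 - y) * ‖ω y‖) ≤ 1 / 32 := by
      intro ω d hω hd hdy hb
      have h1 := (integral_mono_unit (f := fun y => y * (1 - y) * ‖ω y‖)
        (intervalIntegrable_of_continuousOn
          ((continuousOn_id.mul (continuousOn_const.sub continuousOn_id)).mul hω.norm))
        (intervalIntegrable_of_continuousOn (hd.mul hω.norm)) (fun y hy =>
          mul_le_mul_of_nonneg_right (hdy y hy) (norm_nonneg _))).trans hb
      have h2 : |k| * L * 5281 ≤ n ^ 3 / 32 := by
        have : r ^ 3 ≤ n ^ 3 := by gcongr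
        nlinarith
      calc _ ≤ |k| * L * (5281 / n ^ 3) := by gcongr
        _ = |k| * L * 5281 / n ^ 3 := by ring
        _ ≤ (n ^ 3 / 32) / n ^ 3 := by gcongr
        _ = _ := by field_simp
    have Ia := hint ωa (fun y => y) sa.vort.continuousOn continuousOn_id
      (fun y hy => by nlinarith [hy.1]) A3
    have Ib := hint ωb (fun y => 1 - y) sb.vort.continuousOn
      (continuousOn_const.sub continuousOn_id)
      (fun y hy => by nlinarith [hy.1, hy.2]) B3
    have hn16 : 10 / n ≤ 1 / 32 := by
      rw [div_le_div_iff₀ hn0 (by norm_num)]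
      linarith
    have Da : ‖ωa 1 - ωa 0‖ ≤ 1 / 16 := by
      have := norm_sub_le (ωa 1) (ωa 0)
      linarith [A2 0 zero_mem_unit, A2 1 one_mem_unit]
    have Db : ‖ωb 1 - ωb 0‖ ≤ 1 / 16 := by
      have := norm_sub_le (ωb 1) (ωb 0)
      linarith [B2 0 zero_mem_unit, B2 1 one_mem_unit]
    obtain ⟨U0c, U1c⟩ := norm_velocity_le sc.stream sc.vel sc.vort.continuousOn c0 c1
    have hflux := sG.flux_eq hU.prim hU.prim1 (by simp [a0, b0, c0]) (by simp [a1, b1, c1])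
    rw [hvG0, hvG1] at hflux
    simp only [intervalIntegral.integral_zero] at hflux
    have hfin : ∀ x y z w : ℂ, ‖x - 1‖ ≤ 3 / 32 → ‖y‖ ≤ 3 / 32 → ‖z‖ ≤ 1 / 8 →
        w = x + y + z → 1 / 2 ≤ ‖w‖ := by
      intro x y z w hx hy hz hw
      have h1 : (1 : ℂ) = w - (x - 1) - y - z := by rw [hw]; ring
      have h2 : (1 : ℝ) ≤ ‖w‖ + ‖x - 1‖ + ‖y‖ + ‖z‖ := by
        calc (1 : ℝ) = ‖(1 : ℂ)‖ := norm_one.symm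
          _ = ‖w - (x - 1) - y - z‖ := by rw [← h1]
          _ ≤ _ := (norm_sub_le _ _).trans (add_le_add ((norm_sub_le _ _).trans
            (add_le_add (norm_sub_le _ _) le_rfl)) le_rfl)
      linarith
    have hsmall {x : ℂ} {z : ℂ} (hx : ‖x‖ = n ^ 2) (hz : ‖z‖ ≤ √(normSq ωc)) :
        ‖x * z‖ ≤ 1 / 8 := by
      rw [norm_mul, hx]
      calc n ^ 2 * ‖z‖ ≤ n ^ 2 * (1 / (8 * n ^ 2)) := by
            gcongr
            exact hz.trans hωc
        _ = _ := by field_simp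
    -- The lower bound is proved at the end where `‖p‖ = n ^ 2`, as `n ^ 2` is the factor that the
    -- corrector tolerates; the equality of `p u` at both ends carries it to `0`. The errors `3/32 +
    -- 3/32 + 1/8` are less than `1/2`.
    rcases le_total ‖pCoeff U k lam 0‖ ‖pCoeff U k lam 1‖ with hle | hle
    · rw [min_eq_left hle] at hn
      have la := sa.local_left hUc hd0 a0 a1
      have lb := sb.local_left hUc hd0 b0 b1
      rw [a2] at la
      rw [b2, sub_zero] at lb
      exact hfin _ _ _ _ (by linarith : ‖pCoeff U k lam 0 * ua 0 - 1‖ ≤ 3 / 32)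
        (by linarith : ‖pCoeff U k lam 0 * ub 0‖ ≤ 3 / 32) (hsmall hn.symm U0c) (by ring)
    · rw [min_eq_right hle] at hn
      have la := sa.local_right hUc hd1 a0 a1
      have lb := sb.local_right hUc hd1 b0 b1
      rw [a3, sub_zero] at la
      rw [b3] at lb
      exact hfin _ _ _ _ (by linarith : ‖pCoeff U k lam 1 * ub 1 - 1‖ ≤ 3 / 32)
        (by linarith : ‖pCoeff U k lam 1 * ua 1‖ ≤ 3 / 32) (hsmall hn.symm U1c)
        (by linear_combination -hflux)

end unit_flux

/-! ### Singular integrals along a shear profile -/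

/-- The denominator `η + i Y`. -/
def shearDen (η : ℝ) (Y : ℝ → ℝ) (y : ℝ) : ℂ := η + Complex.I * Y y

/-- A profile `Y` with derivatives `Y1`, `Y2` bounded by `B` and without a common zero of
`Y` and `Y1`. -/
structure Shear (Y Y1 Y2 : ℝ → ℝ) (B c : ℝ) : Prop where
  one_le : 1 ≤ B
  pos : 0 < c
  prim : IsPrim Y Y1
  prim1 : IsPrim Y1 Y2
  cont2 : ContinuousOn Y2 (Icc 0 1)
  abs_le : ∀ y ∈ Icc (0 : ℝ) 1, |Y y| ≤ B
  abs1_le : ∀ y ∈ Icc (0 : ℝ) 1, |Y1 y| ≤ B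
  abs2_le : ∀ y ∈ Icc (0 : ℝ) 1, |Y2 y| ≤ B
  le : ∀ y ∈ Icc (0 : ℝ) 1, c ≤ Y1 y ^ 2 + Y y ^ 2

/-- The multiplier `Y' / (Y'^2 + Y^2)`. -/
def shearMul (Y Y1 : ℝ → ℝ) (y : ℝ) : ℝ := Y1 y / (Y1 y ^ 2 + Y y ^ 2)

/-- The derivative of the multiplier `shearMul`. -/
def shearMulDeriv (Y Y1 Y2 : ℝ → ℝ) (y : ℝ) : ℝ :=
  (Y2 y * (Y1 y ^ 2 + Y y ^ 2) - Y1 y * (2 * Y1 y * Y2 y + 2 * Y y * Y1 y)) /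
    (Y1 y ^ 2 + Y y ^ 2) ^ 2

/-- The kernel `1 / |η + i Y|^2`. -/
def shearKer (η : ℝ) (Y : ℝ → ℝ) (y : ℝ) : ℝ := (η ^ 2 + Y y ^ 2)⁻¹

section basic
variable {Y Y1 Y2 : ℝ → ℝ} {B c η : ℝ}

theorem shearDen_ne_zero (hη : η ≠ 0) (Y : ℝ → ℝ) (y : ℝ) : shearDen η Y y ≠ 0 := by
  intro h
  have := congrArg Complex.re h
  simp [shearDen] at this
  exact hη this

theorem norm_shearDen_sq (η : ℝ) (Y : ℝ → ℝ) (y : ℝ) :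
    ‖shearDen η Y y‖ ^ 2 = η ^ 2 + Y y ^ 2 := by
  rw [← Complex.normSq_eq_norm_sq, Complex.normSq_apply]
  simp [shearDen]
  ring

theorem norm_inv_shearDen_sq (η : ℝ) (Y : ℝ → ℝ) (y : ℝ) :
    ‖(shearDen η Y y)⁻¹‖ ^ 2 = shearKer η Y y := by
  rw [norm_inv, inv_pow, norm_shearDen_sq, shearKer]

theorem shearKer_pos (hη : η ≠ 0) (Y : ℝ → ℝ) (y : ℝ) : 0 < shearKer η Y y := by
  unfold shearKer; positivity

theorem shearKer_mul (hη : η ≠ 0) (Y : ℝ → ℝ) (y : ℝ) :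
    shearKer η Y y * (η ^ 2 + Y y ^ 2) = 1 := by
  unfold shearKer
  exact inv_mul_cancel₀ (by positivity)

theorem inv_shearDen_re (η : ℝ) (Y : ℝ → ℝ) (y : ℝ) :
    ((shearDen η Y y)⁻¹).re = η * shearKer η Y y := by
  rw [Complex.inv_re, Complex.normSq_eq_norm_sq, norm_shearDen_sq, shearKer, div_eq_mul_inv]
  simp [shearDen]

theorem inv_shearDen_im (η : ℝ) (Y : ℝ → ℝ) (y : ℝ) :
    ((shearDen η Y y)⁻¹).im = -(Y y * shearKer η Y y) := by
  rw [Complex.inv_im, Complex.normSq_eq_norm_sq, norm_shearDen_sq, shearKer, div_eq_mul_inv]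
  simp [shearDen]

theorem continuousOn_shearKer (hY : ContinuousOn Y (Icc 0 1)) (hη : η ≠ 0) :
    ContinuousOn (shearKer η Y) (Icc 0 1) :=
  ((continuousOn_const (c := η ^ 2)).add (hY.pow 2)).inv₀ fun y _ =>
    (by positivity : 0 < η ^ 2 + Y y ^ 2).ne'

theorem continuousOn_shearDen (hY : ContinuousOn Y (Icc 0 1)) (η : ℝ) :
    ContinuousOn (shearDen η Y) (Icc 0 1) :=
  continuousOn_const.add (continuousOn_const.mul (Complex.continuous_ofReal.comp_continuousOn hY))

theorem continuousOn_inv_shearDen (hY : ContinuousOn Y (Icc 0 1)) (hη : η ≠ 0) :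
    ContinuousOn (fun y => (shearDen η Y y)⁻¹) (Icc 0 1) :=
  (continuousOn_shearDen hY η).inv₀ fun y _ => shearDen_ne_zero hη Y y

end basic

namespace Shear
variable {Y Y1 Y2 : ℝ → ℝ} {B c η : ℝ}

theorem denom_pos (S : Shear Y Y1 Y2 B c) {y : ℝ} (hy : y ∈ Icc (0 : ℝ) 1) : 0 < Y1 y ^ 2 + Y y ^ 2 :=
  S.pos.trans_le (S.le y hy)

theorem continuousOn_mulDeriv (S : Shear Y Y1 Y2 B c) : ContinuousOn (shearMulDeriv Y Y1 Y2) (Icc 0 1) := by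
  have h := S.prim.continuousOn
  have h1 := S.prim1.continuousOn
  have h2 := S.cont2
  unfold shearMulDeriv
  refine ContinuousOn.div (by fun_prop) (by fun_prop) fun y hy => ?_
  have := S.denom_pos hy
  positivity

theorem prim_mul (S : Shear Y Y1 Y2 B c) : IsPrim (shearMul Y Y1) (shearMulDeriv Y Y1 Y2) := by
  refine IsPrim.of_hasDerivWithinAt (fun y hy => ?_) S.continuousOn_mulDeriv
  have d := S.prim.hasDerivWithinAt S.prim1.continuousOn hy
  have d1 := S.prim1.hasDerivWithinAt S.cont2 hy
  refine (d1.fun_div ((d1.fun_pow 2).fun_add (d.fun_pow 2)) (S.denom_pos hy).ne').congr_deriv ?_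
  simp only [shearMulDeriv]
  congr 1
  norm_num

theorem abs_mul_le (S : Shear Y Y1 Y2 B c) {y : ℝ} (hy : y ∈ Icc (0 : ℝ) 1) : |shearMul Y Y1 y| ≤ B / c := by
  have hc := S.pos
  rw [shearMul, abs_div, abs_of_pos (S.denom_pos hy)]
  exact div_le_div₀ (zero_le_one.trans S.one_le) (S.abs1_le y hy) hc (S.le y hy)

theorem abs_mulDeriv_le (S : Shear Y Y1 Y2 B c) {y : ℝ} (hy : y ∈ Icc (0 : ℝ) 1) :
    |shearMulDeriv Y Y1 Y2 y| ≤ 6 * B ^ 3 / c ^ 2 := by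
  have hc := S.pos
  have hB : 0 ≤ B := zero_le_one.trans S.one_le
  have h0 := S.abs_le y hy
  have h1 := S.abs1_le y hy
  have h2 := S.abs2_le y hy
  rw [shearMulDeriv, abs_div, abs_of_pos (pow_pos (S.denom_pos hy) 2)]
  refine div_le_div₀ (by positivity) ?_ (by positivity) (pow_le_pow_left₀ hc.le (S.le y hy) 2)
  have e : Y2 y * (Y1 y ^ 2 + Y y ^ 2) - Y1 y * (2 * Y1 y * Y2 y + 2 * Y y * Y1 y)
      = Y2 y * Y y ^ 2 - Y1 y ^ 2 * (Y2 y + 2 * Y y) := by ring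
  rw [e]
  calc |Y2 y * Y y ^ 2 - Y1 y ^ 2 * (Y2 y + 2 * Y y)|
      ≤ |Y2 y| * |Y y| ^ 2 + |Y1 y| ^ 2 * (|Y2 y| + 2 * |Y y|) := by
        refine (abs_sub _ _).trans ?_
        rw [abs_mul, abs_mul, abs_pow, abs_pow]
        gcongr
        refine (abs_add_le _ _).trans ?_
        rw [abs_mul, abs_two]
    _ ≤ B * B ^ 2 + B ^ 2 * (B + 2 * B) := by gcongr
    _ ≤ 6 * B ^ 3 := by nlinarith [pow_nonneg hB 3]

theorem prim_arctan (S : Shear Y Y1 Y2 B c) (hη : η ≠ 0) :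
    IsPrim (fun y => Real.arctan (Y y / η)) (fun y => η * Y1 y * shearKer η Y y) := by
  refine IsPrim.of_hasDerivWithinAt (fun y hy => ?_)
    ((continuousOn_const.mul S.prim1.continuousOn).mul
      (continuousOn_shearKer S.prim.continuousOn hη))
  have d := S.prim.hasDerivWithinAt S.prim1.continuousOn hy
  refine (d.div_const η).arctan.congr_deriv ?_
  have : 0 < η ^ 2 + Y y ^ 2 := by positivity
  have : 0 < 1 + (Y y / η) ^ 2 := by positivity
  simp only [shearKer]
  field_simp

theorem prim_inv (S : Shear Y Y1 Y2 B c) (hη : η ≠ 0) :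
    IsPrim (fun y => (shearDen η Y y)⁻¹)
      (fun y => -(Complex.I * Y1 y) * ((shearDen η Y y)⁻¹) ^ 2) := by
  refine IsPrim.of_hasDerivWithinAt (fun y hy => ?_) ?_
  · have d := S.prim.hasDerivWithinAt S.prim1.continuousOn hy
    have d2 : HasDerivWithinAt (shearDen η Y) (Complex.I * Y1 y) (Icc 0 1) y :=
      ((d.ofReal_comp).const_mul Complex.I).const_add _
    refine (d2.inv (shearDen_ne_zero hη Y y)).congr_deriv ?_
    rw [div_eq_mul_inv, inv_pow]
  · exact ((continuousOn_const.mul (Complex.continuous_ofReal.comp_continuousOn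
      S.prim1.continuousOn)).neg).mul ((continuousOn_inv_shearDen S.prim.continuousOn hη).pow 2)

/-- The kernel `|η| / (η^2 + Y^2)` is bounded in `L¹`. -/
theorem integral_ker_le (S : Shear Y Y1 Y2 B c) (hη : η ≠ 0) (hη1 : |η| ≤ 1) :
    |η| * ∫ y in (0 : ℝ)..1, shearKer η Y y ≤ 4 * (B / c) + 12 * B ^ 3 / c ^ 2 + 1 / c := by
  have hc := S.pos
  have hB : 0 ≤ B := zero_le_one.trans S.one_le
  have hat (x : ℝ) : |Real.arctan x| ≤ 2 := by
    rw [_root_.abs_le]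
    have := Real.neg_pi_div_two_lt_arctan x
    have := Real.arctan_lt_pi_div_two x
    have := Real.pi_lt_d2
    constructor <;> linarith
  have hk := continuousOn_shearKer S.prim.continuousOn hη
  have hi := (intervalIntegrable_of_continuousOn hk).const_mul η
  -- Where `Y' ≠ 0` one would divide by `Y'`. The multiplier `m = Y'/(Y'² + Y²)` does this without
  -- singularity: `mY' = 1 - Y²/(Y'² + Y²)`, and in the defect the factor `Y²` cancels the
  -- singularity of the kernel.
  have hP := S.prim_mul.mul (S.prim_arctan hη)
  have hend {y : ℝ} (hy : y ∈ Icc (0 : ℝ) 1) :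
      |shearMul Y Y1 y * Real.arctan (Y y / η)| ≤ 2 * (B / c) := by
    rw [abs_mul, mul_comm 2]
    exact mul_le_mul (S.abs_mul_le hy) (hat _) (abs_nonneg _) (by positivity)
  have hdiff : ‖(∫ y in (0 : ℝ)..1, η * shearKer η Y y) - ∫ y in (0 : ℝ)..1,
      (shearMulDeriv Y Y1 Y2 y * Real.arctan (Y y / η)
        + shearMul Y Y1 y * (η * Y1 y * shearKer η Y y))‖ ≤ 12 * B ^ 3 / c ^ 2 + 1 / c := by
    rw [← intervalIntegral.integral_sub hi hP.1]
    have := intervalIntegral.norm_integral_le_of_norm_le_const (a := (0 : ℝ)) (b := 1)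
      (f := fun y => η * shearKer η Y y - (shearMulDeriv Y Y1 Y2 y * Real.arctan (Y y / η)
        + shearMul Y Y1 y * (η * Y1 y * shearKer η Y y)))
      (C := 12 * B ^ 3 / c ^ 2 + 1 / c) fun y hy => ?_
    · simpa using this
    rw [uIoc_of_le zero_le_one] at hy
    have hy' := Ioc_subset_Icc_self hy
    have hN := S.denom_pos hy'
    have e : η * shearKer η Y y - (shearMulDeriv Y Y1 Y2 y * Real.arctan (Y y / η)
        + shearMul Y Y1 y * (η * Y1 y * shearKer η Y y))
        = η * (Y y ^ 2 * shearKer η Y y) * (1 / (Y1 y ^ 2 + Y y ^ 2))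
          - shearMulDeriv Y Y1 Y2 y * Real.arctan (Y y / η) := by
      rw [shearMul]
      field_simp
      ring
    rw [e, Real.norm_eq_abs]
    refine (abs_sub _ _).trans ?_
    rw [abs_mul, abs_mul η, abs_mul (shearMulDeriv Y Y1 Y2 y),
      abs_of_pos (one_div_pos.2 hN)]
    have h1 : |Y y ^ 2 * shearKer η Y y| ≤ 1 := by
      have := shearKer_mul hη Y y
      have := shearKer_pos hη Y y
      rw [abs_of_nonneg (by positivity)]
      nlinarith [sq_nonneg η, mul_nonneg (sq_nonneg η) this.le]
    have h2 : 1 / (Y1 y ^ 2 + Y y ^ 2) ≤ 1 / c := one_div_le_one_div_of_le hc (S.le y hy')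
    have h3 := mul_le_mul (S.abs_mulDeriv_le hy') (hat (Y y / η)) (abs_nonneg _) (by positivity)
    have h4 : |η| * |Y y ^ 2 * shearKer η Y y| * (1 / (Y1 y ^ 2 + Y y ^ 2)) ≤ 1 * 1 * (1 / c) := by
      gcongr
    have h5 : 6 * B ^ 3 / c ^ 2 * 2 = 12 * B ^ 3 / c ^ 2 := by ring
    linarith
  rw [hP.integral_eq, intervalIntegral.integral_const_mul, Real.norm_eq_abs] at hdiff
  have hI : 0 ≤ ∫ y in (0 : ℝ)..1, shearKer η Y y :=
    intervalIntegral.integral_nonneg zero_le_one fun y _ => (shearKer_pos hη Y y).le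
  have e1 := abs_sub_abs_le_abs_sub (η * ∫ y in (0 : ℝ)..1, shearKer η Y y)
    (shearMul Y Y1 1 * Real.arctan (Y 1 / η) - shearMul Y Y1 0 * Real.arctan (Y 0 / η))
  have e2 := abs_sub (shearMul Y Y1 1 * Real.arctan (Y 1 / η))
    (shearMul Y Y1 0 * Real.arctan (Y 0 / η))
  rw [abs_mul, abs_of_nonneg hI] at e1
  have := hend zero_mem_unit
  have := hend one_mem_unit
  linarith

theorem normSq_inv_le (S : Shear Y Y1 Y2 B c) (hη : η ≠ 0) (hη1 : |η| ≤ 1) {A ε : ℝ}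
    (hA : A = 4 * (B / c) + 12 * B ^ 3 / c ^ 2 + 1 / c) (hε : 0 < ε) (he : ε ^ 2 = |η|) :
    √(normSq fun y => (shearDen η Y y)⁻¹) ≤ √A / ε := by
  have h := S.integral_ker_le hη hη1
  rw [← hA, ← he] at h
  have hA0 : 0 ≤ A := by
    have := S.pos
    have := zero_le_one.trans S.one_le
    rw [hA]
    positivity
  have e : (normSq fun y => (shearDen η Y y)⁻¹) = ∫ y in (0 : ℝ)..1, shearKer η Y y :=
    integral_congr_unit fun y _ => norm_inv_shearDen_sq η Y y
  rw [e]
  refine Real.sqrt_le_iff.2 ⟨by positivity, ?_⟩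
  rw [div_pow, Real.sq_sqrt hA0, le_div_iff₀ (by positivity)]
  linarith

/-- Integration by parts against the kernel `(η + i Y)⁻²`. -/
theorem integral_parts (S : Shear Y Y1 Y2 B c) (hη : η ≠ 0) {G g : ℝ → ℂ} (hG : IsPrim G g) :
    ∫ y in (0 : ℝ)..1, G y * ((shearDen η Y y)⁻¹) ^ 2 =
      (∫ y in (0 : ℝ)..1, ((Y y ^ 2 / (Y1 y ^ 2 + Y y ^ 2) : ℝ) : ℂ)
        * (G y * ((shearDen η Y y)⁻¹) ^ 2))
      + Complex.I * (shearMul Y Y1 1 * G 1 * (shearDen η Y 1)⁻¹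
        - shearMul Y Y1 0 * G 0 * (shearDen η Y 0)⁻¹
        - ∫ y in (0 : ℝ)..1, (shearMulDeriv Y Y1 Y2 y * G y + shearMul Y Y1 y * g y)
            * (shearDen η Y y)⁻¹) := by
  have hY := S.prim.continuousOn
  have hY1 := S.prim1.continuousOn
  have hz := continuousOn_inv_shearDen hY hη
  -- With the multiplier `m`, `1 = m Y' + Y²/(Y'² + Y²)`, and `Y'(η + iY)⁻²` is `i` times the
  -- derivative of `(η + iY)⁻¹`.
  have hP := ((S.prim_mul.ofReal.mul hG).mul (S.prim_inv hη))
  have i1 : IntervalIntegrable (fun y => ((Y y ^ 2 / (Y1 y ^ 2 + Y y ^ 2) : ℝ) : ℂ)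
        * (G y * ((shearDen η Y y)⁻¹) ^ 2)) volume 0 1 := by
    refine intervalIntegrable_of_continuousOn ((Complex.continuous_ofReal.comp_continuousOn
      (ContinuousOn.div (hY.pow 2) ((hY1.pow 2).add (hY.pow 2))
        fun y hy => (S.denom_pos hy).ne')).mul (hG.continuousOn.mul (hz.pow 2)))
  have i2 : IntervalIntegrable (fun y => (shearMulDeriv Y Y1 Y2 y * G y + shearMul Y Y1 y * g y)
      * (shearDen η Y y)⁻¹) volume 0 1 :=
    (S.prim_mul.ofReal.mul hG).1.mul_continuousOn (by rwa [uIcc_unit])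
  rw [← hP.integral_eq, ← intervalIntegral.integral_sub hP.1 i2,
    ← intervalIntegral.integral_const_mul,
    ← intervalIntegral.integral_add i1 ((hP.1.sub i2).const_mul _)]
  refine integral_congr_unit fun y hy => ?_
  have hN := S.denom_pos hy
  have hN2 : ((Y1 y : ℂ) ^ 2 + (Y y : ℂ) ^ 2) ≠ 0 := by
    exact_mod_cast hN.ne'
  have hz0 := shearDen_ne_zero hη Y y
  simp only [shearMul]
  push_cast
  field_simp
  ring_nf
  rw [Complex.I_sq]
  ring

/-- `G` vanishes at the ends and has a square integrable derivative, so one integration by parts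
lowers the kernel to `(η + iY)⁻¹`, whose `L²` norm costs only `ε⁻¹`. -/
theorem norm_integral_data_le (S : Shear Y Y1 Y2 B c) (hη : η ≠ 0) (hη1 : |η| ≤ 1) {G g : ℝ → ℂ} (hG : IsPrim G g)
    (hg : SqInt g) (h0 : G 0 = 0) (h1 : G 1 = 0) {A ε : ℝ}
    (hA : A = 4 * (B / c) + 12 * B ^ 3 / c ^ 2 + 1 / c) (hε : 0 < ε) (he : ε ^ 2 = |η|) :
    ‖∫ y in (0 : ℝ)..1, G y * ((shearDen η Y y)⁻¹) ^ 2‖ ≤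
      (1 / c + (6 * B ^ 3 / c ^ 2 + B / c) * √A) * (√(normSq g) / ε) := by
  have hc := S.pos
  have hB : 0 ≤ B := zero_le_one.trans S.one_le
  have hY := S.prim.continuousOn
  have hY1 := S.prim1.continuousOn
  have hz := continuousOn_inv_shearDen hY hη
  set F := √(normSq g) with hF
  have hF0 : 0 ≤ F := Real.sqrt_nonneg _
  have hGF : ∀ y ∈ Icc (0 : ℝ) 1, ‖G y‖ ≤ F := fun y hy => by
    rw [hG.2 y hy, h0, zero_add]
    refine (intervalIntegral.norm_integral_le_integral_norm hy.1).trans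
      (le_trans ?_ hg.integral_norm_le)
    exact intervalIntegral.integral_mono_interval le_rfl hy.1 hy.2
      (Filter.Eventually.of_forall fun _ => norm_nonneg _) hG.1.norm
  have hε1 : ε ≤ 1 := by nlinarith
  have hzn := S.normSq_inv_le hη hη1 hA hε he
  have hzi := (sqInt_of_continuousOn hz).integral_norm_le.trans hzn
  have hgz := (hg.integral_mul_le (sqInt_of_continuousOn hz)).trans
    (mul_le_mul_of_nonneg_left hzn hF0)
  rw [S.integral_parts hη hG, h0, h1]
  simp only [mul_zero, zero_mul, sub_zero, zero_sub]
  refine (norm_add_le _ _).trans ?_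
  have b1 : ‖∫ y in (0 : ℝ)..1, ((Y y ^ 2 / (Y1 y ^ 2 + Y y ^ 2) : ℝ) : ℂ)
        * (G y * ((shearDen η Y y)⁻¹) ^ 2)‖ ≤ 1 / c * F := by
    have := intervalIntegral.norm_integral_le_of_norm_le_const (a := (0 : ℝ)) (b := 1)
      (f := fun y => ((Y y ^ 2 / (Y1 y ^ 2 + Y y ^ 2) : ℝ) : ℂ)
        * (G y * ((shearDen η Y y)⁻¹) ^ 2)) (C := 1 / c * F) fun y hy => ?_
    · simpa using this
    rw [uIoc_of_le zero_le_one] at hy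
    have hy' := Ioc_subset_Icc_self hy
    have hN := S.denom_pos hy'
    rw [norm_mul, norm_mul, norm_pow, norm_inv_shearDen_sq, Complex.norm_real, Real.norm_eq_abs,
      abs_of_nonneg (by positivity)]
    have h2 : 1 / (Y1 y ^ 2 + Y y ^ 2) ≤ 1 / c := one_div_le_one_div_of_le hc (S.le y hy')
    have h1 : Y y ^ 2 * shearKer η Y y ≤ 1 := by
      have := shearKer_mul hη Y y
      have := shearKer_pos hη Y y
      nlinarith [mul_nonneg (sq_nonneg η) this.le]
    have h3 := shearKer_pos hη Y y
    calc _ = (1 / (Y1 y ^ 2 + Y y ^ 2)) * (‖G y‖ * (Y y ^ 2 * shearKer η Y y)) := by ring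
      _ ≤ 1 / c * (F * 1) := by
        gcongr
        exact hGF y hy'
      _ = _ := by ring
  have b2 : ‖Complex.I * -∫ y in (0 : ℝ)..1,
      (shearMulDeriv Y Y1 Y2 y * G y + shearMul Y Y1 y * g y) * (shearDen η Y y)⁻¹‖
      ≤ 6 * B ^ 3 / c ^ 2 * F * (√A / ε) + B / c * (F * (√A / ε)) := by
    rw [norm_mul, Complex.norm_I, one_mul, norm_neg]
    refine (norm_integral_unit_le _).trans ?_
    have i1 := intervalIntegrable_of_continuousOn hz.norm
    have i2 := hg.intervalIntegrable_mul (sqInt_of_continuousOn hz)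
    have := integral_mono_unit (((S.prim_mul.ofReal.mul hG).1.mul_continuousOn
      (by rwa [uIcc_unit])).norm) ((i1.const_mul (6 * B ^ 3 / c ^ 2 * F)).add
        (i2.const_mul (B / c))) fun y hy => ?_
    · refine this.trans ?_
      rw [intervalIntegral.integral_add (i1.const_mul _) (i2.const_mul _),
        intervalIntegral.integral_const_mul, intervalIntegral.integral_const_mul]
      gcongr
    rw [norm_mul]
    have h2 := (norm_add_le (shearMulDeriv Y Y1 Y2 y * G y) (shearMul Y Y1 y * g y))
    rw [norm_mul, norm_mul, Complex.norm_real, Complex.norm_real, Real.norm_eq_abs,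
      Real.norm_eq_abs] at h2
    have h3 : |shearMulDeriv Y Y1 Y2 y| * ‖G y‖ ≤ 6 * B ^ 3 / c ^ 2 * F :=
      mul_le_mul (S.abs_mulDeriv_le hy) (hGF y hy) (norm_nonneg _) (by positivity)
    have h4 : |shearMul Y Y1 y| * ‖g y‖ ≤ B / c * ‖g y‖ :=
      mul_le_mul_of_nonneg_right (S.abs_mul_le hy) (norm_nonneg _)
    calc _ ≤ (6 * B ^ 3 / c ^ 2 * F + B / c * ‖g y‖) * ‖(shearDen η Y y)⁻¹‖ := by
          gcongr
          linarith
      _ = _ := by ring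
  have b3 : 1 / c * F ≤ 1 / c * (F / ε) := by
    gcongr
    rw [le_div_iff₀ hε]
    nlinarith
  calc _ ≤ 1 / c * (F / ε) + (6 * B ^ 3 / c ^ 2 * F * (√A / ε) + B / c * (F * (√A / ε))) :=
        add_le_add (b1.trans b3) b2
    _ = _ := by ring

/-- One factor of the kernel is bounded uniformly by `ε⁻²`, the other in `L²` by a multiple of
`ε⁻¹`. The larger loss is affordable because the energy estimate makes `v` small. -/
theorem norm_integral_flux_le (S : Shear Y Y1 Y2 B c) (hη : η ≠ 0) (hη1 : |η| ≤ 1) {v : ℝ → ℂ}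
    (hv : ContinuousOn v (Icc 0 1)) {A ε : ℝ}
    (hA : A = 4 * (B / c) + 12 * B ^ 3 / c ^ 2 + 1 / c) (hε : 0 < ε) (he : ε ^ 2 = |η|) :
    ‖∫ y in (0 : ℝ)..1, v y * ((shearDen η Y y)⁻¹) ^ 2‖ ≤ √A * (√(normSq v) / ε ^ 3) := by
  have hz := continuousOn_inv_shearDen S.prim.continuousOn hη
  have hzn := S.normSq_inv_le hη hη1 hA hε he
  have i := (sqInt_of_continuousOn hv).intervalIntegrable_mul (sqInt_of_continuousOn hz)
  have hvz := ((sqInt_of_continuousOn hv).integral_mul_le (sqInt_of_continuousOn hz)).trans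
    (mul_le_mul_of_nonneg_left hzn (Real.sqrt_nonneg _))
  refine (norm_integral_unit_le _).trans ((integral_mono_unit (intervalIntegrable_of_continuousOn
    (hv.mul (hz.pow 2))).norm (i.const_mul (1 / ε ^ 2)) fun y hy => ?_).trans ?_)
  · have h1 : ‖(shearDen η Y y)⁻¹‖ ≤ 1 / ε ^ 2 := by
      rw [norm_inv, one_div]
      refine inv_anti₀ (by positivity) ?_
      rw [he]
      have := Complex.abs_re_le_norm (shearDen η Y y)
      simpa [shearDen] using this
    change ‖v y * (shearDen η Y y)⁻¹ ^ 2‖ ≤ _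
    rw [norm_mul, norm_pow]
    calc ‖v y‖ * ‖(shearDen η Y y)⁻¹‖ ^ 2
        = ‖(shearDen η Y y)⁻¹‖ * (‖v y‖ * ‖(shearDen η Y y)⁻¹‖) := by ring
      _ ≤ _ := by gcongr
  · rw [intervalIntegral.integral_const_mul]
    calc _ ≤ 1 / ε ^ 2 * (√(normSq v) * (√A / ε)) := by gcongr
      _ = _ := by
        field_simp

end Shear

/-! ### Nondegeneracy of the singular integral -/

namespace Shear
variable {Y Y1 Y2 : ℝ → ℝ} {B c η : ℝ}

/-- On an interval of length `|η|` next to the zero one has `|Y| ≤ B|η|`, so the kernel is at least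
`1/(η²(1 + B²))`. The condition `|η| ≤ 1/2` leaves room for it on one side of `y₀`. -/
theorem le_integral_ker_of_zero (S : Shear Y Y1 Y2 B c) (hη : η ≠ 0) (hη1 : |η| ≤ 1 / 2) {y₀ : ℝ}
    (hy₀ : y₀ ∈ Icc (0 : ℝ) 1) (hz : Y y₀ = 0) :
    1 / (1 + B ^ 2) ≤ |η| * ∫ y in (0 : ℝ)..1, shearKer η Y y := by
  have hη0 : 0 < |η| := abs_pos.2 hη
  have hk := continuousOn_shearKer S.prim.continuousOn hη
  obtain ⟨α, β, hα, hβ, hαy, hyβ, hβα⟩ : ∃ α β : ℝ, 0 ≤ α ∧ β ≤ 1 ∧ α ≤ y₀ ∧ y₀ ≤ β ∧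
      β - α = |η| := by
    rcases le_total y₀ (1 / 2) with h | h
    · exact ⟨y₀, y₀ + |η|, hy₀.1, by linarith, le_rfl, by linarith, by ring⟩
    · exact ⟨y₀ - |η|, y₀, by linarith, hy₀.2, by linarith, le_rfl, by ring⟩
  have hαβ : α ≤ β := hαy.trans hyβ
  have hα' : α ∈ Icc (0 : ℝ) 1 := ⟨hα, hαβ.trans hβ⟩
  have hβ' : β ∈ Icc (0 : ℝ) 1 := ⟨hα.trans hαβ, hβ⟩
  have hi := intervalIntegrable_of_continuousOn hk
  have h1 : ∫ y in α..β, shearKer η Y y ≤ ∫ y in (0 : ℝ)..1, shearKer η Y y :=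
    intervalIntegral.integral_mono_interval hα hαβ hβ
      (Filter.Eventually.of_forall fun y => (shearKer_pos hη Y y).le) hi
  have h2 : ∫ _ in α..β, (η ^ 2 * (1 + B ^ 2))⁻¹ ≤ ∫ y in α..β, shearKer η Y y := by
    refine intervalIntegral.integral_mono_on hαβ intervalIntegrable_const
      (intervalIntegrable_sub hi hα' hβ') fun y hy => ?_
    have hy' : y ∈ Icc (0 : ℝ) 1 := ⟨hα.trans hy.1, hy.2.trans hβ⟩
    have h3 := S.prim.abs_sub_le S.abs1_le hy₀ hy'
    rw [hz, sub_zero] at h3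
    have h4 : |y - y₀| ≤ |η| := by
      rw [_root_.abs_le]
      constructor <;> linarith [hy.1, hy.2]
    have h5 : |Y y| ≤ B * |η| := h3.trans
      (mul_le_mul_of_nonneg_left h4 (zero_le_one.trans S.one_le))
    have h6 := pow_le_pow_left₀ (abs_nonneg _) h5 2
    rw [mul_pow, sq_abs, sq_abs] at h6
    exact inv_anti₀ (by positivity) (by linarith)
  rw [intervalIntegral.integral_const, hβα, smul_eq_mul] at h2
  have h7 : 1 / (1 + B ^ 2) = |η| * (|η| * (η ^ 2 * (1 + B ^ 2))⁻¹) := by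
    rw [← sq_abs η]
    field_simp
  rw [h7]
  gcongr
  exact h2.trans h1

theorem sq_inv_shearDen_im (η : ℝ) (Y : ℝ → ℝ) (y : ℝ) :
    ((shearDen η Y y)⁻¹ ^ 2).im = -(2 * η * Y y * shearKer η Y y ^ 2) := by
  rw [sq, Complex.mul_im, inv_shearDen_re, inv_shearDen_im]
  ring

theorem sq_inv_shearDen_re (η : ℝ) (Y : ℝ → ℝ) (y : ℝ) :
    ((shearDen η Y y)⁻¹ ^ 2).re = (η ^ 2 - Y y ^ 2) * shearKer η Y y ^ 2 := by
  rw [sq, Complex.mul_re, inv_shearDen_re, inv_shearDen_im]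
  ring

/-- Eliminating `Y'²` isolates the coercive term `-Y''/(Y'² + Y²)` times the kernel `q`, positive by
concavity. All other terms carry a factor `Y` and sum to at most `R|Y|q`, where `R` collects `2/c +
4B²/c² + 2/c`. Since `Y²q ≤ 1`, one has `|Y|q ≤ (aq + 1/a)/2`, and `a` is chosen so that half of the
coercive term survives. -/
theorem mulDeriv_ker_ge (S : Shear Y Y1 Y2 B c) (hη : η ≠ 0) {b : ℝ} (hb : 0 < b) {y : ℝ}
    (hy : y ∈ Icc (0 : ℝ) 1) (hb2 : Y2 y ≤ -b) {R a : ℝ} (hR : R = 4 / c + 4 * B ^ 2 / c ^ 2)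
    (ha : a = b / (2 * B ^ 2 * R)) :
    b / (4 * B ^ 2) * shearKer η Y y - R / (2 * a) ≤ shearMulDeriv Y Y1 Y2 y * shearKer η Y y
      + 2 * Y y ^ 3 / (Y1 y ^ 2 + Y y ^ 2) * shearKer η Y y ^ 2 := by
  have hc := S.pos
  have hB : 0 < B := one_pos.trans_le S.one_le
  have hN := S.denom_pos hy
  have hcN := S.le y hy
  have h0 := S.abs_le y hy
  have h2 := S.abs2_le y hy
  have hR0 : 0 < R := by rw [hR]; positivity
  have ha0 : 0 < a := by rw [ha]; positivity
  have hq := shearKer_pos hη Y y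
  have hq1 := shearKer_mul hη Y y
  have hNB : Y1 y ^ 2 + Y y ^ 2 ≤ 2 * B ^ 2 := by
    have e1 := pow_le_pow_left₀ (abs_nonneg _) (S.abs1_le y hy) 2
    have e0 := pow_le_pow_left₀ (abs_nonneg _) h0 2
    rw [sq_abs] at e1 e0
    linarith
  set N := Y1 y ^ 2 + Y y ^ 2 with hNdef
  set q := shearKer η Y y
  have e : shearMulDeriv Y Y1 Y2 y * q + 2 * Y y ^ 3 / N * q ^ 2
      = (-Y2 y / N) * q - (2 * (Y y * q) / N - 2 * (Y y * q) * (Y y * (Y2 y + Y y)) / N ^ 2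
        - 2 * (Y y * q) * (Y y ^ 2 * q) / N) := by
    have : Y1 y ^ 2 = N - Y y ^ 2 := by rw [hNdef]; ring
    rw [shearMulDeriv, ← hNdef]
    field_simp
    rw [this]
    ring
  have hYq : Y y ^ 2 * q ≤ 1 := by nlinarith [mul_nonneg (sq_nonneg η) hq.le]
  have m1 : b / (2 * B ^ 2) * q ≤ (-Y2 y / N) * q := by
    gcongr <;> linarith
  have m2 : |Y y| * q ≤ (a * q + 1 / a) / 2 := by
    rw [le_div_iff₀ two_pos, ← sub_nonneg]
    have : a * q + 1 / a - |Y y| * q * 2 = (a ^ 2 * q + 1 - 2 * a * (|Y y| * q)) / a := by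
      field_simp
    rw [this]
    refine div_nonneg ?_ ha0.le
    nlinarith [mul_nonneg (sq_nonneg (a - |Y y|)) hq.le, sq_abs (Y y)]
  have m3 : 2 * (Y y * q) / N - 2 * (Y y * q) * (Y y * (Y2 y + Y y)) / N ^ 2
        - 2 * (Y y * q) * (Y y ^ 2 * q) / N ≤ R * (|Y y| * q) := by
    refine (le_abs_self _).trans ((abs_sub _ _).trans ((add_le_add (abs_sub _ _) le_rfl).trans ?_))
    have t : |Y y * q| = |Y y| * q := by rw [abs_mul, abs_of_pos hq]
    have x0 : 0 ≤ |Y y| * q := by positivity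
    have t1 : |2 * (Y y * q) / N| ≤ 2 / c * (|Y y| * q) := by
      rw [abs_div, abs_mul, abs_two, t, abs_of_pos hN, mul_div_right_comm]
      gcongr
    have t2 : |2 * (Y y * q) * (Y y * (Y2 y + Y y)) / N ^ 2|
        ≤ 4 * B ^ 2 / c ^ 2 * (|Y y| * q) := by
      rw [abs_div, abs_mul _ (Y y * (Y2 y + Y y)), abs_mul 2, abs_mul (Y y) (Y2 y + Y y), abs_two, t,
        abs_of_pos (pow_pos hN 2)]
      have := abs_add_le (Y2 y) (Y y)
      calc 2 * (|Y y| * q) * (|Y y| * |Y2 y + Y y|) / N ^ 2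
          ≤ 2 * (|Y y| * q) * (B * (B + B)) / c ^ 2 := by
            gcongr
            linarith
        _ = _ := by ring
    have t3 : |2 * (Y y * q) * (Y y ^ 2 * q) / N| ≤ 2 / c * (|Y y| * q) := by
      rw [abs_div, abs_mul _ (Y y ^ 2 * q), abs_mul 2, abs_two, t, abs_of_pos hN,
        abs_of_nonneg (by positivity : 0 ≤ Y y ^ 2 * q)]
      calc 2 * (|Y y| * q) * (Y y ^ 2 * q) / N ≤ 2 * (|Y y| * q) * 1 / c := by gcongr
        _ = _ := by ring
    calc _ ≤ 2 / c * (|Y y| * q) + 4 * B ^ 2 / c ^ 2 * (|Y y| * q) + 2 / c * (|Y y| * q) :=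
          add_le_add (add_le_add t1 t2) t3
      _ = _ := by rw [hR]; ring
  have m4 : R * (|Y y| * q) ≤ b / (4 * B ^ 2) * q + R / (2 * a) := by
    refine (mul_le_mul_of_nonneg_left m2 hR0.le).trans (le_of_eq ?_)
    have : R * a = b / (2 * B ^ 2) := by
      rw [ha]
      field_simp
    have h3 : R * ((a * q + 1 / a) / 2) = R * a * q / 2 + R / (2 * a) := by
      field_simp
    rw [h3, this]
    ring
  have m5 : b / (2 * B ^ 2) * q = b / (4 * B ^ 2) * q + b / (4 * B ^ 2) * q := by
    field_simp
    ring
  rw [e]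
  linarith

/-- The imaginary part is integrated by parts with the multiplier. The end terms are of order `|η|`,
as `|Y| ≥ c₀` there, and the interior term is `η` times an integral bounded below by a multiple of
`∫ shearKer`, up to a constant. Because `Y` has a zero, `|η| ∫ shearKer` does not tend to zero with
`η`. -/
theorem le_norm_integral_of_zero (S : Shear Y Y1 Y2 B c) (hη : η ≠ 0) (hη1 : |η| ≤ 1 / 2)
    {b : ℝ} (hb : 0 < b) (hb2 : ∀ y ∈ Icc (0 : ℝ) 1, Y2 y ≤ -b) {y₀ : ℝ}
    (hy₀ : y₀ ∈ Icc (0 : ℝ) 1) (hz : Y y₀ = 0) {c₀ : ℝ} (hc₀ : 0 < c₀) (h0 : c₀ ≤ |Y 0|)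
    (h1 : c₀ ≤ |Y 1|) {R a : ℝ} (hR : R = 4 / c + 4 * B ^ 2 / c ^ 2)
    (ha : a = b / (2 * B ^ 2 * R)) :
    b / (4 * B ^ 2) / (1 + B ^ 2) ≤ ‖∫ y in (0 : ℝ)..1, (shearDen η Y y)⁻¹ ^ 2‖
      + (R / (2 * a) + 2 * (B / c / c₀ ^ 2)) * |η| := by
  have hB : 0 < B := one_pos.trans_le S.one_le
  have hc := S.pos
  have hY := S.prim.continuousOn
  have hY1 := S.prim1.continuousOn
  have hz2 := intervalIntegrable_of_continuousOn ((continuousOn_inv_shearDen hY hη).pow 2)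
  have hq := continuousOn_shearKer hY hη
  have im := (IsPrim.of_integrable hz2 0).im
  have ei := im.integral_eq
  simp only [zero_add, intervalIntegral.integral_same, Complex.zero_im, sub_zero] at ei
  have hP := S.prim_mul.mul (S.prim_inv hη).re
  set g : ℝ → ℝ := fun y => shearMulDeriv Y Y1 Y2 y * shearKer η Y y
      + 2 * Y y ^ 3 / (Y1 y ^ 2 + Y y ^ 2) * shearKer η Y y ^ 2 with hg
  have hgc : IntervalIntegrable g volume 0 1 := by
    refine intervalIntegrable_of_continuousOn ((S.continuousOn_mulDeriv.mul hq).add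
      (ContinuousOn.mul (ContinuousOn.div (continuousOn_const.mul (hY.pow 3))
        ((hY1.pow 2).add (hY.pow 2)) fun y hy => (S.denom_pos hy).ne') (hq.pow 2)))
  have e1 : (∫ y in (0 : ℝ)..1, ((shearDen η Y y)⁻¹ ^ 2).im)
      = (shearMul Y Y1 1 * (η * shearKer η Y 1) - shearMul Y Y1 0 * (η * shearKer η Y 0))
        - η * ∫ y in (0 : ℝ)..1, g y := by
    rw [← inv_shearDen_re, ← inv_shearDen_re, ← hP.integral_eq,
      ← intervalIntegral.integral_const_mul, ← intervalIntegral.integral_sub hP.1 (hgc.const_mul η)]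
    refine integral_congr_unit fun y hy => ?_
    have hN := S.denom_pos hy
    have e2 : (-(Complex.I * Y1 y) * (shearDen η Y y)⁻¹ ^ 2).re
        = Y1 y * ((shearDen η Y y)⁻¹ ^ 2).im := by
      rw [Complex.mul_re]
      simp
    rw [e2, inv_shearDen_re, sq_inv_shearDen_im, hg, shearMul]
    field_simp
    ring
  have hgl : b / (4 * B ^ 2) * (∫ y in (0 : ℝ)..1, shearKer η Y y) - R / (2 * a)
      ≤ ∫ y in (0 : ℝ)..1, g y := by
    have i1 := (intervalIntegrable_of_continuousOn hq).const_mul (b / (4 * B ^ 2))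
    have := integral_mono_unit (i1.sub (intervalIntegrable_const (c := R / (2 * a)))) hgc
      fun y hy => S.mulDeriv_ker_ge hη hb hy (hb2 y hy) hR ha
    rw [intervalIntegral.integral_sub i1 intervalIntegrable_const,
      intervalIntegral.integral_const_mul] at this
    simpa using this
  have hend {y : ℝ} (hy : y ∈ Icc (0 : ℝ) 1) (h : c₀ ≤ |Y y|) :
      |shearMul Y Y1 y * (η * shearKer η Y y)| ≤ B / c / c₀ ^ 2 * |η| := by
    have hk : shearKer η Y y ≤ 1 / c₀ ^ 2 := by
      rw [shearKer, one_div]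
      refine inv_anti₀ (by positivity) ?_
      have := pow_le_pow_left₀ hc₀.le h 2
      rw [sq_abs] at this
      nlinarith [sq_nonneg η]
    have := S.abs_mul_le hy
    have := (shearKer_pos hη Y y).le
    rw [abs_mul, abs_mul, abs_of_pos (shearKer_pos hη Y y)]
    calc _ ≤ B / c * (|η| * (1 / c₀ ^ 2)) := by
          gcongr
      _ = _ := by ring
  have hlow := S.le_integral_ker_of_zero hη hη1 hy₀ hz
  have h3 : |η * ∫ y in (0 : ℝ)..1, g y| ≤ ‖∫ y in (0 : ℝ)..1, (shearDen η Y y)⁻¹ ^ 2‖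
      + 2 * (B / c / c₀ ^ 2) * |η| := by
    have e3 : η * ∫ y in (0 : ℝ)..1, g y = (shearMul Y Y1 1 * (η * shearKer η Y 1)
        - shearMul Y Y1 0 * (η * shearKer η Y 0)) - (∫ y in (0 : ℝ)..1, (shearDen η Y y)⁻¹ ^ 2).im := by
      have : (∫ y in (0 : ℝ)..1, ((shearDen η Y y)⁻¹ ^ 2).im)
          = (∫ y in (0 : ℝ)..1, (shearDen η Y y)⁻¹ ^ 2).im := ei
      rw [← this, e1]
      ring
    rw [e3]
    have a1 := abs_sub (shearMul Y Y1 1 * (η * shearKer η Y 1)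
        - shearMul Y Y1 0 * (η * shearKer η Y 0)) (∫ y in (0 : ℝ)..1, (shearDen η Y y)⁻¹ ^ 2).im
    have a2 := abs_sub (shearMul Y Y1 1 * (η * shearKer η Y 1))
      (shearMul Y Y1 0 * (η * shearKer η Y 0))
    have a3 := Complex.abs_im_le_norm (∫ y in (0 : ℝ)..1, (shearDen η Y y)⁻¹ ^ 2)
    have := hend zero_mem_unit h0
    have := hend one_mem_unit h1
    linarith
  rw [abs_mul] at h3
  have h4 : |η| * (b / (4 * B ^ 2) * (∫ y in (0 : ℝ)..1, shearKer η Y y) - R / (2 * a))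
      ≤ |η| * |∫ y in (0 : ℝ)..1, g y| :=
    mul_le_mul_of_nonneg_left (hgl.trans (le_abs_self _)) (abs_nonneg _)
  have h5 : b / (4 * B ^ 2) * (1 / (1 + B ^ 2))
      ≤ b / (4 * B ^ 2) * (|η| * ∫ y in (0 : ℝ)..1, shearKer η Y y) := by gcongr
  rw [mul_one_div] at h5
  linarith

/-- Without zeros of `Y` the real part `(η² - Y²)/(η² + Y²)²` of the integrand is negative of
definite size. -/
theorem le_norm_integral_of_pos (S : Shear Y Y1 Y2 B c) (hη : η ≠ 0) {c₀ : ℝ} (hc₀ : 0 < c₀)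
    (hη1 : |η| ≤ 1) (hη2 : |η| ≤ c₀ / 2) (h : ∀ y ∈ Icc (0 : ℝ) 1, c₀ ≤ Y y) :
    3 / 4 * c₀ ^ 2 / (1 + B ^ 2) ^ 2 ≤ ‖∫ y in (0 : ℝ)..1, (shearDen η Y y)⁻¹ ^ 2‖ := by
  have hY := S.prim.continuousOn
  have hz2 := (continuousOn_inv_shearDen hY hη).pow 2
  have re := (IsPrim.of_integrable (intervalIntegrable_of_continuousOn hz2) 0).re
  have ei : (∫ y in (0 : ℝ)..1, ((shearDen η Y y)⁻¹ ^ 2).re)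
      = (∫ y in (0 : ℝ)..1, (shearDen η Y y)⁻¹ ^ 2).re := by
    have := re.integral_eq
    simpa using this
  have hm : ∫ y in (0 : ℝ)..1, ((shearDen η Y y)⁻¹ ^ 2).re
      ≤ ∫ y in (0 : ℝ)..1, -(3 / 4 * c₀ ^ 2 / (1 + B ^ 2) ^ 2) := by
    refine integral_mono_unit re.1 intervalIntegrable_const fun y hy => ?_
    rw [sq_inv_shearDen_re]
    have e1 := pow_le_pow_left₀ (abs_nonneg _) (S.abs_le y hy) 2
    have e2 := pow_le_pow_left₀ hc₀.le (h y hy) 2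
    have e3 := pow_le_pow_left₀ (abs_nonneg _) hη2 2
    have e4 := pow_le_pow_left₀ (abs_nonneg _) hη1 2
    rw [sq_abs] at e1 e3 e4
    have hk : 1 / (1 + B ^ 2) ≤ shearKer η Y y := by
      rw [shearKer, one_div]
      exact inv_anti₀ (by positivity) (by linarith)
    have hk2 := pow_le_pow_left₀ (by positivity) hk 2
    rw [div_pow, one_pow] at hk2
    have e5 : 3 / 4 * c₀ ^ 2 ≤ Y y ^ 2 - η ^ 2 := by linarith
    have e6 := mul_le_mul e5 hk2 (by positivity) (by nlinarith [sq_nonneg c₀])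
    rw [mul_one_div] at e6
    linarith
  rw [ei] at hm
  have := Complex.abs_re_le_norm (∫ y in (0 : ℝ)..1, (shearDen η Y y)⁻¹ ^ 2)
  have := neg_abs_le (∫ y in (0 : ℝ)..1, (shearDen η Y y)⁻¹ ^ 2).re
  simp only [intervalIntegral.integral_const, sub_zero, one_smul] at hm
  linarith

end Shear

/-! ### Concave profiles -/

namespace Profile
variable {U U1 U2 W W1 : ℝ → ℝ} {L : ℝ}

theorem inv_le_neg (hU : Profile U U1 U2 W W1 L) {y : ℝ} (hy : y ∈ Icc (0 : ℝ) 1) :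
    U2 y ≤ -(1 / L) := by
  have hL : 0 < L := one_pos.trans_le hU.one_le
  have hW : 0 < W y := (one_div_pos.2 hL).trans_le (hU.le_W y hy)
  have h1 : -U2 y = 1 / W y := by
    rw [eq_div_iff hW.ne']
    linarith [hU.weight y hy]
  have h2 := one_div_le_one_div_of_le hW (hU.W_le y hy)
  linarith

theorem le_tangent (hU : Profile U U1 U2 W W1 L) {x y : ℝ} (hx : x ∈ Icc (0 : ℝ) 1)
    (hy : y ∈ Icc (0 : ℝ) 1) : U x ≤ U y + U1 y * (x - y) := by
  have hL : 0 < L := one_pos.trans_le hU.one_le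
  have hneg : ∀ t ∈ Icc (0 : ℝ) 1, U2 t ≤ 0 := fun t ht =>
    (hU.inv_le_neg ht).trans (neg_nonpos.2 (one_div_pos.2 hL).le)
  have hanti : ∀ s ∈ Icc (0 : ℝ) 1, ∀ t ∈ Icc (0 : ℝ) 1, s ≤ t → U1 t ≤ U1 s := by
    intro s hs t ht hst
    have h1 := hU.prim1.sub_eq hs ht
    have h2 : ∫ x in s..t, U2 x ≤ ∫ _ in s..t, (0 : ℝ) :=
      intervalIntegral.integral_mono_on hst (intervalIntegrable_sub hU.prim1.1 hs ht)
        intervalIntegrable_const fun x hx => hneg x ⟨hs.1.trans hx.1, hx.2.trans ht.2⟩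
    simp only [intervalIntegral.integral_zero] at h2
    linarith
  rcases le_total y x with h | h
  · have h1 := hU.prim.sub_eq hy hx
    have h2 : ∫ t in y..x, U1 t ≤ ∫ _ in y..x, U1 y :=
      intervalIntegral.integral_mono_on h (intervalIntegrable_sub hU.prim.1 hy hx)
        intervalIntegrable_const fun t ht => hanti y hy t ⟨hy.1.trans ht.1, ht.2.trans hx.2⟩ ht.1
    rw [intervalIntegral.integral_const, smul_eq_mul] at h2
    linarith
  · have h1 := hU.prim.sub_eq hx hy
    have h2 : ∫ _ in x..y, U1 y ≤ ∫ t in x..y, U1 t :=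
      intervalIntegral.integral_mono_on h intervalIntegrable_const
        (intervalIntegrable_sub hU.prim.1 hx hy)
        fun t ht => hanti t ⟨hx.1.trans ht.1, ht.2.trans hy.2⟩ y hy ht.2
    rw [intervalIntegral.integral_const, smul_eq_mul] at h2
    linarith

/-- The tangent at `y` lies above `U` at both ends; averaging with the weights `1 - y` and `y`
cancels the slope. -/
theorem min_le (hU : Profile U U1 U2 W W1 L) {y : ℝ} (hy : y ∈ Icc (0 : ℝ) 1) :
    min (U 0) (U 1) ≤ U y := by
  have h0 := hU.le_tangent zero_mem_unit hy
  have h1 := hU.le_tangent one_mem_unit hy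
  have m0 := mul_le_mul_of_nonneg_left ((min_le_left (U 0) (U 1)).trans h0) (sub_nonneg.2 hy.2)
  have m1 := mul_le_mul_of_nonneg_left ((min_le_right (U 0) (U 1)).trans h1) hy.1
  linarith

/-- A profile with a positive value has no critical zero. -/
theorem exists_pos_le (hU : Profile U U1 U2 W W1 L) {y₁ : ℝ} (hy₁ : y₁ ∈ Icc (0 : ℝ) 1)
    (hpos : 0 < U y₁) : ∃ c : ℝ, 0 < c ∧ ∀ y ∈ Icc (0 : ℝ) 1, c ≤ U1 y ^ 2 + U y ^ 2 := by
  obtain ⟨x, hx, hm⟩ := isCompact_Icc.exists_isMinOn (nonempty_Icc.2 zero_le_one)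
    ((hU.prim1.continuousOn.pow 2).add (hU.prim.continuousOn.pow 2))
  refine ⟨U1 x ^ 2 + U x ^ 2, ?_, fun y hy => hm hy⟩
  refine lt_of_le_of_ne (by positivity) fun h => ?_
  have e1 : U1 x = 0 := by nlinarith [sq_nonneg (U1 x), sq_nonneg (U x)]
  have e2 : U x = 0 := by nlinarith [sq_nonneg (U1 x), sq_nonneg (U x)]
  -- At a critical zero the tangent is the zero function, which forces `U ≤ 0`.
  have := hU.le_tangent hy₁ hx
  rw [e1, e2] at this
  linarith

/-- Nondegeneracy survives the shift because `(U + s)² ≥ U²/2 - s²` and `s² ≤ c/4`. -/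
theorem shear (hU : Profile U U1 U2 W W1 L) {c s : ℝ} (hc : 0 < c)
    (h : ∀ y ∈ Icc (0 : ℝ) 1, c ≤ U1 y ^ 2 + U y ^ 2) (hs1 : |s| ≤ 1) (hs : |s| ≤ c / 4) :
    Shear (fun y => U y + s) U1 U2 (L + 1) (c / 4) where
  one_le := by linarith [hU.one_le]
  pos := by positivity
  prim := (hU.prim.add (IsPrim.const s)).congr_right fun y _ => by simp
  prim1 := hU.prim1
  cont2 := hU.cont2
  abs_le y hy := (abs_add_le _ _).trans (add_le_add (hU.abs_le y hy) hs1)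
  abs1_le y hy := (hU.abs1_le y hy).trans (by linarith)
  abs2_le y hy := (hU.abs2_le y hy).trans (by linarith)
  le y hy := by
    have h1 := h y hy
    have h2 : s ^ 2 ≤ c / 4 := by
      rw [← sq_abs]
      nlinarith [abs_nonneg s]
    nlinarith [sq_nonneg (U y + 2 * s), sq_nonneg (U1 y)]

/-- The bounds are uniform in `s` and `η`, which will be `Im λ / k` and `Re λ / k`. If `U` is
positive at both ends, concavity keeps it positive and the real part of the integral is bounded
below. Otherwise `U` is negative at one end and positive at `y₁`, the shifted profile has a zero by
continuity, and the imaginary part is used. -/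
theorem exists_nondegenerate (hU : Profile U U1 U2 W W1 L) (h0 : U 0 ≠ 0) (h1 : U 1 ≠ 0)
    {y₁ : ℝ} (hy₁ : y₁ ∈ Icc (0 : ℝ) 1) (hpos : 0 < U y₁) :
    ∃ δ c b : ℝ, 0 < δ ∧ 0 < b ∧ ∀ s η : ℝ, |s| ≤ δ → η ≠ 0 → |η| ≤ δ →
      Shear (fun y => U y + s) U1 U2 (L + 1) c ∧
        b ≤ ‖∫ y in (0 : ℝ)..1, (shearDen η (fun y => U y + s) y)⁻¹ ^ 2‖ := by
  have hL := hU.one_le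
  have hL0 : 0 < L := one_pos.trans_le hL
  obtain ⟨c, hc, hcle⟩ := hU.exists_pos_le hy₁ hpos
  obtain ⟨m, hm, hm0, hm1⟩ : ∃ m : ℝ, 0 < m ∧ m ≤ |U 0| ∧ m ≤ |U 1| :=
    ⟨min |U 0| |U 1|, lt_min (abs_pos.2 h0) (abs_pos.2 h1), min_le_left _ _, min_le_right _ _⟩
  by_cases hp : 0 < U 0 ∧ 0 < U 1
  · obtain ⟨hp0, hp1⟩ := hp
    rw [abs_of_pos hp0] at hm0
    rw [abs_of_pos hp1] at hm1
    refine ⟨min (min 1 (c / 4)) (m / 4), c / 4, 3 / 4 * (m / 2) ^ 2 / (1 + (L + 1) ^ 2) ^ 2,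
      by positivity, by positivity, fun s η hs hη hη1 => ?_⟩
    rw [le_min_iff, le_min_iff] at hs hη1
    have S := hU.shear hc hcle hs.1.1 hs.1.2
    refine ⟨S, S.le_norm_integral_of_pos hη (by positivity) hη1.1.1 (by linarith) fun y hy => ?_⟩
    have := (le_min hm0 hm1).trans (hU.min_le hy)
    linarith [neg_abs_le s]
  · set R := 4 / (c / 4) + 4 * (L + 1) ^ 2 / (c / 4) ^ 2 with hR
    set a := 1 / L / (2 * (L + 1) ^ 2 * R) with ha
    set D := R / (2 * a) + 2 * ((L + 1) / (c / 4) / (m / 2) ^ 2) with hD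
    set b := 1 / L / (4 * (L + 1) ^ 2) / (1 + (L + 1) ^ 2) with hb
    have hR0 : 0 < R := by positivity
    have ha0 : 0 < a := by positivity
    have hD0 : 0 < D := by positivity
    have hb0 : 0 < b := by positivity
    refine ⟨min (min (min (1 / 2) (c / 4)) (min (m / 2) (U y₁))) (b / (2 * D)), c / 4, b / 2,
      by positivity, by positivity, fun s η hs hη hη1 => ?_⟩
    simp only [le_min_iff] at hs hη1
    obtain ⟨⟨⟨hs1, hs2⟩, hs3, hs4⟩, -⟩ := hs
    obtain ⟨⟨⟨hη1, -⟩, -, -⟩, hη2⟩ := hη1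
    have S := hU.shear hc hcle (hs1.trans (by norm_num)) hs2
    refine ⟨S, ?_⟩
    have hfar {e : ℝ} (he : m ≤ |U e|) : m / 2 ≤ |U e + s| := by
      have := abs_sub_abs_le_abs_sub (U e) (-s)
      rw [abs_neg, sub_neg_eq_add] at this
      linarith
    have hcont := S.prim.continuousOn
    have hy₁' : 0 ≤ U y₁ + s := by linarith [neg_abs_le s]
    obtain ⟨y₀, hy₀, hz⟩ : ∃ y₀ ∈ Icc (0 : ℝ) 1, U y₀ + s = 0 := by
      have hs5 := le_abs_self s
      rw [not_and_or, not_lt, not_lt] at hp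
      rcases hp with hp | hp
      · rw [abs_of_nonpos hp] at hm0
        obtain ⟨y, hy, e⟩ := intermediate_value_Icc hy₁.1
          (hcont.mono (Icc_subset_Icc_right hy₁.2)) (show (0 : ℝ) ∈ Icc (U 0 + s) (U y₁ + s) from
            ⟨by linarith, hy₁'⟩)
        exact ⟨y, ⟨hy.1, hy.2.trans hy₁.2⟩, e⟩
      · rw [abs_of_nonpos hp] at hm1
        obtain ⟨y, hy, e⟩ := intermediate_value_Icc' hy₁.2
          (hcont.mono (Icc_subset_Icc_left hy₁.1)) (show (0 : ℝ) ∈ Icc (U 1 + s) (U y₁ + s) from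
            ⟨by linarith, hy₁'⟩)
        exact ⟨y, ⟨hy₁.1.trans hy.1, hy.2⟩, e⟩
    have key := S.le_norm_integral_of_zero hη hη1 (one_div_pos.2 hL0)
      (fun y hy => hU.inv_le_neg hy) hy₀ hz (c₀ := m / 2) (by positivity) (hfar hm0) (hfar hm1)
      hR ha
    rw [← hD, ← hb] at key
    have : D * |η| ≤ b / 2 := by
      calc D * |η| ≤ D * (b / (2 * D)) := by gcongr
        _ = _ := by field_simp
    linarith

end Profile

/-! ### Bounds for the boundary flux of solutions with zero vorticity flux -/

/-- The relations between the parameters of the problem: `r ^ 2` is the real part and `l ^ 2` the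
modulus of the spectral parameter, and `n ^ 2` the size of the coefficient at the boundary. -/
structure Regime (U : ℝ → ℝ) (L k : ℝ) (lam : ℂ) (r l n : ℝ) : Prop where
  le_r : 320 ≤ r
  two_le : 2 * L ^ 4 ≤ r ^ 2
  re_eq : lam.re = r ^ 2
  k_le : 200000 * L ^ 3 * |k| ≤ r ^ 3
  l_pos : 0 < l
  l_sq : l ^ 2 = ‖lam‖
  n_pos : 0 < n
  n_sq : n ^ 2 = min ‖pCoeff U k lam 0‖ ‖pCoeff U k lam 1‖

/-- The bound `‖λ₀ u(0)‖² r⁴ ≤ C n³ l ‖f‖²` for solutions without vorticity flux at the boundary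
and with a force of zero mean. -/
def FluxBound (U U2 : ℝ → ℝ) (k : ℝ) (lam : ℂ) (r l n C : ℝ) : Prop :=
  ∀ f Φ u ω v, Sol (pCoeff U k lam) (qCoeff U2 k) f Φ u ω v → SqInt f →
    Φ 0 = 0 → Φ 1 = 0 → v 0 = 0 → v 1 = 0 → ∫ y in (0 : ℝ)..1, f y = 0 →
      ‖pCoeff U k lam 0 * u 0‖ ^ 2 * r ^ 4 ≤ C * n ^ 3 * l * normSq f

namespace Regime
variable {U U1 U2 W W1 : ℝ → ℝ} {L k r l n : ℝ} {lam : ℂ}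

theorem r_le_l (R : Regime U L k lam r l n) : r ≤ l := by
  refine le_of_sq_le_sq ?_ R.l_pos.le
  rw [R.l_sq, ← R.re_eq]
  exact Complex.re_le_norm _

theorem bounds (R : Regime U L k lam r l n) (hU : Profile U U1 U2 W W1 L) {f Φ u ω v : ℝ → ℂ}
    (h : Sol (pCoeff U k lam) (qCoeff U2 k) f Φ u ω v) (hf : SqInt f)
    (hΦ0 : Φ 0 = 0) (hΦ1 : Φ 1 = 0) (hv0 : v 0 = 0) (hv1 : v 1 = 0) :
    r ^ 2 * √(normSq ω) ≤ 2 * L ^ 2 * √(normSq f) ∧ r * √(normSq v) ≤ 2 * L ^ 2 * √(normSq f) := by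
  have hr : 0 < r := by linarith [R.le_r]
  obtain ⟨h1, h2⟩ := h.neumann_bounds hU (R.two_le.trans R.re_eq.ge) hf hΦ0 hΦ1 hv0 hv1
  rw [R.re_eq] at h1 h2
  refine ⟨h1, le_of_sq_le_sq ?_ (by positivity)⟩
  rw [mul_pow, mul_pow, sqrt_normSq_sq, sqrt_normSq_sq]
  linarith

/-- Since `p u` is the same at both ends, it can be estimated where `‖p‖ = n²`, by `n²‖ω‖`; of the
resulting `n⁴` one factor is exchanged for `A l`. -/
theorem fluxBound_of_le (R : Regime U L k lam r l n) (hU : Profile U U1 U2 W W1 L) {A : ℝ}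
    (hA : n ≤ A * l) : FluxBound U U2 k lam r l n (A * (4 * L ^ 4)) := by
  intro f Φ u ω v h hf hΦ0 hΦ1 hv0 hv1 hmean
  have hn := R.n_pos
  obtain ⟨b1, -⟩ := R.bounds hU h hf hΦ0 hΦ1 hv0 hv1
  obtain ⟨u0, u1⟩ := norm_velocity_le h.stream h.vel h.vort.continuousOn hΦ0 hΦ1
  have hflux := h.flux_eq hU.prim hU.prim1 hΦ0 hΦ1
  rw [hv0, hv1, hmean, sub_zero, sub_zero, sub_eq_zero] at hflux
  have hC : ‖pCoeff U k lam 0 * u 0‖ ≤ n ^ 2 * √(normSq ω) := by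
    rw [R.n_sq]
    rcases le_total ‖pCoeff U k lam 0‖ ‖pCoeff U k lam 1‖ with hle | hle
    · rw [min_eq_left hle, norm_mul]
      gcongr
    · rw [min_eq_right hle, ← hflux, norm_mul]
      gcongr
  have hr : 0 < r := by linarith [R.le_r]
  have s1 := pow_le_pow_left₀ (norm_nonneg _) hC 2
  have s2 := pow_le_pow_left₀ (by positivity) b1 2
  rw [mul_pow, mul_pow, mul_pow, sqrt_normSq_sq, sqrt_normSq_sq] at s2
  rw [mul_pow, sqrt_normSq_sq] at s1
  have hfn := normSq_nonneg f
  calc ‖pCoeff U k lam 0 * u 0‖ ^ 2 * r ^ 4 ≤ ((n ^ 2) ^ 2 * normSq ω) * r ^ 4 := by gcongr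
    _ = n ^ 3 * n * ((r ^ 2) ^ 2 * normSq ω) := by ring
    _ ≤ n ^ 3 * (A * l) * (2 ^ 2 * (L ^ 2) ^ 2 * normSq f) := by
      have := normSq_nonneg ω
      have : 0 ≤ A * l := hn.le.trans hA
      gcongr
    _ = _ := by ring

/-- The imaginary part of the energy identity yields `t‖u‖r² ≤ 4L³ l ‖f‖`, and Sobolev's inequality
passes to `u 0`. From `‖p(0)‖ ≤ 2Lt²` arises `t³`, which `β t ≤ n` converts into `n³`. -/
theorem fluxBound_of_nonpos (R : Regime U L k lam r l n) (hU : Profile U U1 U2 W W1 L)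
    (hneg : ∀ y ∈ Icc (0 : ℝ) 1, U y ≤ 0) {t β : ℝ} (ht : 0 < t) (htk : t ^ 2 = |k|)
    (hl : l ≤ t) (hβ : 0 < β) (hn : β * t ≤ n) :
    FluxBound U U2 k lam r l n (128 * L ^ 8 / β ^ 3) := by
  intro f Φ u ω v h hf hΦ0 hΦ1 hv0 hv1 _
  have hL := hU.one_le
  have hr : 0 < r := by linarith [R.le_r]
  have hrl := R.r_le_l
  have hl0 := R.l_pos
  obtain ⟨b1, b2⟩ := R.bounds hU h hf hΦ0 hΦ1 hv0 hv1
  have hu := h.velocity_bound hU hneg hf hΦ0 hΦ1 hv0 hv1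
  have hu0 := h.vel.norm_sq_le h.vort.sqInt zero_mem_unit
  rw [← sqrt_normSq_sq u, ← sqrt_normSq_sq ω, Real.sqrt_sq (Real.sqrt_nonneg _), ← htk] at hu
  rw [← sqrt_normSq_sq u, Real.sqrt_sq (Real.sqrt_nonneg _)] at hu0
  rw [← sqrt_normSq_sq f]
  have x0 := Real.sqrt_nonneg (normSq u)
  have w0 := Real.sqrt_nonneg (normSq ω)
  have v0 := Real.sqrt_nonneg (normSq v)
  have F0 := Real.sqrt_nonneg (normSq f)
  generalize √(normSq u) = x at *
  generalize √(normSq ω) = w at *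
  generalize √(normSq v) = vv at *
  generalize √(normSq f) = F at *
  have him : |lam.im| ≤ l ^ 2 := R.l_sq ▸ Complex.abs_im_le_norm lam
  have hr1 : 1 ≤ r := by linarith [R.le_r]
  have hrl2 : r ^ 2 ≤ l ^ 2 := pow_le_pow_left₀ hr.le hrl 2
  have hrr : r ≤ r ^ 2 := le_self_pow₀ hr1 (by norm_num)
  have hx : t * x * r ^ 2 ≤ 4 * L ^ 3 * l * F := by
    refine le_of_sq_le_sq ?_ (by positivity)
    have e1 : (r ^ 2 * w) * (r ^ 2 * w) ≤ (2 * L ^ 2 * F) * (2 * L ^ 2 * F) := by gcongr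
    have e2 : (r * vv) * (r ^ 2 * w) ≤ (2 * L ^ 2 * F) * (2 * L ^ 2 * F) := by gcongr
    calc (t * x * r ^ 2) ^ 2 = t ^ 2 * x ^ 2 * r ^ 4 := by ring
      _ ≤ L * (|lam.im| * w ^ 2 + F * w + vv * w) * r ^ 4 :=
        mul_le_mul_of_nonneg_right hu (by positivity)
      _ = L * (|lam.im| * ((r ^ 2 * w) * (r ^ 2 * w)) + F * r ^ 2 * (r ^ 2 * w)
          + r * ((r * vv) * (r ^ 2 * w))) := by ring
      _ ≤ L * (l ^ 2 * ((2 * L ^ 2 * F) * (2 * L ^ 2 * F)) + F * l ^ 2 * (2 * L ^ 2 * F)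
          + l ^ 2 * ((2 * L ^ 2 * F) * (2 * L ^ 2 * F))) := by
        have : r ≤ l ^ 2 := hrr.trans hrl2
        gcongr
      _ = l ^ 2 * F ^ 2 * (8 * L ^ 5 + 2 * L ^ 3) := by ring
      _ ≤ l ^ 2 * F ^ 2 * (8 * L ^ 6 + 2 * L ^ 6) := by
        gcongr <;> norm_num
      _ ≤ _ := by nlinarith [(by positivity : 0 ≤ l ^ 2 * F ^ 2 * L ^ 6)]
  have hub : ‖u 0‖ ^ 2 * r ^ 4 * t ≤ 32 * L ^ 6 * l * F ^ 2 := by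
    have e1 : x ^ 2 * r ^ 4 * t ≤ 16 * L ^ 6 * l * F ^ 2 := by
      refine le_of_mul_le_mul_left ?_ ht
      calc t * (x ^ 2 * r ^ 4 * t) = (t * x * r ^ 2) * (t * x * r ^ 2) := by ring
        _ ≤ (4 * L ^ 3 * l * F) * (4 * L ^ 3 * l * F) := by gcongr
        _ = l * (16 * L ^ 6 * l * F ^ 2) := by ring
        _ ≤ t * (16 * L ^ 6 * l * F ^ 2) := by gcongr
    have e2 : 2 * (x * w) * r ^ 4 * t ≤ 16 * L ^ 6 * l * F ^ 2 := by
      calc 2 * (x * w) * r ^ 4 * t = 2 * ((t * x * r ^ 2) * (r ^ 2 * w)) := by ring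
        _ ≤ 2 * ((4 * L ^ 3 * l * F) * (2 * L ^ 2 * F)) := by gcongr
        _ = 16 * L ^ 5 * l * F ^ 2 := by ring
        _ ≤ _ := by
          gcongr
          norm_num
    calc ‖u 0‖ ^ 2 * r ^ 4 * t ≤ (x ^ 2 + 2 * (x * w)) * r ^ 4 * t := by gcongr
      _ = x ^ 2 * r ^ 4 * t + 2 * (x * w) * r ^ 4 * t := by ring
      _ ≤ _ := by linarith
  have hp : ‖pCoeff U k lam 0‖ ≤ 2 * L * t ^ 2 := by
    have e1 : ‖pCoeff U k lam 0‖ ≤ ‖lam‖ + |k| * |U 0| := by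
      refine (norm_add_le _ _).trans (le_of_eq ?_)
      simp
    have e2 := hU.abs_le 0 zero_mem_unit
    have e3 : l ^ 2 ≤ t ^ 2 := pow_le_pow_left₀ hl0.le hl 2
    rw [← R.l_sq, ← htk] at e1
    nlinarith [mul_le_mul_of_nonneg_left e2 (sq_nonneg t),
      mul_le_mul_of_nonneg_left hL (sq_nonneg t)]
  have ht3 : t ^ 3 ≤ n ^ 3 / β ^ 3 := by
    rw [le_div_iff₀ (by positivity), ← mul_pow, mul_comm t]
    exact pow_le_pow_left₀ (by positivity) hn 3
  rw [norm_mul]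
  calc (‖pCoeff U k lam 0‖ * ‖u 0‖) ^ 2 * r ^ 4
      ≤ (2 * L * t ^ 2 * ‖u 0‖) ^ 2 * r ^ 4 := by gcongr
    _ = 4 * L ^ 2 * t ^ 3 * (‖u 0‖ ^ 2 * r ^ 4 * t) := by ring
    _ ≤ 4 * L ^ 2 * (n ^ 3 / β ^ 3) * (32 * L ^ 6 * l * F ^ 2) := by
      have := R.n_pos
      gcongr
    _ = _ := by ring

theorem pCoeff_eq (R : Regime U L k lam r l n) (hk : k ≠ 0) (y : ℝ) :
    pCoeff U k lam y = k * shearDen (r ^ 2 / k) (fun y => U y + lam.im / k) y := by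
  have hk' : (k : ℂ) ≠ 0 := by exact_mod_cast hk
  have h : lam = (r : ℂ) ^ 2 + lam.im * Complex.I := by
    conv_lhs => rw [← Complex.re_add_im lam, R.re_eq]
    push_cast
    rfl
  simp only [pCoeff, shearDen]
  push_cast
  field_simp
  linear_combination h

/-- The constant of integration `C₁` of the integrated equation is isolated by dividing by the
square of `η + iY = p/k`: the left side becomes `k (Φ/(η + iY))'`, which integrates to zero. -/
theorem fluxBound_of_shear (R : Regime U L k lam r l n) (hU : Profile U U1 U2 W W1 L)
    {t β B c b A D : ℝ} (ht : 0 < t) (htk : t ^ 2 = |k|) (hβ : 0 < β) (hn : β * t ≤ n)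
    (hη1 : |r ^ 2 / k| ≤ 1) (S : Shear (fun y => U y + lam.im / k) U1 U2 B c) (hb : 0 < b)
    (hbI : b ≤ ‖∫ y in (0 : ℝ)..1, (shearDen (r ^ 2 / k) (fun y => U y + lam.im / k) y)⁻¹ ^ 2‖)
    (hA : A = 4 * (B / c) + 12 * B ^ 3 / c ^ 2 + 1 / c)
    (hD : D = (2 * L ^ 2 * √A + (1 / c + (6 * B ^ 3 / c ^ 2 + B / c) * √A)) / b) :
    FluxBound U U2 k lam r l n (D ^ 2 / β ^ 3) := by
  intro f Φ u ω v h hf hΦ0 hΦ1 hv0 hv1 hmean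
  have hL := hU.one_le
  have hr : 0 < r := by linarith [R.le_r]
  have hk : k ≠ 0 := abs_pos.1 (htk ▸ by positivity)
  have hk' : (k : ℂ) ≠ 0 := by exact_mod_cast hk
  have hη : r ^ 2 / k ≠ 0 := by positivity
  obtain ⟨-, b2⟩ := R.bounds hU h hf hΦ0 hΦ1 hv0 hv1
  set Y : ℝ → ℝ := fun y => U y + lam.im / k with hY
  set η := r ^ 2 / k with hηdef
  set C₁ := pCoeff U k lam 0 * u 0 with hC₁
  have hε : (r / t) ^ 2 = |η| := by
    rw [hηdef, abs_div, abs_of_pos (by positivity : 0 < r ^ 2), ← htk, div_pow]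
  have hG := IsPrim.of_integrable hf.intervalIntegrable 0
  set G : ℝ → ℂ := fun y => 0 + ∫ s in (0 : ℝ)..y, f s with hGdef
  have hG0 : G 0 = 0 := by simp [hGdef]
  have hG1 : G 1 = 0 := by simp [hGdef, hmean]
  have hJ : ∀ y ∈ Icc (0 : ℝ) 1, pCoeff U k lam y * u y - Complex.I * k * U1 y * Φ y
      = v y + G y + C₁ := by
    intro y hy
    have e := (h.isPrim_flux hU.prim hU.prim1).2 y hy
    simp only [hΦ0, hv0] at e
    have e2 : G y = ∫ s in (0 : ℝ)..y, f s := by simp [hGdef]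
    rw [e2]
    linear_combination e
  have hPr := h.stream.mul (S.prim_inv hη)
  have hi1 : ContinuousOn (fun y => v y * (shearDen η Y y)⁻¹ ^ 2) (Icc 0 1) :=
    h.flux.continuousOn.mul ((continuousOn_inv_shearDen S.prim.continuousOn hη).pow 2)
  have hi2 : ContinuousOn (fun y => G y * (shearDen η Y y)⁻¹ ^ 2) (Icc 0 1) :=
    hG.continuousOn.mul ((continuousOn_inv_shearDen S.prim.continuousOn hη).pow 2)
  have hi3 : ContinuousOn (fun y => C₁ * (shearDen η Y y)⁻¹ ^ 2) (Icc 0 1) :=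
    continuousOn_const.mul ((continuousOn_inv_shearDen S.prim.continuousOn hη).pow 2)
  have hsum : (∫ y in (0 : ℝ)..1, v y * (shearDen η Y y)⁻¹ ^ 2)
      + (∫ y in (0 : ℝ)..1, G y * (shearDen η Y y)⁻¹ ^ 2)
      + C₁ * ∫ y in (0 : ℝ)..1, (shearDen η Y y)⁻¹ ^ 2 = 0 := by
    have e := (hPr.const_mul (k : ℂ)).integral_eq
    rw [hΦ0, hΦ1] at e
    rw [← intervalIntegral.integral_const_mul,
      ← intervalIntegral.integral_add (intervalIntegrable_of_continuousOn hi1)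
        (intervalIntegrable_of_continuousOn hi2),
      ← intervalIntegral.integral_add ((intervalIntegrable_of_continuousOn hi1).add
        (intervalIntegrable_of_continuousOn hi2)) (intervalIntegrable_of_continuousOn hi3)]
    simp only [zero_mul, mul_zero, sub_zero] at e
    rw [← e]
    refine integral_congr_unit fun y hy => ?_
    have hz := shearDen_ne_zero hη Y y
    have e3 := hJ y hy
    rw [R.pCoeff_eq hk] at e3
    rw [← add_mul, ← add_mul, ← e3, ← hY, ← hηdef]
    field_simp
    ring
  have n1 := S.norm_integral_flux_le hη hη1 h.flux.continuousOn hA (by positivity) hε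
  have n2 := S.norm_integral_data_le hη hη1 hG hf hG0 hG1 hA (by positivity) hε
  set F := √(normSq f)
  have hF0 : 0 ≤ F := Real.sqrt_nonneg _
  have hA0 := Real.sqrt_nonneg A
  -- The extra loss `(t/r)²` in the flux term is paid by `r‖v‖ ≤ 2L²‖f‖` and `|k| ≤ r³`; this is how
  -- the exponent `2/3` enters.
  have n3 : √(normSq v) / (r / t) ^ 3 ≤ 2 * L ^ 2 * (F / (r / t)) := by
    have e1 : |k| ≤ r ^ 3 := by
      have : 1 ≤ L ^ 3 := one_le_pow₀ hL
      nlinarith [R.k_le, abs_nonneg k]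
    rw [← htk] at e1
    have e2 : √(normSq v) / (r / t) ^ 3 = (r * √(normSq v)) * (t ^ 2 / r ^ 3) * (t / r) := by
      field_simp
    rw [e2]
    calc _ ≤ (2 * L ^ 2 * F) * 1 * (t / r) := by
          gcongr
          rw [div_le_one (by positivity)]
          exact e1
      _ = _ := by field_simp
  have hCb : ‖C₁‖ ≤ D * (F * t / r) := by
    rw [hD, div_mul_eq_mul_div, le_div_iff₀ hb]
    have e1 : C₁ * ∫ y in (0 : ℝ)..1, (shearDen η Y y)⁻¹ ^ 2
        = -((∫ y in (0 : ℝ)..1, v y * (shearDen η Y y)⁻¹ ^ 2)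
          + (∫ y in (0 : ℝ)..1, G y * (shearDen η Y y)⁻¹ ^ 2)) := by
      linear_combination hsum
    have e2 := congrArg norm e1
    rw [norm_mul, norm_neg] at e2
    have e3 : F / (r / t) = F * t / r := by field_simp
    rw [e3] at n2 n3
    calc ‖C₁‖ * b ≤ ‖C₁‖ * ‖∫ y in (0 : ℝ)..1, (shearDen η Y y)⁻¹ ^ 2‖ := by gcongr
      _ ≤ ‖∫ y in (0 : ℝ)..1, v y * (shearDen η Y y)⁻¹ ^ 2‖
          + ‖∫ y in (0 : ℝ)..1, G y * (shearDen η Y y)⁻¹ ^ 2‖ := e2.trans_le (norm_add_le _ _)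
      _ ≤ √A * (2 * L ^ 2 * (F * t / r))
          + (1 / c + (6 * B ^ 3 / c ^ 2 + B / c) * √A) * (F * t / r) :=
        add_le_add (n1.trans (by gcongr)) n2
      _ = _ := by ring
  have hrt : r ≤ t := by
    refine le_of_sq_le_sq ?_ ht.le
    rw [← hε, div_pow, div_le_one (by positivity)] at hη1
    exact hη1
  have hrl := R.r_le_l
  have ht3 : t ^ 3 ≤ n ^ 3 / β ^ 3 := by
    rw [le_div_iff₀ (by positivity), ← mul_pow, mul_comm t]
    exact pow_le_pow_left₀ (by positivity) hn 3
  rw [← sqrt_normSq_sq f]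
  calc ‖C₁‖ ^ 2 * r ^ 4 ≤ (D * (F * t / r)) ^ 2 * r ^ 4 := by gcongr
    _ = D ^ 2 * F ^ 2 * (t ^ 2 * (r * r)) := by field_simp
    _ ≤ D ^ 2 * F ^ 2 * (t ^ 2 * (t * l)) := by gcongr
    _ = D ^ 2 * F ^ 2 * (t ^ 3 * l) := by ring
    _ ≤ D ^ 2 * F ^ 2 * (n ^ 3 / β ^ 3 * l) := by
      have := R.l_pos
      gcongr
    _ = _ := by ring

end Regime

/-! ### The clamped problem -/

section clamped
variable {U U1 U2 W W1 : ℝ → ℝ} {L k r l n : ℝ} {lam : ℂ}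

theorem FluxBound.mono {C C' : ℝ} (h : FluxBound U U2 k lam r l n C) (hC : C ≤ C') (hn : 0 < n)
    (hl : 0 < l) : FluxBound U U2 k lam r l n C' := by
  intro f Φ u ω v hs hf hΦ0 hΦ1 hv0 hv1 hm
  refine (h f Φ u ω v hs hf hΦ0 hΦ1 hv0 hv1 hm).trans ?_
  have := normSq_nonneg f
  gcongr

theorem norm_pCoeff_le (hU : Profile U U1 U2 W W1 L) {y : ℝ} (hy : y ∈ Icc (0 : ℝ) 1) :
    ‖pCoeff U k lam y‖ ≤ ‖lam‖ + L * |k| := by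
  refine (norm_add_le _ _).trans (add_le_add le_rfl ?_)
  rw [norm_mul, norm_mul, Complex.norm_I, one_mul, Complex.norm_real, Complex.norm_real,
    Real.norm_eq_abs, Real.norm_eq_abs, mul_comm]
  exact mul_le_mul_of_nonneg_right (hU.abs_le y hy) (abs_nonneg _)

theorem le_norm_pCoeff (U : ℝ → ℝ) (k : ℝ) (lam : ℂ) (y : ℝ) :
    |U y| * |k| - ‖lam‖ ≤ ‖pCoeff U k lam y‖ := by
  have h := norm_sub_norm_le (Complex.I * k * (U y : ℂ)) (-lam)
  rw [norm_neg, norm_mul, norm_mul, Complex.norm_I, one_mul, Complex.norm_real, Complex.norm_real,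
    Real.norm_eq_abs, Real.norm_eq_abs, mul_comm |k|] at h
  refine h.trans (le_of_eq ?_)
  rw [pCoeff]
  congr 1
  ring

theorem Profile.exists_fluxBound (hU : Profile U U1 U2 W W1 L) :
    ∃ C : ℝ, 0 < C ∧ ∀ (k : ℝ) (lam : ℂ) (r l n : ℝ), Regime U L k lam r l n →
      FluxBound U U2 k lam r l n C := by
  have hL := hU.one_le
  have hL0 : 0 < L := one_pos.trans_le hL
  by_cases hend : U 0 = 0 ∨ U 1 = 0
  -- At an end where `U` vanishes `p` equals `λ`, hence `n ≤ l`.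
  · refine ⟨1 * (4 * L ^ 4), by positivity, fun k lam r l n R => R.fluxBound_of_le hU ?_⟩
    rw [one_mul]
    refine le_of_sq_le_sq ?_ R.l_pos.le
    rw [R.n_sq, R.l_sq]
    rcases hend with h | h
    · exact (min_le_left _ _).trans (by simp [pCoeff, h])
    · exact (min_le_right _ _).trans (by simp [pCoeff, h])
  rw [not_or] at hend
  obtain ⟨h0, h1⟩ := hend
  obtain ⟨m, hm, hm0, hm1⟩ : ∃ m : ℝ, 0 < m ∧ m ≤ |U 0| ∧ m ≤ |U 1| :=
    ⟨min |U 0| |U 1|, lt_min (abs_pos.2 h0) (abs_pos.2 h1), min_le_left _ _, min_le_right _ _⟩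
  -- If `‖λ‖` is at least a fixed multiple of `|k|`, then `n ≲ l` and the elementary bound applies.
  -- In the remaining regime `ikU` dominates `p` at the ends, so `n ≥ √(m/2) t` with `t = √|k|`.
  suffices hred : ∃ δ C : ℝ, 0 < δ ∧ 0 < C ∧ ∀ (k : ℝ) (lam : ℂ) (r l n t : ℝ),
      Regime U L k lam r l n → 0 < t → t ^ 2 = |k| → ‖lam‖ ≤ δ * |k| → l ≤ t →
        √(m / 2) * t ≤ n → FluxBound U U2 k lam r l n C by
    obtain ⟨δ, C, hδ, hC, hmain⟩ := hred
    set δ' := min (min δ 1) (m / 2)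
    have hδ' : 0 < δ' := by positivity
    refine ⟨max C ((1 + L / δ') * (4 * L ^ 4)), by positivity, fun k lam r l n R => ?_⟩
    rcases le_total (δ' * |k|) ‖lam‖ with hlam | hlam
    · refine (R.fluxBound_of_le hU ?_).mono (le_max_right _ _) R.n_pos R.l_pos
      have hA : 1 ≤ 1 + L / δ' := le_add_of_nonneg_right (by positivity)
      have hl := R.l_pos
      refine le_of_sq_le_sq ?_ (by positivity)
      rw [R.n_sq, mul_pow, R.l_sq]
      calc _ ≤ ‖lam‖ + L * |k| := (min_le_left _ _).trans (norm_pCoeff_le hU zero_mem_unit)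
        _ ≤ ‖lam‖ + L * (‖lam‖ / δ') := by
          gcongr
          rw [le_div_iff₀ hδ']
          linarith
        _ = (1 + L / δ') * ‖lam‖ := by ring
        _ ≤ _ := by
          gcongr
          exact le_self_pow₀ hA (by norm_num)
    · have hδ1 : δ' ≤ δ := (min_le_left _ _).trans (min_le_left _ _)
      have hδ2 : δ' ≤ 1 := (min_le_left _ _).trans (min_le_right _ _)
      have hδ3 : δ' ≤ m / 2 := min_le_right _ _
      have hl2 := R.l_sq
      have hk : 0 < |k| := by
        have : 0 < ‖lam‖ := hl2 ▸ pow_pos R.l_pos 2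
        by_contra hc
        nlinarith [abs_nonneg k]
      have ht := Real.sqrt_pos.2 hk
      have ht2 := Real.sq_sqrt hk.le
      refine (hmain k lam r l n √|k| R ht ht2 (hlam.trans (by gcongr)) ?_ ?_).mono
        (le_max_left _ _) R.n_pos R.l_pos
      · refine le_of_sq_le_sq ?_ ht.le
        rw [hl2, ht2]
        nlinarith
      · refine le_of_sq_le_sq ?_ R.n_pos.le
        rw [mul_pow, ht2, Real.sq_sqrt (by positivity), R.n_sq]
        have b0 := le_norm_pCoeff U k lam 0
        have b1 := le_norm_pCoeff U k lam 1
        have c0 := mul_le_mul_of_nonneg_right hm0 hk.le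
        have c1 := mul_le_mul_of_nonneg_right hm1 hk.le
        have c2 := mul_le_mul_of_nonneg_right hδ3 hk.le
        exact le_min (by linarith) (by linarith)
  have hβ : 0 < √(m / 2) := Real.sqrt_pos.2 (by positivity)
  by_cases hneg : ∀ y ∈ Icc (0 : ℝ) 1, U y ≤ 0
  · exact ⟨1, _, one_pos, by positivity, fun k lam r l n t R ht htk _ hlt hn =>
      R.fluxBound_of_nonpos hU hneg ht htk hlt hβ hn⟩
  · push Not at hneg
    obtain ⟨y₁, hy₁, hpos⟩ := hneg
    obtain ⟨δ, c, b, hδ, hb, hnd⟩ := hU.exists_nondegenerate h0 h1 hy₁ hpos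
    set A := 4 * ((L + 1) / c) + 12 * (L + 1) ^ 3 / c ^ 2 + 1 / c with hA
    set D := (2 * L ^ 2 * √A
      + (1 / c + (6 * (L + 1) ^ 3 / c ^ 2 + (L + 1) / c) * √A)) / b with hD
    refine ⟨min δ 1, max 1 (D ^ 2 / √(m / 2) ^ 3), by positivity, by positivity,
      fun k lam r l n t R ht htk hlam hlt hn => ?_⟩
    have hk0 : 0 < |k| := htk ▸ pow_pos ht 2
    have hk : k ≠ 0 := abs_pos.1 hk0
    have hr : 0 < r := by linarith [R.le_r]
    have hdiv {x : ℝ} (hx : |x| ≤ ‖lam‖) : |x / k| ≤ min δ 1 := by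
      rw [abs_div, div_le_iff₀ hk0]
      exact hx.trans hlam
    have hs := hdiv (Complex.abs_im_le_norm lam)
    have hη := hdiv (Complex.abs_re_le_norm lam)
    rw [R.re_eq] at hη
    obtain ⟨S, hbI⟩ := hnd (lam.im / k) (r ^ 2 / k) (hs.trans (min_le_left _ _)) (by positivity)
      (hη.trans (min_le_left _ _))
    exact (R.fluxBound_of_shear hU ht htk hβ hn (hη.trans (min_le_right _ _)) S hb hbI hA
      hD).mono (le_max_right _ _) R.n_pos R.l_pos

theorem Regime.clamped_bound (R : Regime U L k lam r l n) (hU : Profile U U1 U2 W W1 L) {C : ℝ}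
    (hC : FluxBound U U2 k lam r l n C) {f Φ u ω v : ℝ → ℂ}
    (h : Sol (pCoeff U k lam) (qCoeff U2 k) f Φ u ω v) (hf : SqInt f) (hΦ0 : Φ 0 = 0)
    (hΦ1 : Φ 1 = 0) (hu0 : u 0 = 0) (hu1 : u 1 = 0) (hmean : ∫ y in (0 : ℝ)..1, f y = 0) :
    normSq ω * r ^ 4 ≤ (8 * L ^ 4 + 2568 * C) * l * normSq f := by
  have hr : 0 < r := by linarith [R.le_r]
  have hn := R.n_pos
  have hl := R.l_pos
  have hl1 : 1 ≤ l := by linarith [R.le_r, R.r_le_l]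
  obtain ⟨ΦG, uG, ωG, vG, sG, G0, G1, G2, G3, hωG, hCG⟩ :=
    exists_unit_flux hU R.le_r R.two_le R.re_eq R.k_le R.n_pos R.n_sq
  -- Equal fluxes at the two ends: a single multiple of the unit flux solution removes both.
  have hv : v 1 = v 0 := by
    have := h.flux_eq hU.prim hU.prim1 hΦ0 hΦ1
    rw [hu0, hu1, hmean] at this
    linear_combination -this
  have s1 := (h.add (sG.const_mul (-v 0))).congr_force (f' := f) fun y _ => by simp
  have hfin := normSq_nonneg f
  obtain ⟨e1, -⟩ := R.bounds hU s1 hf (by simp [hΦ0, G0]) (by simp [hΦ1, G1]) (by simp [G2])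
    (by simp [G3, hv])
  have e2 := hC _ _ _ _ _ s1 hf (by simp [hΦ0, G0]) (by simp [hΦ1, G1]) (by simp [G2])
    (by simp [G3, hv]) hmean
  set ω₁ : ℝ → ℂ := fun y => ω y + -v 0 * ωG y with hω₁
  -- From `u 0 = 0`, the boundary velocity of the remainder is `-v 0 * uG 0`, and `‖p(0) uG 0‖ ≥
  -- 1/2`.
  have e3 : ‖v 0‖ ^ 2 ≤ 4 * ‖pCoeff U k lam 0 * (u 0 + -v 0 * uG 0)‖ ^ 2 := by
    have : pCoeff U k lam 0 * (u 0 + -v 0 * uG 0) = -(v 0 * (pCoeff U k lam 0 * uG 0)) := by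
      rw [hu0]
      ring
    rw [this, norm_neg, norm_mul]
    have := mul_le_mul_of_nonneg_left hCG (norm_nonneg (v 0))
    nlinarith [norm_nonneg (v 0)]
  have e4 : normSq ω ≤ 2 * normSq ω₁ + 2 * (‖v 0‖ ^ 2 * normSq ωG) := by
    have := s1.vort.sqInt.normSq_add_le (sG.vort.sqInt.const_mul (v 0))
    rw [normSq_const_mul] at this
    refine le_trans (le_of_eq ?_) this
    congr 1
    ext y
    simp [hω₁]
  have e5 : normSq ω₁ * r ^ 4 ≤ 4 * L ^ 4 * normSq f := by
    have := pow_le_pow_left₀ (by positivity) e1 2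
    rw [mul_pow, mul_pow, mul_pow, sqrt_normSq_sq, sqrt_normSq_sq] at this
    linarith
  -- The `n³` of `FluxBound` cancels against the squared norm `321/n³` of the boundary layers; `1284
  -- = 4 · 321`.
  have e6 : ‖v 0‖ ^ 2 * normSq ωG * r ^ 4 ≤ 1284 * C * l * normSq f := by
    calc ‖v 0‖ ^ 2 * normSq ωG * r ^ 4
        ≤ 4 * ‖pCoeff U k lam 0 * (u 0 + -v 0 * uG 0)‖ ^ 2 * (321 / n ^ 3) * r ^ 4 := by
          have := normSq_nonneg ωG
          gcongr
      _ = 1284 / n ^ 3 * (‖pCoeff U k lam 0 * (u 0 + -v 0 * uG 0)‖ ^ 2 * r ^ 4) := by ring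
      _ ≤ 1284 / n ^ 3 * (C * n ^ 3 * l * normSq f) := by gcongr
      _ = _ := by field_simp
  have e7 : 4 * L ^ 4 * normSq f ≤ 4 * L ^ 4 * normSq f * l :=
    le_mul_of_one_le_right (by positivity) hl1
  have e8 := mul_le_mul_of_nonneg_right e4 (by positivity : 0 ≤ r ^ 4)
  linarith

theorem Regime.clamped_unique (R : Regime U L k lam r l n) (hU : Profile U U1 U2 W W1 L) {C : ℝ}
    (hC : FluxBound U U2 k lam r l n C) {Φ u ω v : ℝ → ℂ}
    (h : Sol (pCoeff U k lam) (qCoeff U2 k) (fun _ => 0) Φ u ω v) (hΦ0 : Φ 0 = 0)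
    (hΦ1 : Φ 1 = 0) (hu0 : u 0 = 0) (hu1 : u 1 = 0) : ∀ y ∈ Icc (0 : ℝ) 1, ω y = 0 := by
  have hr : 0 < r := by linarith [R.le_r]
  have e := R.clamped_bound hU hC h (sqInt_of_continuousOn continuousOn_const) hΦ0 hΦ1 hu0 hu1
    (by simp)
  have e2 : normSq (fun _ => (0 : ℂ)) = 0 := by simp [normSq]
  rw [e2, mul_zero] at e
  refine eq_zero_of_normSq_eq_zero h.vort h.flux.sqInt (le_antisymm ?_ (normSq_nonneg ω))
  by_contra hc
  rw [not_le] at hc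
  exact absurd e (not_le.2 (by positivity))

end clamped

/-! ### Smooth strictly concave functions as profiles -/

theorem exists_profile {U : ℝ → ℝ} (hU : ContDiffOn ℝ ((⊤ : ℕ∞) : WithTop ℕ∞) U (Icc 0 1))
    (hconc : ∀ y ∈ Icc (0 : ℝ) 1, iteratedDerivWithin 2 U (Icc 0 1) y < 0) :
    ∃ U1 W W1 L, Profile U U1 (iteratedDerivWithin 2 U (Icc 0 1)) W W1 L := by
  have hs := uniqueDiffOn_Icc (zero_lt_one (α := ℝ))
  have hc (j : ℕ) : ContinuousOn (iteratedDerivWithin j U (Icc 0 1)) (Icc 0 1) :=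
    hU.continuousOn_iteratedDerivWithin (by exact_mod_cast le_top) hs
  have hd (j : ℕ) (y : ℝ) (hy : y ∈ Icc (0 : ℝ) 1) : HasDerivWithinAt
      (iteratedDerivWithin j U (Icc 0 1)) (iteratedDerivWithin (j + 1) U (Icc 0 1) y)
      (Icc 0 1) y := by
    rw [iteratedDerivWithin_succ]
    exact (hU.differentiableOn_iteratedDerivWithin
      (by exact_mod_cast WithTop.coe_lt_top j) hs y hy).hasDerivWithinAt
  have hp (j : ℕ) := IsPrim.of_hasDerivWithinAt (hd j) (hc (j + 1))
  have hp0 := hp 0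
  rw [iteratedDerivWithin_zero, zero_add] at hp0
  have hc0 := hc 0
  rw [iteratedDerivWithin_zero] at hc0
  have hc1 := hc 1
  have hp1 : IsPrim (iteratedDerivWithin 1 U (Icc 0 1)) (iteratedDerivWithin 2 U (Icc 0 1)) := hp 1
  have hc2 := hc 2
  have hc3 := hc 3
  have hd2 (y : ℝ) (hy : y ∈ Icc (0 : ℝ) 1) : HasDerivWithinAt
      (iteratedDerivWithin 2 U (Icc 0 1)) (iteratedDerivWithin 3 U (Icc 0 1) y) (Icc 0 1) y :=
    hd 2 y hy
  clear hp hc hd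
  generalize iteratedDerivWithin 1 U (Icc 0 1) = U1 at *
  generalize iteratedDerivWithin 2 U (Icc 0 1) = U2 at *
  generalize iteratedDerivWithin 3 U (Icc 0 1) = U3 at *
  have hW : ContinuousOn (fun y => (-U2 y)⁻¹) (Icc 0 1) :=
    hc2.neg.inv₀ fun y hy => (neg_pos.2 (hconc y hy)).ne'
  have hW1 : ContinuousOn (fun y => U3 y / (-U2 y) ^ 2) (Icc 0 1) :=
    hc3.div (hc2.neg.pow 2) fun y hy => pow_ne_zero 2 (neg_pos.2 (hconc y hy)).ne'
  obtain ⟨C0, h0⟩ := isCompact_Icc.exists_bound_of_continuousOn hc0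
  obtain ⟨C1, h1⟩ := isCompact_Icc.exists_bound_of_continuousOn hc1
  obtain ⟨C2, h2⟩ := isCompact_Icc.exists_bound_of_continuousOn hc2
  obtain ⟨C3, h3⟩ := isCompact_Icc.exists_bound_of_continuousOn hW
  obtain ⟨C4, h4⟩ := isCompact_Icc.exists_bound_of_continuousOn hW1
  simp only [Real.norm_eq_abs] at h0 h1 h2 h3 h4
  set L := 1 + |C0| + |C1| + |C2| + |C3| + |C4|
  have g0 := abs_nonneg C0
  have g1 := abs_nonneg C1
  have g2 := abs_nonneg C2
  have g3 := abs_nonneg C3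
  have g4 := abs_nonneg C4
  have l0 : C0 ≤ L := (le_abs_self _).trans (by linarith)
  have l1 : C1 ≤ L := (le_abs_self _).trans (by linarith)
  have l2 : C2 ≤ L := (le_abs_self _).trans (by linarith)
  have l3 : C3 ≤ L := (le_abs_self _).trans (by linarith)
  have l4 : C4 ≤ L := (le_abs_self _).trans (by linarith)
  refine ⟨U1, fun y => (-U2 y)⁻¹, fun y => U3 y / (-U2 y) ^ 2, L,
    { one_le := by linarith
      prim := hp0
      prim1 := hp1
      cont2 := hc2
      primW := IsPrim.of_hasDerivWithinAt (fun y hy =>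
        ((hd2 y hy).fun_neg.inv (neg_pos.2 (hconc y hy)).ne').congr_deriv (by ring)) hW1
      weight := fun y hy => by
        have := (hconc y hy).ne
        field_simp
      abs_le := fun y hy => (h0 y hy).trans l0
      abs1_le := fun y hy => (h1 y hy).trans l1
      abs2_le := fun y hy => (h2 y hy).trans l2
      le_W := fun y hy => ?_
      W_le := fun y hy => (le_abs_self _).trans ((h3 y hy).trans l3)
      absW1_le := fun y hy => (h4 y hy).trans l4 }⟩
  rw [one_div]
  exact inv_anti₀ (neg_pos.2 (hconc y hy)) ((neg_le_abs _).trans ((h2 y hy).trans l2))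

/-! ### Solutions of the resolvent equation in `L²` -/

theorem ae_Ioo_iff {P : ℝ → Prop} : (∀ᵐ y ∂(volume.restrict (Ioo (0 : ℝ) 1)), P y) ↔
    ∀ᵐ y ∂(volume.restrict (Ioc (0 : ℝ) 1)), P y := by
  rw [restrict_Ioo_eq_Ioc]

theorem sqInt_coe (f : L2) : SqInt f := by
  rw [SqInt, ← restrict_Ioo_eq_Ioc]
  exact Lp.memLp f

theorem norm_sq_eq_normSq (f : L2) : ‖f‖ ^ 2 = normSq f := by
  rw [← inner_self_eq_norm_sq (𝕜 := ℂ), L2.inner_def, setIntegral_Ioo_eq, normSq]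
  have : ∀ y : ℝ, inner ℂ (f y) (f y) = ((‖f y‖ ^ 2 : ℝ) : ℂ) := fun y => by
    rw [inner_self_eq_norm_sq_to_K]
    norm_cast
  simp only [this]
  rw [intervalIntegral.integral_ofReal]
  rfl

/-- The mean of `f` is the difference of its two boundary velocities. -/
theorem integral_eq_zero_of_mem {f : L2} (hf : f ∈ H) : ∫ y in (0 : ℝ)..1, f y = 0 := by
  have h : boundaryVelocity f = 0 := hf
  rw [boundaryVelocity_eq, Prod.mk_eq_zero] at h
  have h0 := h.1
  have h1 := h.2
  simp only [velocity, intervalIntegral.integral_same] at h0 h1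
  linear_combination h1 - h0

section transfer
variable {U U2 : ℝ → ℝ} {k : ℝ} {lam : ℂ} {f : L2}

/-- Needed for uniqueness: an arbitrary weak solution has a representative to which the estimates
for `Sol` apply. -/
theorem exists_sol_of_isResolventSolution {ω' : L2}
    (h : IsResolventSolution U k lam f ω') :
    ∃ Φ u ω v, Sol (pCoeff U k lam) (qCoeff (iteratedDerivWithin 2 U (Icc 0 1)) k) f Φ u ω v ∧
      Φ 0 = 0 ∧ Φ 1 = 0 ∧ u 0 = 0 ∧ u 1 = 0 ∧
      ∀ᵐ y ∂(volume.restrict (Ioc (0 : ℝ) 1)), ω' y = ω y := by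
  obtain ⟨hb, ω₂, hw, he⟩ := h
  rw [boundaryVelocity_eq, Prod.mk_eq_zero] at hb
  have hi := intervalIntegrable_coe ω'
  obtain ⟨h0, h1, -⟩ := isDirichletSolution_streamFunction hi
  obtain ⟨ω, v, hωv, hv, hae⟩ := exists_isPrim_of_weak hi (intervalIntegrable_coe ω₂)
    (fun φ hφ => by
      rw [← setIntegral_Ioo_eq, ← setIntegral_Ioo_eq]
      exact hw φ hφ.smooth hφ.compact hφ.supp)
  have hu : IsPrim (velocity ω') ω' := (IsPrim.of_integrable hi (velocity ω' 0)).congr_left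
    fun y _ => by simp [velocity]; ring
  rw [ae_Ioo_iff] at he
  refine ⟨streamFunction ω', velocity ω', ω, v, ⟨IsPrim.of_hasDerivWithinAt
    (fun y hy => hasDerivWithinAt_streamFunction hi hy) hu.continuousOn, hu.congr_ae ?_, hωv,
    hv.congr_ae ?_⟩, h0, h1, hb.1, hb.2, hae⟩
  · filter_upwards [hae] with y hy using hy.symm
  · filter_upwards [hae, he] with y hy hy'
    simp only [pCoeff, qCoeff, ← hy]
    linear_combination hy'

theorem exists_isResolventSolution (hU : ContinuousOn U (Icc 0 1))
    (hU2 : ContinuousOn (iteratedDerivWithin 2 U (Icc 0 1)) (Icc 0 1)) {Φ u ω v : ℝ → ℂ}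
    (h : Sol (pCoeff U k lam) (qCoeff (iteratedDerivWithin 2 U (Icc 0 1)) k) f Φ u ω v)
    (hΦ0 : Φ 0 = 0) (hΦ1 : Φ 1 = 0) (hu0 : u 0 = 0) (hu1 : u 1 = 0) :
    ∃ ω' : L2, IsResolventSolution U k lam f ω' ∧
      ∀ᵐ y ∂(volume.restrict (Ioc (0 : ℝ) 1)), ω' y = ω y := by
  have hm : MemLp ω 2 (volume.restrict (Ioo (0 : ℝ) 1)) := by
    rw [restrict_Ioo_eq_Ioc]
    exact h.vort.sqInt
  set g : ℝ → ℂ := fun y => pCoeff U k lam y * ω y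
    - qCoeff (iteratedDerivWithin 2 U (Icc 0 1)) k y * Φ y - f y with hg
  have hm2 : MemLp g 2 (volume.restrict (Ioo (0 : ℝ) 1)) := by
    rw [restrict_Ioo_eq_Ioc]
    have hs : SqInt (fun y => pCoeff U k lam y * ω y
        - qCoeff (iteratedDerivWithin 2 U (Icc 0 1)) k y * Φ y) :=
      sqInt_of_continuousOn (((continuousOn_pCoeff hU k lam).mul h.vort.continuousOn).sub
        ((continuousOn_qCoeff hU2 k).mul h.stream.continuousOn))
    exact MemLp.sub hs (sqInt_coe f)
  have hae : ∀ᵐ y ∂(volume.restrict (Ioc (0 : ℝ) 1)), hm.toLp ω y = ω y := by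
    rw [← restrict_Ioo_eq_Ioc]
    exact hm.coeFn_toLp
  have hae2 : ∀ᵐ y ∂(volume.restrict (Ioc (0 : ℝ) 1)), hm2.toLp g y = g y := by
    rw [← restrict_Ioo_eq_Ioc]
    exact hm2.coeFn_toLp
  have hvel : IsPrim u (hm.toLp ω) := h.vel.congr_ae hae
  have hD : IsDirichletSolution (hm.toLp ω) Φ := ⟨hΦ0, hΦ1, u,
    fun y hy => h.stream.hasDerivWithinAt h.vel.continuousOn hy, hvel.2⟩
  -- Uniqueness for the Dirichlet problem identifies the component `Φ` of the system with the stream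
  -- function of the `L²` class.
  have hS := (isDirichletSolution_streamFunction (intervalIntegrable_coe (hm.toLp ω))).eqOn hD
  have hb {e : ℝ} (he : e ∈ Icc (0 : ℝ) 1) (hue : u e = 0) :
      derivWithin (streamFunction (hm.toLp ω)) (Icc 0 1) e = 0 := by
    rw [derivWithin_congr hS (hS he), ← hue]
    exact (h.stream.hasDerivWithinAt h.vel.continuousOn he).derivWithin
      (uniqueDiffOn_Icc zero_lt_one e he)
  refine ⟨hm.toLp ω, ⟨?_, hm2.toLp g, ?_, ?_⟩, hae⟩
  · rw [boundaryVelocity, hb zero_mem_unit hu0, hb one_mem_unit hu1]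
    rfl
  · intro φ h1 h2 h3
    have hφ : IsTest φ := ⟨h1, h2, h3⟩
    rw [setIntegral_Ioo_eq, setIntegral_Ioo_eq]
    have e := h.vort.integral_deriv_deriv h.flux hφ
    have hI {a b : ℝ → ℂ} (hab : ∀ᵐ y ∂(volume.restrict (Ioc (0 : ℝ) 1)), a y = b y)
        (ψ : ℝ → ℝ) : ∫ y in (0 : ℝ)..1, a y * ((ψ y : ℝ) : ℂ)
          = ∫ y in (0 : ℝ)..1, b y * ((ψ y : ℝ) : ℂ) := by
      rw [intervalIntegral.integral_of_le zero_le_one, intervalIntegral.integral_of_le zero_le_one]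
      refine integral_congr_ae ?_
      filter_upwards [hab] with y hy
      rw [hy]
    rw [hI hae (deriv (deriv φ)), hI hae2 φ]
    exact e
  · rw [ae_Ioo_iff]
    filter_upwards [hae, hae2, ae_restrict_mem measurableSet_Ioc] with y hy hy2 hyI
    rw [hy, hy2, hS (Ioc_subset_Icc_self hyI), hg]
    simp only [pCoeff, qCoeff]
    ring

end transfer

/-! ### Choice of the parameters and proof of the theorem -/

theorem exists_regime {U : ℝ → ℝ} {L k : ℝ} {lam : ℂ} (hL : 1 ≤ L) (hk : 1 ≤ |k|)
    (hlam : (320 * L ^ 3) ^ 2 * |k| ^ (2 / 3 : ℝ) ≤ lam.re) :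
    ∃ n : ℝ, Regime U L k lam √lam.re √‖lam‖ n := by
  have hL0 : 0 < L := one_pos.trans_le hL
  have hk0 : 0 < |k| := one_pos.trans_le hk
  set q := |k| ^ (1 / 3 : ℝ) with hq
  have hq0 : 0 < q := Real.rpow_pos_of_pos hk0 _
  have hq1 : 1 ≤ q := Real.one_le_rpow hk (by norm_num)
  have hq3 : q ^ 3 = |k| := by
    rw [hq, ← Real.rpow_natCast, ← Real.rpow_mul hk0.le]
    norm_num
  have hq2 : |k| ^ (2 / 3 : ℝ) = q ^ 2 := by
    rw [hq, ← Real.rpow_natCast, ← Real.rpow_mul hk0.le]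
    norm_num
  rw [hq2, ← mul_pow] at hlam
  have hre : 0 < lam.re := lt_of_lt_of_le (by positivity) hlam
  have hr : 320 * L ^ 3 * q ≤ √lam.re := Real.le_sqrt_of_sq_le hlam
  have hr2 : √lam.re ^ 2 = lam.re := Real.sq_sqrt hre.le
  have hL3 : 1 ≤ L ^ 3 := one_le_pow₀ hL
  have hLq : 320 * L ^ 3 ≤ √lam.re := le_trans (le_mul_of_one_le_right (by positivity) hq1) hr
  have hp (y : ℝ) : 0 < ‖pCoeff U k lam y‖ := by
    refine hre.trans_le ?_
    have := Complex.re_le_norm (pCoeff U k lam y)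
    simpa [pCoeff] using this
  have hl : 0 < ‖lam‖ := hre.trans_le (Complex.re_le_norm lam)
  refine ⟨√(min ‖pCoeff U k lam 0‖ ‖pCoeff U k lam 1‖), by linarith, ?_, hr2.symm, ?_,
    Real.sqrt_pos.2 hl, Real.sq_sqrt hl.le, Real.sqrt_pos.2 (lt_min (hp 0) (hp 1)),
    Real.sq_sqrt (lt_min (hp 0) (hp 1)).le⟩
  · calc 2 * L ^ 4 ≤ 2 * L ^ 6 := by gcongr; norm_num
      _ ≤ (320 * L ^ 3) ^ 2 := by
        have : 0 ≤ L ^ 6 := by positivity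
        nlinarith
      _ ≤ _ := pow_le_pow_left₀ (by positivity) hLq 2
  -- With `q = |k|^(1/3)` the hypothesis reads `r ≥ 320 L³ q`, and `320³` exceeds `200000`.
  · calc 200000 * L ^ 3 * |k| = 200000 * L ^ 3 * q ^ 3 := by rw [hq3]
      _ ≤ 320 ^ 3 * L ^ 9 * q ^ 3 := by
        gcongr <;> norm_num
      _ = (320 * L ^ 3 * q) ^ 3 := by ring
      _ ≤ _ := pow_le_pow_left₀ (by positivity) hr 3

end HydrostaticNS

end

open HydrostaticNS in
theorem proposition7p1 (U : ℝ → ℝ) (hU : ContDiffOn ℝ ((⊤ : ℕ∞) : WithTop ℕ∞) U (Icc 0 1))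
    (hconc : ∀ y ∈ Icc (0 : ℝ) 1, iteratedDerivWithin 2 U (Icc 0 1) y < 0) :
    ∃ Kstar k₀ M : ℝ, 0 < Kstar ∧ 0 < k₀ ∧ 0 < M ∧
      ∀ (k : ℝ) (lam : ℂ), k₀ ≤ |k| → Kstar * |k| ^ (2 / 3 : ℝ) ≤ lam.re →
        ∀ f : HydrostaticNS.L2, f ∈ HydrostaticNS.H →
          ∃ ω : HydrostaticNS.L2,
            HydrostaticNS.IsResolventSolution U k lam f ω ∧
            (∀ ω' : HydrostaticNS.L2,
              HydrostaticNS.IsResolventSolution U k lam f ω' → ω' = ω) ∧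
            ‖ω‖ ≤ M * ‖lam‖ ^ (1 / 4 : ℝ) * |k| ^ (-(2 / 3) : ℝ) * ‖f‖ := by
  obtain ⟨U1, W, W1, L, hP⟩ := exists_profile hU hconc
  obtain ⟨C, hC0, hC⟩ := hP.exists_fluxBound
  have hL := hP.one_le
  have hL0 : 0 < L := one_pos.trans_le hL
  have hUc := hP.prim.continuousOn
  refine ⟨(320 * L ^ 3) ^ 2, 1, √(8 * L ^ 4 + 2568 * C), by positivity, one_pos,
    Real.sqrt_pos.2 (by positivity), fun k lam hk hlam f hf => ?_⟩
  obtain ⟨n, R⟩ := exists_regime (U := U) hL hk hlam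
  have hFB := hC _ _ _ _ _ R
  have hmean := integral_eq_zero_of_mem hf
  obtain ⟨Φ, u, ω, v, hs, h0, h1, h2, h3⟩ := exists_clamped (continuousOn_pCoeff hUc k lam)
    (continuousOn_qCoeff hP.cont2 k) (intervalIntegrable_coe f)
    (fun Φ u ω v h a b c d => R.clamped_unique hP hFB h a b c d)
  obtain ⟨ω', hω', hae⟩ := exists_isResolventSolution hUc hP.cont2 hs h0 h1 h2 h3
  refine ⟨ω', hω', fun ω'' hω'' => ?_, ?_⟩
  · obtain ⟨Φ', u', w', v', hs', a0, a1, a2, a3, hae'⟩ := exists_sol_of_isResolventSolution hω''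
    have hd := R.clamped_unique hP hFB ((hs'.add (hs.const_mul (-1))).congr_force
      (f' := fun _ => 0) fun y _ => by simp) (by simp [a0, h0]) (by simp [a1, h1])
      (by simp [a2, h2]) (by simp [a3, h3])
    refine Lp.ext (ae_Ioo_iff.2 ?_)
    filter_upwards [hae, hae', ae_restrict_mem measurableSet_Ioc] with y e1 e2 hy
    rw [e1, e2]
    linear_combination hd y (Ioc_subset_Icc_self hy)
  · have key := R.clamped_bound hP hFB hs (sqInt_coe f) h0 h1 h2 h3 hmean
    have e : normSq ω = normSq ω' := by
      unfold normSq
      rw [intervalIntegral.integral_of_le zero_le_one, intervalIntegral.integral_of_le zero_le_one]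
      refine integral_congr_ae ?_
      filter_upwards [hae] with y hy
      rw [hy]
    rw [e, ← norm_sq_eq_normSq, ← norm_sq_eq_normSq] at key
    have hk0 : 0 < |k| := one_pos.trans_le hk
    have hr : 0 < √lam.re := by linarith [R.le_r]
    have hκ : 0 < |k| ^ (2 / 3 : ℝ) := Real.rpow_pos_of_pos hk0 _
    have hr2 : |k| ^ (2 / 3 : ℝ) ≤ √lam.re ^ 2 := by
      rw [← R.re_eq]
      refine le_trans (le_mul_of_one_le_left hκ.le ?_) hlam
      have : 1 ≤ L ^ 3 := one_le_pow₀ hL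
      exact one_le_pow₀ (by linarith)
    have hl : (‖lam‖ ^ (1 / 4 : ℝ)) ^ 2 = √‖lam‖ := by
      rw [Real.sqrt_eq_rpow, ← Real.rpow_natCast, ← Real.rpow_mul (norm_nonneg _)]
      norm_num
    rw [Real.rpow_neg hk0.le]
    have hw : 0 ≤ ‖lam‖ ^ (1 / 4 : ℝ) := Real.rpow_nonneg (norm_nonneg _) _
    have hD : 0 ≤ 8 * L ^ 4 + 2568 * C := by positivity
    -- The square root of the clamped estimate; `l = √‖λ‖` becomes `‖λ‖^(1/4)`, and division by `r²
    -- ≥ |k|^(2/3)` finishes.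
    have h4 : ‖ω'‖ * √lam.re ^ 2 ≤ √(8 * L ^ 4 + 2568 * C) * ‖lam‖ ^ (1 / 4 : ℝ) * ‖f‖ := by
      refine le_of_sq_le_sq ?_ (by positivity)
      rw [mul_pow, mul_pow, mul_pow, hl, Real.sq_sqrt hD]
      linarith
    have h5 := mul_le_mul_of_nonneg_left hr2 (norm_nonneg ω')
    have h6 := h5.trans h4
    rw [← le_div_iff₀ hκ] at h6
    refine h6.trans (le_of_eq ?_)
    ring
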